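/- All graphs are finite, simple and undirected. A path decomposition of a graph $G$ is a sequence of subsets of $V(G)$ (bags) covering all vertices and all edges of $G$, in which the bags containing any fixed vertex are consecutive; its width is the maximum size of a bag minus one, and the pathwidth $\mathrm{pw}(G)$ is the minimum width of a path decomposition of $G$. *Pathwidth Improvement* is the following problem. Input: a graph $G$, an integer $k$ with $2\le k\le |V(G)|$, and a path decomposition $\mathcal P$ of $G$ of width $k-1$. Question: is $\mathrm{pw}(G)\le k-2$? *$k$-Pathwidth* is the parameterized problem: given a graph $G$ and the parameter $k\in\mathbb N$, is $\mathrm{pw}(G)\le k$? Instances are encoded as binary strings (adjacency matrices, unary integers, characteristic vectors of bags). An equivalence relation $\mathcal R$ on $\Sigma^*$ is a *polynomial equivalence relation* if it is decidable in polynomial time and partitions every finite $S\subseteq\Sigma^*$ into a number of classes that is polynomially bounded in $\max_{x\in S}|x|$. A language $L\subseteq\Sigma^*$ *OR-cross-composes* into a parameterized problem $Q\subseteq\Sigma^*\times\mathbb N$ if there are a polynomial equivalence relation $\mathcal R$ and an algorithm that, given $t\ge 1$ strings $x_1,\dots,x_t$ in the same class of $\mathcal R$, computes in time polynomial in the total input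 length an instance $(x^*,k^*)$ such that $(x^*,k^*)\in Q$ if and only if $x_i\in L$ for some $i$, and $k^*$ is bounded by a polynomial in $\max_i|x_i|+\log t$. For $s\in\mathbb N$ let $\widetilde{\mathbb T}^s$ be the graph obtained from the complete ternary tree of height $s$ (with $3^s$ leaves) by attaching to each of its leaves one new pendant vertex. For $k \in \mathbb N$, the inflation $H\diamond k$ of a graph $H$ has vertices $v_1,\dots,v_k$ for every $v\in V(H)$, two distinct vertices $u_i,v_j$ being adjacent iff $u=v$ or $\{u,v\}\in E(H)$. For $s\ge1$, $t=3^s$, let $x^1,\dots,x^t$ be the leaves of $\widetilde{\mathbb T}^s$ and $y^i$ the neighbour of $x^i$. Given $k\ge 2$ and graphs $G_1,\dots,G_t$, let $G'$ be obtained from $\widetilde{\mathbb T}^s\diamond k$ by replacing, for each $i$, the clique $x^i_1,\dots,x^i_k$ by a copy of $G_i$ all of whose vertices are made adjacent to $y^i_1,\dots,y^i_k$; put $k'=k(s+2)-2$. **Theorem.** Pathwidth Improvement OR-cross-composes into $k$-Pathwidth. More precisely: 1. There is an OR-cross-composition of Pathwidth Improvement into $k$-Pathwidth, with respect to a polynomial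 equivalence relation under which any two instances with the same $k$ are equivalent, and there is, for each $s \ge 1$, a labelling $x^1,\dots,x^{3^s}$ of the leaves of $\widetilde{\mathbb T}^s$, such that on any $t=3^s$ instances $(G_1,k,\mathcal P^1),\dots,(G_t,k,\mathcal P^t)$ with $s\ge1$ the output is (the encoding of a graph isomorphic to) $G'$ together with the parameter $k'=k(s+2)-2$. 2. For every $s\ge1$, every labelling of the leaves, and all instances $(G_1,k,\mathcal P^1),\dots,(G_t,k,\mathcal P^t)$ of Pathwidth Improvement with $t=3^s$, one has $\mathrm{pw}(G')\le k(s+2)-2$ if and only if $\mathrm{pw}(G_i)\le k-2$ for some $i\in\{1,\dots,t\}$. -/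

import Mathlib

namespace CrossComp

/-! ### Path decompositions and pathwidth -/

/-- The sequence `bags` of vertex sets is a path decomposition of `G`: the bags cover all vertices
and all edges, and the bags containing a fixed vertex are consecutive. -/
structure IsPathDecomposition {V : Type*} (G : SimpleGraph V) (bags : List (Finset V)) : Prop where
  vertex_mem : ∀ v : V, ∃ B ∈ bags, v ∈ B
  edge_mem : ∀ u v : V, G.Adj u v → ∃ B ∈ bags, u ∈ B ∧ v ∈ B
  convex : ∀ (v : V) (i j l : ℕ) (hij : i ≤ j) (hjl : j ≤ l) (hl : l < bags.length),
    v ∈ bags[i] → v ∈ bags[l] → v ∈ bags[j]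

/-- The width of a sequence of bags: the maximum cardinality of a bag, minus one
(and `0` if all bags are empty, which for a path decomposition only happens when the graph has no
vertices). -/
def width {V : Type*} (bags : List (Finset V)) : ℕ :=
  (bags.map Finset.card).foldr max 0 - 1

/-- The pathwidth of a (finite) graph: the minimum width of its path decompositions. -/
noncomputable def pathwidth {V : Type*} (G : SimpleGraph V) : ℕ :=
  sInf {w | ∃ bags : List (Finset V), IsPathDecomposition G bags ∧ width bags = w}

/-! ### The ternary tree obstruction, inflation, and the combined graph -/

/-- The nodes of the complete ternary tree of height `s`: words of length at most `s` over a
three-letter alphabet. The root is the empty word and the children of `w` are the words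
`a :: w`. -/
abbrev TernaryNode (s : ℕ) : Type := {w : List (Fin 3) // w.length ≤ s}

/-- The leaves of the complete ternary tree of height `s`: words of length exactly `s`. -/
abbrev TernaryLeaf (s : ℕ) : Type := List.Vector (Fin 3) s

/-- The complete ternary tree of height `s`. -/
def ternaryTree (s : ℕ) : SimpleGraph (TernaryNode s) where
  Adj u v := (∃ a : Fin 3, v.1 = a :: u.1) ∨ (∃ a : Fin 3, u.1 = a :: v.1)
  symm := ⟨fun _ _ h => h.symm⟩
  loopless := ⟨fun u h => by
    rcases h with ⟨a, h⟩ | ⟨a, h⟩ <;> simpa using congrArg List.length h⟩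

/-- The complete ternary tree of height `s` together with, for each of its leaves `x`, a new
vertex `Sum.inr x` that is adjacent only to `x`. For `s ≥ 1` the vertices `Sum.inr x` are exactly
the `3 ^ s` leaves of this graph. -/
def ternaryObstruction (s : ℕ) : SimpleGraph (TernaryNode s ⊕ TernaryLeaf s) where
  Adj
    | .inl u, .inl v => (ternaryTree s).Adj u v
    | .inl u, .inr x => u.1 = x.1
    | .inr x, .inl u => u.1 = x.1
    | .inr _, .inr _ => False
  symm := ⟨fun a b h => by
    rcases a with u | x <;> rcases b with v | y
    · exact (show (ternaryTree s).Adj _ _ from h).symm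
    · exact h
    · exact h
    · exact h⟩
  loopless := ⟨fun a h => by
    rcases a with u | x
    · exact (ternaryTree s).irrefl h
    · exact h⟩

/-- The inflation of `G` by `k`: each vertex `v` is replaced by its copies `(v, 0), …, (v, k - 1)`,
and two distinct copies are adjacent if they are copies of the same vertex or of adjacent
vertices. -/
def inflation {V : Type*} (G : SimpleGraph V) (k : ℕ) : SimpleGraph (V × Fin k) where
  Adj p q := p ≠ q ∧ (p.1 = q.1 ∨ G.Adj p.1 q.1)
  symm := ⟨fun _ _ h => ⟨h.1.symm, h.2.imp Eq.symm fun e => e.symm⟩⟩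
  loopless := ⟨fun _ h => h.1 rfl⟩

/-- The combined graph: in the inflation by `k` of a graph `H`, the copies of each vertex
`Sum.inr x` are removed and replaced by the graph `G x`, all of whose vertices are made adjacent to
all copies of the neighbours of `Sum.inr x` that are of the form `Sum.inl u`. -/
def plug {N X : Type*} (H : SimpleGraph (N ⊕ X)) (k : ℕ) {V : X → Type*}
    (G : ∀ x, SimpleGraph (V x)) : SimpleGraph ((N × Fin k) ⊕ (Σ x, V x)) where
  Adj
    | .inl p, .inl q => (inflation H k).Adj (.inl p.1, p.2) (.inl q.1, q.2)
    | .inl p, .inr q => H.Adj (.inl p.1) (.inr q.1)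
    | .inr p, .inl q => H.Adj (.inl q.1) (.inr p.1)
    | .inr p, .inr q => ∃ (x : X) (u v : V x), p = ⟨x, u⟩ ∧ q = ⟨x, v⟩ ∧ (G x).Adj u v
  symm := ⟨fun a b h => by
    rcases a with p | p <;> rcases b with q | q
    · exact (show (inflation H k).Adj _ _ from h).symm
    · exact h
    · exact h
    · obtain ⟨x, u, v, hp, hq, huv⟩ := h
      exact ⟨x, v, u, hq, hp, huv.symm⟩⟩
  loopless := ⟨fun a h => by
    rcases a with p | p
    · exact (inflation H k).irrefl h
    · obtain ⟨x, u, v, hp, hq, huv⟩ := h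
      rw [hp] at hq
      obtain rfl : u = v := by simpa using hq
      exact (G x).irrefl huv⟩

/-- The graph obtained from the inflation by `k` of the ternary obstruction by replacing, for each
leaf `x`, the clique of its `k` copies by the graph `G x`. -/
abbrev combinedGraph (s k : ℕ) {V : TernaryLeaf s → Type*} (G : ∀ x, SimpleGraph (V x)) :
    SimpleGraph ((TernaryNode s × Fin k) ⊕ (Σ x, V x)) :=
  plug (ternaryObstruction s) k G

/-! ### Polynomial equivalence relations and OR-cross-compositions -/

/-- A finite sequence of strings over `A`, written as one string in which `none` terminates each
member of the sequence. -/
def encodeStrings {A : Type} (xs : List (List A)) : List (Option A) :=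
  xs.flatMap fun x => x.map some ++ [none]

/-- The self-delimiting unary code `1 ⋯ 1 0` of a natural number. -/
def unaryCode (n : ℕ) : List Bool := List.replicate n true ++ [false]

/-- An instance `(x, k)` of a parameterized problem over `{0, 1}` as one string;
its length is `|x| + k + 1`. -/
def encodeParam (p : List Bool × ℕ) : List Bool := unaryCode p.2 ++ p.1

/-- The maximum length of the strings in a list. -/
def maxLength {A : Type} (xs : List (List A)) : ℕ := (xs.map List.length).foldr max 0

open Classical in
/-- An equivalence relation on strings is a polynomial equivalence relation if it can be decided
in polynomial time by a Turing machine and if it partitions any finite set of strings into a number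
of classes that is polynomially bounded in the maximum length of the strings in the set. -/
structure IsPolynomialEquivalence (R : Setoid (List Bool)) : Prop where
  decide_polyTime : Nonempty (Turing.TM2ComputableInPolyTime
    (fun p : List Bool × List Bool => encodeStrings [p.1, p.2]) Computability.encodeBool
    (fun p => decide (R p.1 p.2)))
  card_classes_le : ∃ P : Polynomial ℕ, ∀ S : Finset (List Bool),
    (Quotient.mk R '' (S : Set (List Bool))).ncard ≤ P.eval (S.sup List.length)

/-- The sequences that may be input to an OR-cross-composition with respect to `R`: `t ≥ 1` strings
that all belong to the same class. -/
def SameClass (R : Setoid (List Bool)) (xs : List (List Bool)) : Prop :=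
  xs ≠ [] ∧ ∀ x ∈ xs, ∀ y ∈ xs, R x y

/-- `f` is an OR-cross-composition of the language `L` into the parameterized problem `Q`, with
respect to the equivalence relation `R`: on sequences of equivalent strings it is computable by a
Turing machine in time polynomial in the length of the input sequence, its output is a
yes-instance iff some input string is, and the output parameter is polynomially bounded in the
maximum length of an input string plus the logarithm of the number of input strings. -/
structure IsORCrossComposition (R : Setoid (List Bool)) (f : List (List Bool) → List Bool × ℕ)
    (L : Set (List Bool)) (Q : Set (List Bool × ℕ)) : Prop where
  polyTime : Nonempty (Turing.TM2ComputableInPolyTime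
    (fun xs : {xs : List (List Bool) // SameClass R xs} => encodeStrings xs.1) encodeParam
    (fun xs => f xs.1))
  mem_iff : ∀ xs, SameClass R xs → (f xs ∈ Q ↔ ∃ x ∈ xs, x ∈ L)
  param_le : ∃ P : Polynomial ℕ, ∀ xs, SameClass R xs →
    (f xs).2 ≤ P.eval (maxLength xs + Nat.log 2 xs.length)

/-! ### The two problems -/

open Classical in
/-- A graph on `Fin n` as a string: `n` in unary, followed by the adjacency matrix. -/
noncomputable def encodeGraph {n : ℕ} (G : SimpleGraph (Fin n)) : List Bool :=
  unaryCode n ++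
    (List.finRange n).flatMap fun u => (List.finRange n).map fun v => decide (G.Adj u v)

/-- An instance of Pathwidth Improvement: a graph `G` on `n` vertices, an integer `k` with
`2 ≤ k ≤ n`, and a path decomposition of `G` of width `k - 1`. -/
structure ImprovementInstance where
  n : ℕ
  graph : SimpleGraph (Fin n)
  k : ℕ
  bags : List (Finset (Fin n))
  two_le : 2 ≤ k
  le_card : k ≤ n
  isPathDecomposition : IsPathDecomposition graph bags
  width_eq : width bags = k - 1

/-- An instance of Pathwidth Improvement as a string: the graph, followed by `k` in unary, the
number of bags in unary, and the characteristic vectors of the bags. -/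
noncomputable def ImprovementInstance.encode (I : ImprovementInstance) : List Bool :=
  encodeGraph I.graph ++ unaryCode I.k ++ unaryCode I.bags.length ++
    I.bags.flatMap fun B => (List.finRange I.n).map fun v => decide (v ∈ B)

/-- The language of Pathwidth Improvement: is the pathwidth of `G` at most `k - 2`? -/
def pathwidthImprovement : Set (List Bool) :=
  {x | ∃ I : ImprovementInstance, x = I.encode ∧ pathwidth I.graph ≤ I.k - 2}

/-- The parameterized problem `k`-Pathwidth: is the pathwidth of `G` at most the parameter `k`? -/
def kPathwidth : Set (List Bool × ℕ) :=
  {p | ∃ (n : ℕ) (G : SimpleGraph (Fin n)), p.1 = encodeGraph G ∧ pathwidth G ≤ p.2}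

end CrossComp

/-! Correctness of the construction rests on two inductions over the ternary tree. For a node `w` at
distance `h` from the leaves, consider the vertices at the descendants of `w`, together with the
clique of `k` vertices at `w` itself. Path decompositions are handled as interval representations:
each vertex is assigned an interval of positions, adjacent vertices get intersecting intervals, and
the bag at a position consists of the vertices whose interval contains it (`pathwidth_le_iff`).

If no plugged-in graph has pathwidth at most `k - 2`, every decomposition has a bag with at least
`k(h+2)` vertices of the subtree of `w` (`exists_bag_subtree`). At a leaf, the clique has a common
interval that every interval of the plugged-in graph meets; a bag inside it contains the whole
clique, and one of these has at least `k` further vertices (`exists_bag_leaf`). At an inner node,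
take the large bags of the three children and look at the middle one. If it had fewer than `k`
vertices outside the middle child's subtree, the rest of the other two subtrees and of the clique of
`w` would be connected after deleting this bag, hence lie on one side of it (`exists_side`); but the
other two large bags supply vertices on both sides.

Conversely, the given decompositions of width `k - 1` yield bags of size `k(h+2)` for every subtree,
at a cost of `k` per level for the parent clique (`hasRep_subtreeSet`). If one `G x` has pathwidth
at most `k - 2`, one unit is saved at the leaf `x`, and it can be kept all the way up to the root
(`hasRep_subtreeSet_of_suffix`): at each node on the path, the two other child subtrees are placed
at the two ends, where the parent clique need not be present, and only the cheaper middle child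
shares bags with that clique.

Computability in polynomial time means computability by an actual Turing machine. It is obtained
once and for all for words whose length and letters are values of arithmetic expressions over the
input with bounded sums (`Expr.nonempty_polyTime`). Such expressions are evaluated by structured
programs on unary registers, which are compiled to jump code and simulated step by step by a machine
with one stack per register. Parsing, validity of instances, the tree and the adjacency matrix of
the output are all written as expressions.

The composition must also handle sequences whose number is not a power of three, and strings that
encode no instance. Such leaves receive a clique on `k` vertices, whose pathwidth `k - 1` respects
the upper bound and never creates a yes-instance. The equivalence relation compares the parsed
parameter `k`, so a sequence of equivalent strings has one common `k`. -/

namespace CrossComp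

open Function

/-! ### A structured programming language and its compilation to Turing machines -/

/-- A memory state: unary registers, a two-sided view of the read-only input, and the output. -/
@[ext] structure Store where
  reg : ℕ → ℕ
  inp : List (Option Bool)
  shadow : List (Option Bool)
  out : List Bool

/-- The sources on whose emptiness a loop may be controlled. -/
inductive Source
  | reg (r : ℕ)
  | inp
  | shadow

/-- Take one symbol from a source, if there is one. Symbols of the input move to the shadow. -/
def Store.pop (s : Store) : Source → Option Store
  | .reg r => if s.reg r = 0 then none else some { s with reg := update s.reg r (s.reg r - 1) }
  | .inp => match s.inp with
    | [] => none
    | a :: l => some { s with inp := l, shadow := a :: s.shadow }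
  | .shadow => match s.shadow with
    | [] => none
    | _ :: l => some { s with shadow := l }

/-- The code of an input symbol; `0` stands for the end of the input. -/
def symbolCode : Option (Option Bool) → ℕ
  | none => 0
  | some none => 1
  | some (some false) => 2
  | some (some true) => 3

/-- The basic operations. -/
inductive Op
  | inc (r : ℕ)
  | pop (c : Source)
  | left
  | load (r : ℕ)
  | emit (r : ℕ)

/-- The effect of a basic operation. -/
def Op.apply : Op → Store → Store
  | .inc r, s => { s with reg := update s.reg r (s.reg r + 1) }
  | .pop c, s => (s.pop c).getD s
  | .left, s => match s.shadow with
    | [] => s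
    | a :: l => { s with inp := a :: s.inp, shadow := l }
  | .load r, s => { s with reg := update s.reg r (s.reg r + symbolCode s.inp.head?) }
  | .emit r, s => { s with
      reg := update s.reg r (s.reg r - 1)
      out := decide (s.reg r ≠ 0) :: s.out }

/-- Structured programs. -/
inductive Prog
  | skip
  | op (o : Op)
  | seq (p q : Prog)
  | loop (c : Source) (p : Prog)

/-- `Exec p s s' t`: the program `p` takes the store `s` to `s'` in exactly `t` steps. -/
inductive Exec : Prog → Store → Store → ℕ → Prop
  | skip (s) : Exec .skip s s 0
  | op (o s) : Exec (.op o) s (o.apply s) 1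
  | seq {p q s s' s'' t t'} : Exec p s s' t → Exec q s' s'' t' → Exec (.seq p q) s s'' (t + t')
  | done {c p s} : s.pop c = none → Exec (.loop c p) s s 1
  | step {c p s s₁ s₂ s₃ t t'} : s.pop c = some s₁ → Exec p s₁ s₂ t →
      Exec (.loop c p) s₂ s₃ t' → Exec (.loop c p) s s₃ (1 + t + 1 + t')

/-- Instructions of an assembly language with absolute jumps. -/
inductive Instr
  | op (o : Op)
  | jz (c : Source) (l : ℕ)
  | jmp (l : ℕ)

/-- When `jz` does not jump it consumes the symbol it has tested, so the test of a loop is at the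
same time the decrement of its counter. -/
def Instr.exec : Instr → ℕ × Store → ℕ × Store
  | .op o, (pc, s) => (pc + 1, o.apply s)
  | .jz c l, (pc, s) => match s.pop c with
    | none => (l, s)
    | some s' => (pc + 1, s')
  | .jmp l, (_, s) => (l, s)

def Prog.size : Prog → ℕ
  | .skip => 0
  | .op _ => 1
  | .seq p q => p.size + q.size
  | .loop _ p => p.size + 2

/-- The second argument is the address at which the code will stand; it is needed because jumps are
absolute. -/
def Prog.compile : Prog → ℕ → List Instr
  | .skip, _ => []
  | .op o, _ => [.op o]
  | .seq p q, a => p.compile a ++ q.compile (a + p.size)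
  | .loop c p, a => .jz c (a + p.size + 2) :: (p.compile (a + 1) ++ [.jmp a])

theorem Prog.length_compile (p : Prog) (a : ℕ) : (p.compile a).length = p.size := by
  induction p generalizing a <;> simp_all [compile, size]

/-- `AsmRun code c c' t`: the code leads from `c` to `c'` in `t` steps. -/
inductive AsmRun (code : List Instr) : ℕ × Store → ℕ × Store → ℕ → Prop
  | refl (c) : AsmRun code c c 0
  | step {c c' i t} : code[c.1]? = some i → AsmRun code (i.exec c) c' t → AsmRun code c c' (t + 1)

theorem AsmRun.trans {code c c' c'' t t'} (h : AsmRun code c c' t) (h' : AsmRun code c' c'' t') :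
    AsmRun code c c'' (t + t') := by
  induction h with
  | refl => simpa using h'
  | step hi _ ih => rw [Nat.add_right_comm]; exact .step hi (ih h')

theorem AsmRun.single {code c i} (h : code[c.1]? = some i) : AsmRun code c (i.exec c) 1 :=
  .step h (.refl _)

/-- The surrounding code is arbitrary so that the induction can descend into subprograms. Step
counts agree exactly, since `Exec` charges one unit for each loop test and one for each jump back.
-/
theorem Exec.asmRun {p s s' t} (h : Exec p s s' t) (pre post : List Instr) :
    AsmRun (pre ++ p.compile pre.length ++ post) (pre.length, s) (pre.length + p.size, s') t := by
  induction h generalizing pre post with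
  | skip s => exact .refl _
  | op o s => exact AsmRun.single (c := (pre.length, s)) (i := .op o) (by simp [Prog.compile])
  | @seq p q s s' s'' t t' _ _ ih₁ ih₂ =>
    have h₁ := ih₁ pre (q.compile (pre.length + p.size) ++ post)
    have h₂ := ih₂ (pre ++ p.compile pre.length) post
    simp only [List.length_append, Prog.length_compile] at h₂
    simp only [Prog.compile, Prog.size, List.append_assoc, ← Nat.add_assoc] at h₁ h₂ ⊢
    exact h₁.trans h₂
  | @done c p s hs =>
    have h := AsmRun.single (code := pre ++ (Prog.loop c p).compile pre.length ++ post)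
      (c := (pre.length, s)) (i := .jz c (pre.length + p.size + 2)) (by simp [Prog.compile])
    simpa [Instr.exec, hs, Prog.size, ← Nat.add_assoc] using h
  | @step c p s s₁ s₂ s₃ t t' hs _ _ ih₁ ih₂ =>
    have h₀ := AsmRun.single (code := pre ++ (Prog.loop c p).compile pre.length ++ post)
      (c := (pre.length, s)) (i := .jz c (pre.length + p.size + 2)) (by simp [Prog.compile])
    have h₁ := ih₁ (pre ++ [.jz c (pre.length + p.size + 2)]) ([.jmp pre.length] ++ post)
    have h₂ := AsmRun.single (code := pre ++ (Prog.loop c p).compile pre.length ++ post)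
      (c := (pre.length + 1 + p.size, s₂)) (i := .jmp pre.length) (by
        simp only [Prog.compile]
        rw [List.append_assoc, List.getElem?_append_right (by omega)]
        rw [show pre.length + 1 + p.size - pre.length = p.size + 1 by omega, List.cons_append,
          List.getElem?_cons_succ, List.append_assoc,
          List.getElem?_append_right (by simp [Prog.length_compile])]
        simp [Prog.length_compile])
    simp only [Instr.exec, hs] at h₀ h₂
    simp only [List.length_append, List.length_singleton] at h₁
    refine ((h₀.trans ?_).trans h₂).trans (ih₂ pre post)
    simpa [Prog.compile] using h₁

/-! #### The Turing machine of a program -/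

/-- The stacks of the machine of a program with `M` registers. -/
inductive StackName (M : ℕ)
  | inp
  | shadow
  | out
  | reg (i : Fin M)
  deriving DecidableEq, Fintype

abbrev StackName.Symbol {M : ℕ} : StackName M → Type
  | .inp => Option Bool
  | .shadow => Option Bool
  | .out => Bool
  | .reg _ => Unit

/-- The contents of the stacks that represents a store. -/
def Store.stacks (M : ℕ) (s : Store) : ∀ k : StackName M, List k.Symbol
  | .inp => s.inp
  | .shadow => s.shadow
  | .out => s.out
  | .reg i => List.replicate (s.reg i) ()

abbrev MachineStmt (M L : ℕ) : Type :=
  Turing.TM2.Stmt (K := StackName M) StackName.Symbol (Fin (L + 1)) (Option (Option Bool))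

open Turing.TM2.Stmt

/-- Clear the local variable and jump. -/
def jumpTo (M L : ℕ) (l : ℕ) : MachineStmt M L :=
  .load (fun _ => none) (.goto fun _ => Fin.ofNat (L + 1) l)

/-- The stack of a register (junk if the machine does not have this register). -/
def regStack (M r : ℕ) (q : (i : Fin M) → MachineStmt M L) : MachineStmt M L :=
  if h : r < M then q ⟨r, h⟩ else .halt

/-- The local variable records whether a symbol was found. For the input it also carries the symbol,
which is pushed onto the shadow stack so that the head can move back later. -/
def popStmt (M L : ℕ) (c : Source) (l l' : ℕ) : MachineStmt M L :=
  match c with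
  | .reg r => regStack M r fun i => .pop (.reg i) (fun _ a => a.map fun _ => none)
      (.branch Option.isSome (jumpTo M L l) (jumpTo M L l'))
  | .inp => .pop .inp (fun _ a => a)
      (.branch Option.isSome (.push .shadow (fun v => v.getD none) (jumpTo M L l)) (jumpTo M L l'))
  | .shadow => .pop .shadow (fun _ a => a)
      (.branch Option.isSome (jumpTo M L l) (jumpTo M L l'))

def pushTimes (M L : ℕ) (i : Fin M) : ℕ → MachineStmt M L → MachineStmt M L
  | 0, q => q
  | n + 1, q => .push (.reg i) (fun _ => ()) (pushTimes M L i n q)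

def Op.stmt (M L : ℕ) (l : ℕ) : Op → MachineStmt M L
  | .inc r => regStack M r fun i => .push (.reg i) (fun _ => ()) (jumpTo M L l)
  | .pop c => popStmt M L c l l
  | .left => .pop .shadow (fun _ a => a)
      (.branch Option.isSome (.push .inp (fun v => v.getD none) (jumpTo M L l)) (jumpTo M L l))
  | .load r => regStack M r fun i => .peek .inp (fun _ a => a)
      (.branch (fun v => v == none) (jumpTo M L l)
        (.branch (fun v => v == some none) (pushTimes M L i 1 (jumpTo M L l))
          (.branch (fun v => v == some (some false)) (pushTimes M L i 2 (jumpTo M L l))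
            (pushTimes M L i 3 (jumpTo M L l)))))
  | .emit r => regStack M r fun i => .pop (.reg i) (fun _ a => a.map fun _ => none)
      (.push .out (fun v => v.isSome) (jumpTo M L l))

def Instr.stmt (M L : ℕ) (pc : ℕ) : Instr → MachineStmt M L
  | .op o => o.stmt M L (pc + 1)
  | .jz c l => popStmt M L c (pc + 1) l
  | .jmp l => jumpTo M L l

/-- The Turing machine that runs the given code. -/
def machine (M : ℕ) (code : List Instr) : Turing.FinTM2 where
  K := StackName M
  k₀ := .inp
  k₁ := .out
  Γ := StackName.Symbol
  Λ := Fin (code.length + 1)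
  main := 0
  σ := Option (Option Bool)
  initialState := none
  Γk₀Fin := inferInstanceAs (Fintype (Option Bool))
  m l := if h : l.1 < code.length then code[l.1].stmt M code.length l else .halt

/-- The registers that occur in a source are below `M`. -/
def Source.RegsLt (M : ℕ) : Source → Prop
  | .reg r => r < M
  | _ => True

def Op.RegsLt (M : ℕ) : Op → Prop
  | .inc r => r < M
  | .pop c => c.RegsLt M
  | .left => True
  | .load r => r < M
  | .emit r => r < M

def Instr.RegsLt (M : ℕ) : Instr → Prop
  | .op o => o.RegsLt M
  | .jz c _ => c.RegsLt M
  | .jmp _ => True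

theorem update_stacks_reg (M : ℕ) (s : Store) (i : Fin M) (n : ℕ) (l : List Unit)
    (hl : l.length = n) :
    update (s.stacks M) (.reg i) l = ({ s with reg := update s.reg i n } : Store).stacks M := by
  funext k
  rcases k with _ | _ | _ | j
  · rfl
  · rfl
  · rfl
  · by_cases h : j = i
    · subst h
      subst hl
      simp only [update_self, Store.stacks]
      exact List.eq_replicate_of_mem fun _ _ => rfl
    · have h' : (j : ℕ) ≠ i := fun e => h (Fin.ext e)
      simp [Store.stacks, h, h']

theorem update_stacks_inp (M : ℕ) (s : Store) (l : List (Option Bool)) :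
    update (s.stacks M) .inp l = ({ s with inp := l } : Store).stacks M := by
  funext k; rcases k with _ | _ | _ | j <;> simp [Store.stacks]

theorem update_stacks_shadow (M : ℕ) (s : Store) (l : List (Option Bool)) :
    update (s.stacks M) .shadow l = ({ s with shadow := l } : Store).stacks M := by
  funext k; rcases k with _ | _ | _ | j <;> simp [Store.stacks]

theorem update_stacks_out (M : ℕ) (s : Store) (l : List Bool) :
    update (s.stacks M) .out l = ({ s with out := l } : Store).stacks M := by
  funext k; rcases k with _ | _ | _ | j <;> simp [Store.stacks]

abbrev machineCfg (M L : ℕ) (c : ℕ × Store) :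
    Turing.TM2.Cfg (K := StackName M) StackName.Symbol (Fin (L + 1)) (Option (Option Bool)) :=
  ⟨some (Fin.ofNat (L + 1) c.1), none, c.2.stacks M⟩

open Turing.TM2 in
theorem stepAux_popStmt (M L : ℕ) (c : Source) (hc : c.RegsLt M) (l l' : ℕ) (s : Store) :
    stepAux (popStmt M L c l l') none (s.stacks M) =
      match s.pop c with
      | none => machineCfg M L (l', s)
      | some s' => machineCfg M L (l, s') := by
  rcases c with r | _ | _
  · have hr : r < M := hc
    rcases h : s.reg r with _ | n
    · have h0 : s.stacks M (.reg ⟨r, hr⟩) = [] := by simp [Store.stacks, h]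
      have hu := update_eq_self (StackName.reg ⟨r, hr⟩) (s.stacks M)
      rw [h0] at hu
      simp [popStmt, regStack, hr, Store.pop, h, jumpTo, h0, hu]
    · have h0 : s.stacks M (.reg ⟨r, hr⟩) = () :: List.replicate n () := by
        simp [Store.stacks, h, List.replicate_succ]
      simp [popStmt, regStack, hr, Store.pop, h, jumpTo, h0,
        update_stacks_reg M s ⟨r, hr⟩ n (List.replicate n ()) (by simp)]
  · rcases h : s.inp with _ | ⟨a, l⟩
    · have h0 : s.stacks M .inp = [] := by simp [Store.stacks, h]
      have hu := update_eq_self StackName.inp (s.stacks M)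
      rw [h0] at hu
      simp [popStmt, Store.pop, h, jumpTo, h0, hu]
    · have h0 : s.stacks M .inp = a :: l := by simp [Store.stacks, h]
      simp only [popStmt, jumpTo, stepAux, h0, Store.pop, h, update_stacks_inp, List.head?_cons,
        List.tail_cons, Option.isSome_some, cond_true, Option.getD_some]
      have h1 : ({ s with inp := l } : Store).stacks M .shadow = s.shadow := rfl
      rw [h1, update_stacks_shadow]
  · rcases h : s.shadow with _ | ⟨a, l⟩
    · have h0 : s.stacks M .shadow = [] := by simp [Store.stacks, h]
      have hu := update_eq_self StackName.shadow (s.stacks M)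
      rw [h0] at hu
      simp [popStmt, Store.pop, h, jumpTo, h0, hu]
    · have h0 : s.stacks M .shadow = a :: l := by simp [Store.stacks, h]
      simp only [popStmt, jumpTo, stepAux, h0, Store.pop, h, update_stacks_shadow, List.head?_cons,
        List.tail_cons, Option.isSome_some, cond_true]

open Turing.TM2 in
theorem stepAux_pushTimes (M L : ℕ) (i : Fin M) (n l : ℕ) (v : Option (Option Bool)) (s : Store) :
    stepAux (pushTimes M L i n (jumpTo M L l)) v (s.stacks M) =
      machineCfg M L (l, { s with reg := update s.reg i (s.reg i + n) }) := by
  induction n generalizing s with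
  | zero => simp [pushTimes, jumpTo]
  | succ n ih =>
    rw [pushTimes, stepAux, update_stacks_reg M s i (s.reg i + 1) _ (by simp [Store.stacks]), ih]
    simp [Nat.add_assoc, Nat.add_comm 1 n]

-- Each instruction is a single machine statement, so one instruction takes exactly one machine
-- step. The local variable is empty before and after it, which is why a configuration is determined
-- by the program counter and the store.
open Turing.TM2 in
theorem stepAux_stmt (M L : ℕ) (i : Instr) (hi : i.RegsLt M) (pc : ℕ) (s : Store) :
    stepAux (i.stmt M L pc) none (s.stacks M) = machineCfg M L (i.exec (pc, s)) := by
  rcases i with o | ⟨c, l⟩ | l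
  · rcases o with r | c | _ | r | r
    · have hr : r < M := hi
      simp only [Instr.stmt, Op.stmt, regStack, hr, dif_pos]
      exact stepAux_pushTimes M L ⟨r, hr⟩ 1 (pc + 1) none s
    · rw [Instr.stmt, Op.stmt, stepAux_popStmt _ _ _ hi]
      simp only [Instr.exec, Op.apply]
      cases s.pop c <;> rfl
    · rcases h : s.shadow with _ | ⟨a, l⟩
      · have h0 : s.stacks M .shadow = [] := by simp [Store.stacks, h]
        have hu := update_eq_self StackName.shadow (s.stacks M)
        rw [h0] at hu
        simp [Instr.stmt, Op.stmt, Instr.exec, Op.apply, h, jumpTo, h0, hu]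
      · have h0 : s.stacks M .shadow = a :: l := by simp [Store.stacks, h]
        simp only [Instr.stmt, Op.stmt, Instr.exec, Op.apply, jumpTo, stepAux, h0, h,
          update_stacks_shadow, List.head?_cons, List.tail_cons, Option.isSome_some, cond_true,
          Option.getD_some]
        have h1 : ({ s with shadow := l } : Store).stacks M .inp = s.inp := rfl
        rw [h1, update_stacks_inp]
    · have hr : r < M := hi
      have h0 : s.stacks M .inp = s.inp := rfl
      simp only [Instr.stmt, Op.stmt, regStack, hr, dif_pos, stepAux, Instr.exec, Op.apply, h0]
      rcases s.inp.head? with _ | _ | _ | _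
      · simp [symbolCode, jumpTo]
      · simpa [symbolCode] using stepAux_pushTimes M L ⟨r, hr⟩ 1 (pc + 1) (some none) s
      · simpa [symbolCode] using stepAux_pushTimes M L ⟨r, hr⟩ 2 (pc + 1) (some (some false)) s
      · simpa [symbolCode] using stepAux_pushTimes M L ⟨r, hr⟩ 3 (pc + 1) (some (some true)) s
    · have hr : r < M := hi
      have hl : (s.stacks M (.reg ⟨r, hr⟩)).tail.length = s.reg r - 1 := by simp [Store.stacks]
      have hh : ((s.stacks M (.reg ⟨r, hr⟩)).head?.map
          fun _ => (none : Option Bool)).isSome = decide (s.reg r ≠ 0) := by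
        rcases h : s.reg r <;> simp [Store.stacks, h, List.replicate_succ]
      simp only [Instr.stmt, Op.stmt, regStack, hr, dif_pos, stepAux, Instr.exec, Op.apply, jumpTo,
        update_stacks_reg M s ⟨r, hr⟩ (s.reg r - 1) _ hl, hh]
      have h1 : ({ s with reg := update s.reg r (s.reg r - 1) } : Store).stacks M .out = s.out := rfl
      rw [h1, update_stacks_out]
  · rw [Instr.stmt, stepAux_popStmt _ _ _ hi]
    simp only [Instr.exec]
    cases s.pop c <;> rfl
  · simp [Instr.stmt, jumpTo, Instr.exec]

/-- The iteration of the step function of a machine. -/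
def iterStep (tm : Turing.FinTM2) (n : ℕ) (c : tm.Cfg) : Option tm.Cfg :=
  (flip bind tm.step)^[n] (some c)

theorem iterStep_succ {tm : Turing.FinTM2} (n : ℕ) {c c' : tm.Cfg} (h : tm.step c = some c') :
    iterStep tm (n + 1) c = iterStep tm n c' := by
  unfold iterStep
  rw [iterate_succ_apply, ← h]
  rfl

theorem iterStep_succ' {tm : Turing.FinTM2} (n : ℕ) {c c' c'' : tm.Cfg}
    (h : iterStep tm n c = some c') (h' : tm.step c' = some c'') :
    iterStep tm (n + 1) c = some c'' := by
  unfold iterStep at *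
  rw [iterate_succ_apply', h, ← h']
  rfl

theorem AsmRun.machine {M code c c' t} (h : AsmRun code c c' t)
    (hM : ∀ i ∈ code, i.RegsLt M) :
    iterStep (machine M code) t (machineCfg M code.length c) =
      some (machineCfg M code.length c') := by
  induction h with
  | refl => rfl
  | @step c c' i t hi _ ih =>
    obtain ⟨hlt, he⟩ := List.getElem?_eq_some_iff.1 hi
    -- Labels are program counters reduced by `Fin.ofNat`; an address that holds an instruction is
    -- unaffected by the reduction.
    have hmod : c.1 % (code.length + 1) = c.1 := Nat.mod_eq_of_lt (by omega)
    rw [← ih]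
    refine iterStep_succ t ?_
    change some (Turing.TM2.stepAux ((CrossComp.machine M code).m (Fin.ofNat (code.length + 1) c.1))
      none (c.2.stacks M)) = _
    have hm : (CrossComp.machine M code).m (Fin.ofNat (code.length + 1) c.1) =
        i.stmt M code.length c.1 := by
      simp [CrossComp.machine, hmod, hlt, he]
    rw [hm]
    exact congrArg some (stepAux_stmt M code.length i (hM i (he ▸ List.getElem_mem hlt)) c.1 c.2)

/-- A strict upper bound on the registers that occur in a source. -/
def Source.bound : Source → ℕ
  | .reg r => r + 1
  | _ => 0

def Op.bound : Op → ℕ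
  | .inc r => r + 1
  | .pop c => c.bound
  | .left => 0
  | .load r => r + 1
  | .emit r => r + 1

def Prog.bound : Prog → ℕ
  | .skip => 0
  | .op o => o.bound
  | .seq p q => max p.bound q.bound
  | .loop c p => max c.bound p.bound

theorem Source.regsLt_of_bound_le {M : ℕ} (c : Source) (h : c.bound ≤ M) : c.RegsLt M := by
  cases c <;> simp_all [bound, RegsLt]

theorem Op.regsLt_of_bound_le {M : ℕ} (o : Op) (h : o.bound ≤ M) : o.RegsLt M := by
  cases o <;> simp_all [bound, RegsLt, Source.regsLt_of_bound_le]

theorem Prog.regsLt_of_bound_le {M : ℕ} (p : Prog) (h : p.bound ≤ M) (a : ℕ) :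
    ∀ i ∈ p.compile a, i.RegsLt M := by
  induction p generalizing a with
  | skip => simp [compile]
  | op o => simpa [compile, Instr.RegsLt] using o.regsLt_of_bound_le h
  | seq p q ihp ihq =>
    simp only [bound, max_le_iff] at h
    simp only [compile, List.mem_append]
    rintro i (hi | hi)
    exacts [ihp h.1 _ i hi, ihq h.2 _ i hi]
  | loop c p ih =>
    simp only [bound, max_le_iff] at h
    simp only [compile, List.mem_cons, List.mem_append, List.not_mem_nil, or_false]
    rintro i (rfl | hi | rfl)
    exacts [c.regsLt_of_bound_le h.1, ih h.2 _ i hi, trivial]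

/-- The store with the given input in which everything else is empty. -/
def Store.init (w : List (Option Bool)) : Store := ⟨fun _ => 0, w, [], []⟩

/-- The store with the given output in which everything else is empty. -/
def Store.final (b : List Bool) : Store := ⟨fun _ => 0, [], [], b⟩

/-- A function that is computed by a structured program in polynomial time is computable in
polynomial time by a Turing machine. -/
theorem nonempty_polyTime_of_exec {α β : Type} (ea : α → List (Option Bool)) (eb : β → List Bool)
    (f : α → β) (p : Prog) (P : Polynomial ℕ)
    (h : ∀ a, ∃ t ≤ P.eval (ea a).length, Exec p (.init (ea a)) (.final (eb (f a))) t) :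
    Nonempty (Turing.TM2ComputableInPolyTime ea eb f) := by
  refine ⟨{ tm := machine p.bound (p.compile 0), inputAlphabet := Equiv.refl _,
            outputAlphabet := Equiv.refl _, time := P + 1, outputsFun := fun a => ?_ }⟩
  have hex : ∃ t ≤ P.eval (ea a).length,
      iterStep (machine p.bound (p.compile 0)) (t + 1) (machineCfg p.bound _ (0, .init (ea a))) =
        some (Turing.haltList (machine p.bound (p.compile 0)) (eb (f a))) := by
    obtain ⟨t, ht, he⟩ := h a
    refine ⟨t, ht, ?_⟩
    have h₁ := (he.asmRun [] []).machine (M := p.bound) (by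
      simpa using p.regsLt_of_bound_le le_rfl 0)
    simp only [List.nil_append, List.length_nil, Nat.zero_add] at h₁
    rw [List.append_nil] at h₁
    -- The program ends at the address just past its code, where the statement is `halt`; this is
    -- the extra step in the time bound `P + 1`.
    refine iterStep_succ' t h₁ ?_
    have hm : (machine p.bound (p.compile 0)).m
        (Fin.ofNat ((p.compile 0).length + 1) p.size) = .halt := by
      simp [machine, Prog.length_compile]
    change some (Turing.TM2.stepAux ((machine p.bound (p.compile 0)).m
      (Fin.ofNat ((p.compile 0).length + 1) p.size)) none ((Store.final (eb (f a))).stacks _)) = _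
    rw [hm]
    congr 1
    change Turing.TM2.Cfg.mk none none _ = Turing.TM2.Cfg.mk none none _
    congr 1
    funext k
    rcases k with _ | _ | _ | i <;> rfl
  have hinit : Turing.initList (machine p.bound (p.compile 0)) (ea a) =
      machineCfg p.bound (p.compile 0).length (0, .init (ea a)) := by
    change Turing.TM2.Cfg.mk _ none _ = Turing.TM2.Cfg.mk _ none _
    congr 1
    funext k
    rcases k with _ | _ | _ | i <;> rfl
  have hid : ∀ {γ : Type} (l : List γ), List.map (Equiv.refl γ).invFun l = l := fun l =>
    List.map_id l
  refine ⟨⟨hex.choose + 1, ?_⟩, ?_⟩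
  · have h₁ := (congrArg (iterStep (machine p.bound (p.compile 0)) (hex.choose + 1)) hinit).trans
      hex.choose_spec.2
    refine (congrArg (fun l => iterStep (machine p.bound (p.compile 0)) (hex.choose + 1)
      (Turing.initList (machine p.bound (p.compile 0)) l)) (hid (γ := Option Bool) (ea a))).trans ?_
    exact h₁.trans (congrArg (fun l => some (Turing.haltList (machine p.bound (p.compile 0)) l))
      (hid (γ := Bool) (eb (f a))).symm)
  · simpa using hex.choose_spec.1

end CrossComp

/-! ### Arithmetic expressions and their evaluation in polynomial time. -/

namespace CrossComp

open Function

/-! ### Polynomially bounded functions -/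

/-- A function on the natural numbers that is bounded by a polynomial. -/
def PolyBounded (T : ℕ → ℕ) : Prop := ∃ d, ∀ X, T X ≤ (X + 2) ^ d

namespace PolyBounded

variable {T U : ℕ → ℕ}

/-- The base `X + 2` is at least `2`, so a constant is absorbed by the exponent: `c ≤ 2 ^ c`. No
leading coefficients have to be tracked. -/
theorem const (c : ℕ) : PolyBounded fun _ => c :=
  ⟨c, fun X => Nat.lt_two_pow_self.le.trans (Nat.pow_le_pow_left (by omega) c)⟩

theorem id : PolyBounded fun X => X := ⟨1, fun X => by simp⟩

theorem mul (hT : PolyBounded T) (hU : PolyBounded U) : PolyBounded fun X => T X * U X := by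
  obtain ⟨d, hd⟩ := hT
  obtain ⟨e, he⟩ := hU
  exact ⟨d + e, fun X => by rw [pow_add]; exact Nat.mul_le_mul (hd X) (he X)⟩

theorem add (hT : PolyBounded T) (hU : PolyBounded U) : PolyBounded fun X => T X + U X := by
  obtain ⟨d, hd⟩ := hT
  obtain ⟨e, he⟩ := hU
  refine ⟨max d e + 1, fun X => ?_⟩
  have h₁ := (hd X).trans (Nat.pow_le_pow_right (by omega) (le_max_left d e))
  have h₂ := (he X).trans (Nat.pow_le_pow_right (by omega) (le_max_right d e))
  -- The additional factor `X + 2 ≥ 2` pays for adding two bounds with the exponent `max d e`.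
  rw [pow_succ]
  nlinarith [Nat.zero_le X, Nat.zero_le ((X + 2) ^ max d e)]

theorem comp (hT : PolyBounded T) (hU : PolyBounded U) : PolyBounded fun X => T (U X) := by
  obtain ⟨d, hd⟩ := hT
  obtain ⟨e, he⟩ := hU.add (const 2)
  exact ⟨e * d, fun X => (hd _).trans (by rw [pow_mul]; exact Nat.pow_le_pow_left (he X) d)⟩

theorem exists_polynomial (hT : PolyBounded T) : ∃ P : Polynomial ℕ, ∀ X, T X ≤ P.eval X :=
  let ⟨d, hd⟩ := hT
  ⟨(Polynomial.X + 2) ^ d, fun X => by simpa using hd X⟩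

end PolyBounded

/-! ### Running times of structured programs -/

/-- The program `p` takes the store `s` to `s'` in at most `T` steps. -/
def Runs (p : Prog) (s s' : Store) (T : ℕ) : Prop := ∃ t ≤ T, Exec p s s' t

namespace Runs

theorem mono {p s s' T T'} (h : Runs p s s' T) (hT : T ≤ T') : Runs p s s' T' :=
  let ⟨t, ht, he⟩ := h
  ⟨t, ht.trans hT, he⟩

theorem skip (s) : Runs .skip s s 0 := ⟨0, le_rfl, .skip s⟩

theorem op (o s) : Runs (.op o) s (o.apply s) 1 := ⟨1, le_rfl, .op o s⟩

theorem seq {p q s s' s'' T T'} (h : Runs p s s' T) (h' : Runs q s' s'' T') :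
    Runs (.seq p q) s s'' (T + T') :=
  let ⟨_, ht, he⟩ := h
  let ⟨_, ht', he'⟩ := h'
  ⟨_, Nat.add_le_add ht ht', he.seq he'⟩

/-- `S i` is the store just before the test of round `i`. Each round costs at most `T` for the body
and two for test and jump; the last unit is the failing test. -/
theorem loop {c p T} (n : ℕ) (S : ℕ → Store)
    (h : ∀ i < n, ∃ s, (S i).pop c = some s ∧ Runs p s (S (i + 1)) T)
    (hn : (S n).pop c = none) : Runs (.loop c p) (S 0) (S n) (n * (T + 2) + 1) := by
  induction n generalizing S with
  | zero => exact ⟨1, by omega, .done hn⟩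
  | succ n ih =>
    obtain ⟨s, hs, t, ht, he⟩ := h 0 n.succ_pos
    obtain ⟨t', ht', he'⟩ := ih (fun i => S (i + 1)) (fun i hi => h (i + 1) (by omega)) hn
    exact ⟨_, by rw [Nat.succ_mul]; omega, .step hs he he'⟩

end Runs

/-- Add `n` to a register. -/
def Store.add (s : Store) (r n : ℕ) : Store := { s with reg := update s.reg r (s.reg r + n) }

/-- Set a register to `n`. -/
def Store.set (s : Store) (r n : ℕ) : Store := { s with reg := update s.reg r n }

section StoreLemmas

variable (s : Store) (r n : ℕ)

@[simp] theorem Store.add_inp : (s.add r n).inp = s.inp := rfl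
@[simp] theorem Store.add_shadow : (s.add r n).shadow = s.shadow := rfl
@[simp] theorem Store.add_out : (s.add r n).out = s.out := rfl
@[simp] theorem Store.set_inp : (s.set r n).inp = s.inp := rfl
@[simp] theorem Store.set_shadow : (s.set r n).shadow = s.shadow := rfl
@[simp] theorem Store.set_out : (s.set r n).out = s.out := rfl

theorem Store.add_reg (j : ℕ) :
    (s.add r n).reg j = if j = r then s.reg r + n else s.reg j := by
  simp [Store.add, update_apply]

theorem Store.set_reg (j : ℕ) : (s.set r n).reg j = if j = r then n else s.reg j := by
  simp [Store.set, update_apply]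

theorem Store.pop_set_succ : (s.set r (n + 1)).pop (.reg r) = some (s.set r n) := by
  simp [Store.set, Store.pop]

theorem Store.pop_reg_zero (h : s.reg r = 0) : s.pop (.reg r) = none := by
  simp [Store.pop, h]

theorem Store.set_self (h : s.reg r = n) : s.set r n = s := by
  ext j
  · rw [Store.set_reg]; split_ifs with hj <;> simp_all
  all_goals rfl

theorem Store.apply_inc : (Op.inc r).apply s = s.add r 1 := rfl

end StoreLemmas

/-- A loop whose counter is a register that the body does not change. -/
theorem Runs.loop_reg {p T} (r n : ℕ) (S : ℕ → Store)
    (h : ∀ i < n, Runs p ((S i).set r (n - 1 - i)) ((S (i + 1)).set r (n - 1 - i)) T) :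
    Runs (.loop (.reg r) p) ((S 0).set r n) ((S n).set r 0) (n * (T + 2) + 1) := by
  have := Runs.loop (c := .reg r) (p := p) (T := T) n (fun i => (S i).set r (n - i))
    (fun i hi => ⟨(S i).set r (n - 1 - i), ?_, ?_⟩) ?_
  · simpa using this
  · rw [show n - i = n - 1 - i + 1 by omega]
    exact Store.pop_set_succ _ _ _
  · have h₁ := h i hi
    rwa [show n - (i + 1) = n - 1 - i by omega]
  · exact Store.pop_reg_zero _ _ (by simp [Store.set_reg])

theorem runs_clear (s : Store) (r : ℕ) :
    Runs (.loop (.reg r) .skip) s (s.set r 0) (s.reg r * 2 + 1) := by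
  have := Runs.loop_reg r (s.reg r) (fun _ => s) (fun _ _ => Runs.skip _)
  rwa [Store.set_self s r _ rfl] at this

theorem runs_move (s : Store) {r o : ℕ} (hro : r ≠ o) :
    Runs (.loop (.reg r) (.op (.inc o))) s ((s.add o (s.reg r)).set r 0) (s.reg r * 3 + 1) := by
  have := Runs.loop_reg (p := .op (.inc o)) (T := 1) r (s.reg r) (fun i => s.add o i)
    (fun i hi => by
      have h := Runs.op (.inc o) ((s.add o i).set r (s.reg r - 1 - i))
      convert h using 1
      ext j
      · simp only [Store.apply_inc, Store.add_reg, Store.set_reg]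
        split_ifs <;> grind
      all_goals rfl)
  convert this using 1
  ext j
  · simp only [Store.add_reg, Store.set_reg]
    split_ifs <;> grind
  all_goals rfl

/-! ### Expressions -/

/-- Arithmetic expressions with `r` free variables over an input word, with bounded sums. -/
inductive Expr : ℕ → Type
  | const {r : ℕ} (c : ℕ) : Expr r
  | var {r : ℕ} (i : Fin r) : Expr r
  | add {r : ℕ} (a b : Expr r) : Expr r
  | sub {r : ℕ} (a b : Expr r) : Expr r
  | mul {r : ℕ} (a b : Expr r) : Expr r
  | sum {r : ℕ} (b : Expr r) (f : Expr (r + 1)) : Expr r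
  | read {r : ℕ} (a : Expr r) : Expr r
  | len {r : ℕ} : Expr r
  | up {r : ℕ} (a : Expr r) : Expr (r + 1)

/-- The value of an expression. -/
def Expr.eval (w : List (Option Bool)) : {r : ℕ} → Expr r → (Fin r → ℕ) → ℕ
  | _, .const c, _ => c
  | _, .var i, v => v i
  | _, .add a b, v => a.eval w v + b.eval w v
  | _, .sub a b, v => a.eval w v - b.eval w v
  | _, .mul a b, v => a.eval w v * b.eval w v
  | _, .sum b f, v => ∑ i ∈ Finset.range (b.eval w v), f.eval w (Fin.cons i v)
  | _, .read a, v => symbolCode w[a.eval w v]?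
  | _, .len, _ => w.length
  | _, .up a, v => a.eval w (Fin.tail v)

theorem symbolCode_le (a : Option (Option Bool)) : symbolCode a ≤ 3 := by
  rcases a with _ | _ | _ | _ <;> simp [symbolCode]

/-- The value of an expression is polynomially bounded. -/
theorem Expr.exists_eval_le {r : ℕ} (e : Expr r) : ∃ T, PolyBounded T ∧ ∀ (w : List (Option Bool))
    (v : Fin r → ℕ) (X : ℕ), w.length ≤ X → (∀ i, v i ≤ X) → e.eval w v ≤ T X := by
  induction e with
  | const c => exact ⟨_, .const c, fun _ _ _ _ _ => le_rfl⟩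
  | var i => exact ⟨_, .id, fun _ _ _ _ h => h i⟩
  | add a b iha ihb =>
    obtain ⟨T, hT, ha⟩ := iha
    obtain ⟨U, hU, hb⟩ := ihb
    exact ⟨_, hT.add hU, fun w v X hw hv => Nat.add_le_add (ha w v X hw hv) (hb w v X hw hv)⟩
  | sub a b iha _ =>
    obtain ⟨T, hT, ha⟩ := iha
    exact ⟨_, hT, fun w v X hw hv => (Nat.sub_le _ _).trans (ha w v X hw hv)⟩
  | mul a b iha ihb =>
    obtain ⟨T, hT, ha⟩ := iha
    obtain ⟨U, hU, hb⟩ := ihb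
    exact ⟨_, hT.mul hU, fun w v X hw hv => Nat.mul_le_mul (ha w v X hw hv) (hb w v X hw hv)⟩
  | sum b f ihb ihf =>
    obtain ⟨T, hT, hb⟩ := ihb
    obtain ⟨U, hU, hf⟩ := ihf
    -- The summation index is below `T X` and the old variables are at most `X`, so `T X + X` bounds
    -- all arguments of the summand.
    refine ⟨_, hT.mul (hU.comp (hT.add .id)), fun w v X hw hv => ?_⟩
    refine (Finset.sum_le_card_nsmul _ _ (U (T X + X)) fun i hi => hf w _ _ (by omega) ?_).trans ?_
    · have := Finset.mem_range.1 hi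
      have := hb w v X hw hv
      refine Fin.cases ?_ fun j => ?_
      · simp only [Fin.cons_zero]; omega
      · have := hv j
        simp only [Fin.cons_succ]; omega
    · rw [Finset.card_range, smul_eq_mul]
      exact Nat.mul_le_mul_right _ (hb w v X hw hv)
  | read a _ => exact ⟨_, .const 3, fun _ _ _ _ _ => symbolCode_le _⟩
  | len => exact ⟨_, .id, fun _ _ _ h _ => h⟩
  | up a ih =>
    obtain ⟨T, hT, ha⟩ := ih
    exact ⟨T, hT, fun w v X hw hv => ha w _ X hw fun i => hv _⟩

/-- The program `p` adds the value of `e` to the register `o`, in time bounded by `T`, if the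
arguments are in the registers `ρ i` and all registers from `N` on are free. -/
def Computes {r : ℕ} (e : Expr r) (ρ : Fin r → ℕ) (o N : ℕ) (p : Prog) (T : ℕ → ℕ) : Prop :=
  ∀ (s : Store) (X : ℕ), s.shadow = [] → (∀ j, N ≤ j → s.reg j = 0) → s.inp.length ≤ X →
    (∀ i, s.reg (ρ i) ≤ X) → Runs p s (s.add o (e.eval s.inp fun i => s.reg (ρ i))) (T X)

theorem runs_const (o c : ℕ) : ∃ p, ∀ s : Store, Runs p s (s.add o c) c := by
  induction c with
  | zero => exact ⟨.skip, fun s => by simpa [Store.add] using Runs.skip s⟩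
  | succ c ih =>
    obtain ⟨p, hp⟩ := ih
    refine ⟨.seq p (.op (.inc o)), fun s => ?_⟩
    convert (hp s).seq (Runs.op _ _) using 1
    simp [Store.apply_inc, Store.add, Nat.add_assoc]

/-- The store with the input read up to position `n`. -/
def Store.readTo (s : Store) (w : List (Option Bool)) (n : ℕ) : Store :=
  { s with inp := w.drop n, shadow := (w.take n).reverse }

/-- Positions beyond the end of the input all describe the same store, so out-of-range reads need no
separate treatment. -/
theorem Store.readTo_min (s : Store) (w : List (Option Bool)) (n : ℕ) :
    s.readTo w (min n w.length) = s.readTo w n := by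
  rcases le_total n w.length with h | h
  · rw [min_eq_left h]
  · simp [readTo, h]

theorem Store.readTo_zero (s : Store) (hs : s.shadow = []) : s.readTo s.inp 0 = s := by
  ext <;> simp [readTo, hs]

theorem reverse_take_succ {α : Type*} (w : List α) (n : ℕ) (hn : n < w.length) :
    (w.take (n + 1)).reverse = w[n] :: (w.take n).reverse := by
  rw [List.take_succ_eq_append_getElem hn, List.reverse_append]
  rfl

theorem Store.left_readTo (s : Store) (w : List (Option Bool)) (n : ℕ) (hn : n ≤ w.length) :
    Op.left.apply (s.readTo w n) = s.readTo w (n - 1) := by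
  rcases n with _ | n
  · simp [readTo, Op.apply]
  · have h : w[n] :: w.drop (n + 1) = w.drop n := (List.drop_eq_getElem_cons (by omega)).symm
    simp only [readTo, Op.apply, Nat.add_sub_cancel, reverse_take_succ w n hn, h]

theorem Store.pop_inp_readTo (s : Store) (w : List (Option Bool)) (n : ℕ) (hn : n < w.length) :
    (s.readTo w n).pop .inp = some (s.readTo w (n + 1)) := by
  have h : w.drop n = w[n] :: w.drop (n + 1) := List.drop_eq_getElem_cons hn
  simp only [readTo, pop, h, reverse_take_succ w n hn]

theorem Store.pop_inp_readTo_of_le (s : Store) (w : List (Option Bool)) (n : ℕ)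
    (hn : w.length ≤ n) : (s.readTo w n).pop .inp = none := by
  simp [readTo, pop, List.drop_eq_nil_of_le hn]

theorem Store.apply_pop_inp_readTo (s : Store) (w : List (Option Bool)) (n : ℕ) :
    (Op.pop .inp).apply (s.readTo w n) = s.readTo w (n + 1) := by
  rcases lt_or_ge n w.length with h | h
  · simp [Op.apply, Store.pop_inp_readTo _ _ _ h]
  · simp only [Op.apply, Store.pop_inp_readTo_of_le _ _ _ h]
    simp [readTo, h, h.trans (Nat.le_succ n)]

theorem Store.readTo_set (s : Store) (w : List (Option Bool)) (n r m : ℕ) :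
    (s.readTo w n).set r m = (s.set r m).readTo w n := rfl

theorem Store.readTo_add (s : Store) (w : List (Option Bool)) (n r m : ℕ) :
    (s.readTo w n).add r m = (s.add r m).readTo w n := rfl

/-- Moving back to the start of the input. -/
theorem runs_rewind (s : Store) (hs : s.shadow = []) (c n : ℕ) (hc : s.reg c = 0) :
    Runs (.loop (.reg c) (.op .left)) ((s.readTo s.inp n).set c n) s (n * 3 + 1) := by
  have := Runs.loop_reg (p := .op .left) (T := 1) c n
    -- The counter `n` may exceed the number of symbols that were moved. The superfluous moves to
    -- the left meet an empty shadow and do nothing, in agreement with truncated subtraction.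
    (fun i => s.readTo s.inp (min n s.inp.length - i))
    (fun i hi => by
      simp only [Store.readTo_set]
      have h := Runs.op .left ((s.set c (n - 1 - i)).readTo s.inp (min n s.inp.length - i))
      rw [Store.left_readTo _ _ _ (by omega)] at h
      rwa [show min n s.inp.length - i - 1 = min n s.inp.length - (i + 1) by omega] at h)
  simp only [Nat.sub_zero, Store.readTo_min] at this
  rw [show min n s.inp.length - n = 0 by omega, Store.readTo_zero s hs, Store.set_self s c 0 hc]
    at this
  exact this

/-- Reading a register in a loop destroys it. Its value is therefore copied to the scratch register
`N` as well as to `o`, and moved back from `N` afterwards. -/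
theorem computes_var {r : ℕ} (i : Fin r) (ρ : Fin r → ℕ) (o N : ℕ) (hρ : ∀ i, ρ i < N)
    (ho : o < N) (hρo : ∀ i, ρ i ≠ o) :
    ∃ p T, PolyBounded T ∧ Computes (.var i) ρ o N p T := by
  refine ⟨.seq (.loop (.reg (ρ i)) (.seq (.op (.inc N)) (.op (.inc o))))
    (.loop (.reg N) (.op (.inc (ρ i)))), fun X => (X * 4 + 1) + (X * 3 + 1),
    (((PolyBounded.id.mul (.const 4)).add (.const 1)).add
      ((PolyBounded.id.mul (.const 3)).add (.const 1))), fun s X _ hz _ hX => ?_⟩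
  have hi := hX i
  have h₁ := hρ i
  have h₂ := hρo i
  have hN := hz N le_rfl
  have a := Runs.loop_reg (p := .seq (.op (.inc N)) (.op (.inc o))) (T := 1 + 1) (ρ i) (s.reg (ρ i))
    (fun i => (s.add o i).add N i)
    (fun j hj => by
      convert (Runs.op (.inc N) _).seq (Runs.op (.inc o) _) using 1
      ext j
      · simp only [Store.apply_inc, Store.add_reg, Store.set_reg]
        split_ifs <;> grind
      all_goals rfl)
  have b := runs_move (((s.add o (s.reg (ρ i))).add N (s.reg (ρ i))).set (ρ i) 0)
    (r := N) (o := ρ i) (by omega)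
  refine Runs.mono (T := (s.reg (ρ i) * 4 + 1) + (s.reg (ρ i) * 3 + 1)) ?_
    (by dsimp only; omega)
  convert a.seq b using 1
  · ext j
    · simp only [Store.add_reg, Store.set_reg]
      split_ifs <;> grind
    all_goals rfl
  · ext j
    · simp only [Store.add_reg, Store.set_reg, Expr.eval]
      split_ifs <;> grind
    all_goals rfl
  · simp only [Store.add_reg, Store.set_reg]
    split_ifs <;> grind

/-- Every expression is computed by a program in polynomial time. -/
theorem Expr.exists_computes {r : ℕ} (e : Expr r) : ∀ (ρ : Fin r → ℕ) (o N : ℕ),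
    (∀ i, ρ i < N) → o < N → (∀ i, ρ i ≠ o) → ∃ p T, PolyBounded T ∧ Computes e ρ o N p T := by
  induction e with
  | const c =>
    intro ρ o N _ _ _
    obtain ⟨p, hp⟩ := runs_const o c
    exact ⟨p, _, .const c, fun s X _ _ _ _ => hp s⟩
  | var i => exact computes_var i
  | add a b iha ihb =>
    intro ρ o N hρ ho hρo
    obtain ⟨p, T, hT, hp⟩ := iha ρ o N hρ ho hρo
    obtain ⟨q, U, hU, hq⟩ := ihb ρ o N hρ ho hρo
    refine ⟨.seq p q, _, hT.add hU, fun s X hs hz hw hX => ?_⟩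
    have h₁ := hp s X hs hz hw hX
    have hρ' : ∀ n i, (s.add o n).reg (ρ i) = s.reg (ρ i) := fun n i => by
      rw [Store.add_reg, if_neg (hρo i)]
    have h₂ := hq (s.add o (a.eval s.inp fun i => s.reg (ρ i))) X hs
      (fun j hj => by rw [Store.add_reg, if_neg (by omega), hz j hj]) hw (by simpa [hρ'] using hX)
    simp only [hρ', Store.add_inp] at h₂
    convert h₁.seq h₂ using 1
    simp [Store.add, Expr.eval, Nat.add_assoc]
  | sub a b iha ihb =>
    intro ρ o N hρ ho hρo
    obtain ⟨p, T, hT, hp⟩ := iha ρ N (N + 1) (fun i => (hρ i).trans N.lt_succ_self) N.lt_succ_self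
      fun i => (hρ i).ne
    obtain ⟨q, U, hU, hq⟩ := ihb ρ (N + 1) (N + 2) (fun i => (hρ i).trans (by omega)) (by omega)
      fun i => ((hρ i).trans (by omega)).ne
    obtain ⟨V, hV, hv⟩ := a.exists_eval_le
    obtain ⟨W, hW, hw'⟩ := b.exists_eval_le
    -- One unit of `a`, held in `N`, is removed for each unit of `b`, held in `N + 1`. Popping an
    -- empty register has no effect, which gives truncated subtraction.
    refine ⟨.seq p (.seq q (.seq (.loop (.reg (N + 1)) (.op (.pop (.reg N))))
      (.loop (.reg N) (.op (.inc o))))), _, hT.add (hU.add (((hW.mul (.const 3)).add (.const 1)).add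
        ((hV.mul (.const 3)).add (.const 1)))), fun s X hs hz hw hX => ?_⟩
    have h₁ := hp s X hs (fun j hj => hz j (by omega)) hw hX
    have hbd := hv s.inp _ X hw hX
    have hbd' := hw' s.inp _ X hw hX
    set m := a.eval s.inp fun i => s.reg (ρ i) with hm
    set n := b.eval s.inp fun i => s.reg (ρ i) with hn
    have hρ' : ∀ i, (s.add N m).reg (ρ i) = s.reg (ρ i) := fun i => by
      rw [Store.add_reg, if_neg (hρ i).ne]
    have h₂ := hq (s.add N m) X hs
      (fun j hj => by rw [Store.add_reg, if_neg (by omega), hz j (by omega)]) hw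
      (by simpa [hρ'] using hX)
    simp only [hρ', Store.add_inp, ← hn] at h₂
    have h₃ := Runs.loop_reg (p := .op (.pop (.reg N))) (T := 1) (N + 1) n
      (fun i => s.set N (m - i)) (fun i hi => by
        convert Runs.op (.pop (.reg N)) _ using 1
        by_cases h : m - i = 0
        · simp only [Op.apply]
          rw [Store.pop_reg_zero _ _ (by simp [Store.set_reg, h])]
          simp [h, show m - (i + 1) = 0 by omega]
        · have : m - i = (m - (i + 1)) + 1 := by omega
          simp only [Op.apply]
          rw [this, show (s.set N (m - (i + 1) + 1)).set (N + 1) (n - 1 - i) =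
            (s.set (N + 1) (n - 1 - i)).set N (m - (i + 1) + 1) by
              simp [Store.set, update_comm], Store.pop_set_succ]
          simp [Store.set, update_comm])
    have h₄ := runs_move ((s.set N (m - n)).set (N + 1) 0) (r := N) (o := o) ho.ne'
    refine Runs.mono (h₁.seq ((h₂.seq
      ((?_ : Runs _ _ ((s.set N (m - n)).set (N + 1) 0) (n * 3 + 1)).seq
        (?_ : Runs _ _ _ ((m - n) * 3 + 1)))))) ?_
    · convert h₃ using 1
      ext j
      · simp only [Store.add_reg, Store.set_reg]
        split_ifs <;> grind
      all_goals rfl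
    · convert h₄ using 1
      · ext j
        · simp only [Store.add_reg, Store.set_reg, Expr.eval, ← hm, ← hn]
          split_ifs <;> grind
        all_goals rfl
      · simp only [Store.set_reg]
        split_ifs <;> grind
    · omega
  | mul a b iha ihb =>
    intro ρ o N hρ ho hρo
    obtain ⟨p, T, hT, hp⟩ := iha ρ N (N + 1) (fun i => (hρ i).trans N.lt_succ_self) N.lt_succ_self
      fun i => (hρ i).ne
    obtain ⟨q, U, hU, hq⟩ := ihb ρ o (N + 1) (fun i => (hρ i).trans (by omega)) (by omega) hρo
    obtain ⟨V, hV, hv⟩ := a.exists_eval_le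
    -- Multiplication is repeated addition: `b` is evaluated anew for each unit of `a`.
    refine ⟨.seq p (.loop (.reg N) q), _, hT.add ((hV.mul (hU.add (.const 2))).add (.const 1)),
      fun s X hs hz hw hX => ?_⟩
    have h₁ := hp s X hs (fun j hj => hz j (by omega)) hw hX
    have hbd := hv s.inp _ X hw hX
    set m := a.eval s.inp fun i => s.reg (ρ i) with hm
    set n := b.eval s.inp fun i => s.reg (ρ i) with hn
    have h₂ := Runs.loop_reg (p := q) (T := U X) N m (fun i => s.add o (i * n)) (fun i hi => by
      have hρ' : ∀ j, ((s.add o (i * n)).set N (m - 1 - i)).reg (ρ j) = s.reg (ρ j) := fun j => by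
        rw [Store.set_reg, if_neg (hρ j).ne, Store.add_reg, if_neg (hρo j)]
      have h := hq ((s.add o (i * n)).set N (m - 1 - i)) X hs
        (fun j hj => by
          rw [Store.set_reg, if_neg (by omega), Store.add_reg, if_neg (by omega), hz j (by omega)])
        hw (by simpa [hρ'] using hX)
      simp only [hρ', Store.set_inp, Store.add_inp, ← hn] at h
      convert h using 1
      ext j
      · simp only [Store.add_reg, Store.set_reg, Nat.succ_mul]
        split_ifs <;> grind
      all_goals rfl)
    refine Runs.mono (h₁.seq (?_ : Runs _ _ _ (m * (U X + 2) + 1))) ?_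
    · convert h₂ using 1
      · ext j
        · simp only [Store.add_reg, Store.set_reg]
          split_ifs <;> grind
        all_goals rfl
      · ext j
        · simp only [Store.add_reg, Store.set_reg, Expr.eval, ← hm, ← hn]
          split_ifs <;> grind
        all_goals rfl
    · have := Nat.mul_le_mul_right (U X + 2) hbd
      omega
  | @sum r b f ihb ihf =>
    intro ρ o N hρ ho hρo
    obtain ⟨p, T, hT, hp⟩ := ihb ρ N (N + 1) (fun i => (hρ i).trans N.lt_succ_self) N.lt_succ_self
      fun i => (hρ i).ne
    obtain ⟨q, U, hU, hq⟩ := ihf (Fin.cons (N + 1) ρ) o (N + 2)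
      (Fin.cases (by simp) fun i => by have := hρ i; simp only [Fin.cons_succ]; omega) (by omega)
      (Fin.cases (by simp only [Fin.cons_zero]; omega) fun i => by simpa using hρo i)
    obtain ⟨V, hV, hv⟩ := b.exists_eval_le
    -- `N` counts the remaining rounds down while `N + 1` holds the summation index and counts up;
    -- `f` is evaluated with `N + 1` as its new variable. Clearing `N + 1` at the end frees the
    -- scratch registers again.
    refine ⟨.seq p (.seq (.loop (.reg N) (.seq q (.op (.inc (N + 1)))))
      (.loop (.reg (N + 1)) .skip)), _, hT.add
        (((hV.mul ((hU.comp (hV.add .id)).add (.const 3))).add (.const 1)).add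
          ((hV.mul (.const 2)).add (.const 1))), fun s X hs hz hw hX => ?_⟩
    have h₁ := hp s X hs (fun j hj => hz j (by omega)) hw hX
    have hbd := hv s.inp _ X hw hX
    set m := b.eval s.inp fun i => s.reg (ρ i) with hm
    set g : ℕ → ℕ := fun i => f.eval s.inp (Fin.cons i fun i => s.reg (ρ i)) with hg
    have hzN : s.reg N = 0 := hz N le_rfl
    have hzN' : s.reg (N + 1) = 0 := hz _ (Nat.le_succ N)
    have h₂ := Runs.loop_reg (p := .seq q (.op (.inc (N + 1)))) (T := U (V X + X) + 1) N m
      (fun i => (s.add o (∑ j ∈ Finset.range i, g j)).set (N + 1) i) (fun i hi => by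
        set s' := ((s.add o (∑ j ∈ Finset.range i, g j)).set (N + 1) i).set N (m - 1 - i) with hs'
        have hρ' : (fun j => s'.reg ((Fin.cons (N + 1) ρ : Fin (r + 1) → ℕ) j)) =
            (Fin.cons i fun i => s.reg (ρ i) : Fin (r + 1) → ℕ) := by
          refine funext (Fin.cases ?_ fun j => ?_)
          · simp [hs', Store.set_reg]
          · have := hρ j
            have := hρo j
            simp only [Fin.cons_succ, hs', Store.set_reg, Store.add_reg]
            rw [if_neg (by omega), if_neg (by omega), if_neg (by omega)]
        have h := hq s' (V X + X) hs
          (fun j hj => by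
            simp only [hs', Store.set_reg, Store.add_reg]
            rw [if_neg (by omega), if_neg (by omega), if_neg (by omega), hz j (by omega)])
          (hw.trans (Nat.le_add_left _ _)) (fun j => by
            have := congrFun hρ' j
            rw [this]
            refine Fin.cases ?_ (fun j => ?_) j
            · simp only [Fin.cons_zero]; omega
            · simpa using (hX j).trans (Nat.le_add_left _ _))
        rw [hρ'] at h
        convert h.seq (Runs.op _ _) using 1
        ext j
        · simp only [Store.apply_inc, Store.add_reg, Store.set_reg, Finset.sum_range_succ, hs', hg,
            Store.set_inp, Store.add_inp]
          split_ifs <;> grind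
        all_goals rfl)
    have h₃ := runs_clear (((s.add o (∑ j ∈ Finset.range m, g j)).set (N + 1) m).set N 0) (N + 1)
    refine Runs.mono (h₁.seq ((?_ : Runs _ _
      (((s.add o (∑ j ∈ Finset.range m, g j)).set (N + 1) m).set N 0)
      (m * (U (V X + X) + 1 + 2) + 1)).seq (?_ : Runs _ _ _ (m * 2 + 1)))) ?_
    · convert h₂ using 1
      ext j
      · simp only [Store.add_reg, Store.set_reg, Finset.range_zero, Finset.sum_empty]
        split_ifs <;> grind
      all_goals rfl
    · convert h₃ using 1
      · ext j
        · simp only [Store.add_reg, Store.set_reg, Expr.eval, ← hm, hg]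
          split_ifs <;> grind
        all_goals rfl
      · simp only [Store.add_reg, Store.set_reg]
        split_ifs <;> grind
    · have := Nat.mul_le_mul_right (U (V X + X) + 3) hbd
      rw [show U (V X + X) + 1 + 2 = U (V X + X) + 3 from rfl]
      omega
  | read a ih =>
    intro ρ o N hρ ho hρo
    obtain ⟨p, T, hT, hp⟩ := ih ρ N (N + 1) (fun i => (hρ i).trans N.lt_succ_self) N.lt_succ_self
      fun i => (hρ i).ne
    obtain ⟨V, hV, hv⟩ := a.exists_eval_le
    -- The head moves to the desired position while `N + 1` counts the moves, the symbol code is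
    -- added to `o` (zero past the end), and the head is rewound with the help of `N + 1`.
    refine ⟨.seq p (.seq (.loop (.reg N) (.seq (.op (.pop .inp)) (.op (.inc (N + 1)))))
      (.seq (.op (.load o)) (.loop (.reg (N + 1)) (.op .left)))), _, hT.add
        (((hV.mul (.const 4)).add (.const 1)).add ((PolyBounded.const 1).add
          ((hV.mul (.const 3)).add (.const 1)))), fun s X hs hz hw hX => ?_⟩
    have h₁ := hp s X hs (fun j hj => hz j (by omega)) hw hX
    have hbd := hv s.inp _ X hw hX
    set m := a.eval s.inp fun i => s.reg (ρ i) with hm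
    have hzN : s.reg N = 0 := hz N le_rfl
    have hzN' : s.reg (N + 1) = 0 := hz _ (Nat.le_succ N)
    have h₂ := Runs.loop_reg (p := .seq (.op (.pop .inp)) (.op (.inc (N + 1)))) (T := 1 + 1) N m
      (fun i => (s.set (N + 1) i).readTo s.inp i) (fun i hi => by
        convert (Runs.op (.pop .inp) _).seq (Runs.op (.inc (N + 1)) _) using 1
        simp only [Store.readTo_set, Store.apply_pop_inp_readTo, Store.apply_inc, Store.readTo_add]
        congr 1
        ext j
        · simp only [Store.add_reg, Store.set_reg]
          split_ifs <;> grind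
        all_goals rfl)
    have h₃ := Runs.op (.load o) (((s.set (N + 1) m).readTo s.inp m).set N 0)
    have h₄ := runs_rewind (s.add o (symbolCode s.inp[m]?)) hs (N + 1) m
      (by rw [Store.add_reg, if_neg (by omega), hzN'])
    refine Runs.mono (h₁.seq ((?_ : Runs _ _ _ (m * 4 + 1)).seq
      (h₃.seq (?_ : Runs _ _ _ (m * 3 + 1))))) ?_
    · convert h₂ using 1
      rw [Store.readTo_set]
      have hx : ((s.set (N + 1) 0).set N m) = s.add N m := by
        ext j
        · simp only [Store.add_reg, Store.set_reg]
          split_ifs <;> grind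
        all_goals rfl
      rw [hx]
      exact (Store.readTo_zero (s.add N m) hs).symm
    · convert h₄ using 1
      have hx : symbolCode ((s.set (N + 1) m).readTo s.inp m).inp.head? = symbolCode s.inp[m]? := by
        simp [Store.readTo]
      simp only [Op.apply, Store.set_inp, hx]
      ext j
      · simp only [Store.set_reg, Store.readTo, Store.add_reg, update_apply]
        split_ifs <;> grind
      all_goals rfl
    · omega
  | len =>
    intro ρ o N hρ ho hρo
    refine ⟨.seq (.loop .inp (.seq (.op (.inc o)) (.op (.inc N)))) (.loop (.reg N) (.op .left)), _,
      ((PolyBounded.id.mul (.const 4)).add (.const 1)).add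
        ((PolyBounded.id.mul (.const 3)).add (.const 1)), fun s X hs hz hw hX => ?_⟩
    have hzN : s.reg N = 0 := hz N le_rfl
    have h₁ := Runs.loop (c := .inp) (p := .seq (.op (.inc o)) (.op (.inc N))) (T := 1 + 1)
      s.inp.length (fun i => ((s.add o i).add N i).readTo s.inp i) (fun i hi =>
        ⟨_, Store.pop_inp_readTo _ _ _ hi, by
          convert (Runs.op (.inc o) _).seq (Runs.op (.inc N) _) using 1
          simp only [Store.apply_inc, Store.readTo_add]
          congr 1
          ext j
          · simp only [Store.add_reg]
            split_ifs <;> grind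
          all_goals rfl⟩) (Store.pop_inp_readTo_of_le _ _ _ le_rfl)
    have h₂ := runs_rewind (s.add o s.inp.length) hs N s.inp.length
      (by rw [Store.add_reg, if_neg (by omega), hzN])
    refine Runs.mono ((?_ : Runs _ _
      (((s.add o s.inp.length).add N s.inp.length).readTo s.inp s.inp.length)
      (s.inp.length * 4 + 1)).seq (?_ : Runs _ _ _ (s.inp.length * 3 + 1))) ?_
    · convert h₁ using 1
      have hx : (s.add o 0).add N 0 = s := by
        ext j
        · simp only [Store.add_reg]
          split_ifs <;> grind
        all_goals rfl
      rw [hx, Store.readTo_zero s hs]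
    · convert h₂ using 1
      rw [Store.readTo_set]
      congr 1
      ext j
      · simp only [Store.add_reg, Store.set_reg]
        split_ifs <;> grind
      all_goals rfl
    · omega
  | up a ih =>
    intro ρ o N hρ ho hρo
    obtain ⟨p, T, hT, hp⟩ := ih (Fin.tail ρ) o N (fun i => hρ _) ho fun i => hρo _
    exact ⟨p, T, hT, fun s X hs hz hw hX => hp s X hs hz hw fun i => hX _⟩

/-- A function whose output word has length and letters given by expressions is computable in
polynomial time. -/
theorem Expr.nonempty_polyTime {α β : Type} (ea : α → List (Option Bool)) (eb : β → List Bool)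
    (f : α → β) (size : Expr 0) (bit : Expr 1)
    (h : ∀ a, eb (f a) = (List.range (size.eval (ea a) Fin.elim0)).map
      fun i => decide (bit.eval (ea a) (fun _ => i) ≠ 0)) :
    Nonempty (Turing.TM2ComputableInPolyTime ea eb f) := by
  obtain ⟨p, T, hT, hp⟩ := size.exists_computes Fin.elim0 0 1 (fun i => i.elim0) one_pos
    fun i => i.elim0
  obtain ⟨q, U, hU, hq⟩ := bit.exists_computes (fun _ => 0) 1 2 (by simp) (by simp) (by simp)
  obtain ⟨V, hV, hv⟩ := size.exists_eval_le
  obtain ⟨W, hW, hw⟩ := bit.exists_eval_le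
  have hVX := hV.add .id
  obtain ⟨P, hP⟩ := (hT.add (((hV.mul ((hU.comp hVX).add (((PolyBounded.const 2).add
    ((hW.comp hVX).mul (.const 2))).add (.const 2)))).add (.const 1)).add
      (((PolyBounded.id.mul (.const 2)).add (.const 1)).add
        ((PolyBounded.id.mul (.const 2)).add (.const 1))))).exists_polynomial
  refine nonempty_polyTime_of_exec ea eb f (.seq p (.seq (.loop (.reg 0) (.seq q (.seq
    (.op (.emit 1)) (.loop (.reg 1) .skip)))) (.seq (.loop .inp .skip) (.loop .shadow .skip)))) P
    fun a => ?_
  set w := ea a with hw'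
  suffices h : Runs _ (Store.init w) (Store.final (eb (f a))) _ from h.mono (hP w.length)
  have h₁ := hp (.init w) w.length rfl (fun _ _ => rfl) le_rfl fun i => i.elim0
  set n := size.eval w Fin.elim0 with hn
  have hn' : (size.eval (Store.init w).inp fun i => (Store.init w).reg (Fin.elim0 i)) = n :=
    congrArg (size.eval w) (funext fun i => i.elim0)
  have hnV : n ≤ V w.length := hv w _ _ le_rfl fun i => i.elim0
  rw [hn'] at h₁
  set g : ℕ → Bool := fun i => decide (bit.eval w (fun _ => i) ≠ 0) with hg
  -- The output grows at its front, so it is written from the last letter to the first. In round `i`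
  -- the loop counter, register `0`, holds `n - 1 - i`, which is precisely the index of the letter
  -- to be written and serves directly as the argument of `bit`.
  have h₂ := Runs.loop_reg (p := .seq q (.seq (.op (.emit 1)) (.loop (.reg 1) .skip)))
    (T := U (V w.length + w.length) + (2 + W (V w.length + w.length) * 2)) 0 n
    (fun i => ⟨fun _ => 0, w, [], ((List.range n).map g).drop (n - i)⟩) (fun i hi => by
      set s : Store := ⟨fun _ => 0, w, [], ((List.range n).map g).drop (n - i)⟩ with hs
      have a₁ := hq (s.set 0 (n - 1 - i)) (V w.length + w.length) rfl
        (fun j hj => by rw [Store.set_reg, if_neg (by omega)]) (Nat.le_add_left _ _)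
        (fun _ => by simp only [Store.set_reg, if_true]; omega)
      have hx : (bit.eval (s.set 0 (n - 1 - i)).inp fun _ => (s.set 0 (n - 1 - i)).reg 0) =
          bit.eval w fun _ => n - 1 - i := by simp [Store.set_reg, hs]
      rw [hx] at a₁
      have hb := hw w (fun _ => n - 1 - i) (V w.length + w.length) (Nat.le_add_left _ _)
        (fun _ => by omega)
      set b := bit.eval w fun _ => n - 1 - i with hb'
      have a₂ := Runs.op (.emit 1) ((s.set 0 (n - 1 - i)).add 1 b)
      have a₃ := runs_clear ((Op.emit 1).apply ((s.set 0 (n - 1 - i)).add 1 b)) 1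
      refine Runs.mono (T := U (V w.length + w.length) + (1 + ((b - 1) * 2 + 1))) ?_ (by omega)
      convert a₁.seq (a₂.seq a₃) using 1
      · ext1
        · ext j
          simp only [Op.apply, Store.set_reg, Store.add_reg, update_apply]
          split_ifs <;> grind
        · rfl
        · rfl
        · have hd : ((List.range n).map g).drop (n - (i + 1)) =
              g (n - 1 - i) :: ((List.range n).map g).drop (n - i) := by
            rw [List.drop_eq_getElem_cons (by simp; omega)]
            simp only [List.getElem_map, List.getElem_range]
            rw [show n - (i + 1) + 1 = n - i by omega, show n - (i + 1) = n - 1 - i by omega]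
          rw [hd]
          simp only [Store.set_out, Op.apply, Store.add_out, hs]
          simp [Store.add_reg, Store.set_reg, hg, ← hb']
      · simp [Op.apply, Store.set_reg, Store.add_reg, hs])
  -- The final configuration requires every stack except the output to be empty, so the input is
  -- moved to the shadow and the shadow is discarded.
  have h₃ := Runs.loop (c := .inp) (p := .skip) (T := 0) w.length
    (fun i => (⟨fun _ => 0, w, [], (List.range n).map g⟩ : Store).readTo w i)
    (fun i hi => ⟨_, Store.pop_inp_readTo _ _ _ hi, Runs.skip _⟩)
    (Store.pop_inp_readTo_of_le _ _ _ le_rfl)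
  have h₄ := Runs.loop (c := .shadow) (p := .skip) (T := 0) w.length
    (fun i => (⟨fun _ => 0, [], w.reverse.drop i, (List.range n).map g⟩ : Store))
    (fun i hi => ⟨_, by
      simp only [Store.pop]
      rw [List.drop_eq_getElem_cons (by simpa using hi)], Runs.skip _⟩)
    (by simp only [Store.pop]; rw [List.drop_eq_nil_of_le (by simp)])
  have hfin : eb (f a) = (List.range n).map g := h a
  refine Runs.mono (h₁.seq ((?_ : Runs _ _ ⟨fun _ => 0, w, [], (List.range n).map g⟩
    (n * (U (V w.length + w.length) + (2 + W (V w.length + w.length) * 2) + 2) + 1)).seq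
    ((?_ : Runs _ _ ⟨fun _ => 0, [], w.reverse, (List.range n).map g⟩ (w.length * 2 + 1)).seq
      (?_ : Runs _ _ _ (w.length * 2 + 1))))) ?_
  · convert h₂ using 1
    · ext1
      · ext j
        simp only [Store.set_reg, Store.add_reg, Store.init]
        split_ifs <;> grind
      · rfl
      · rfl
      · simp [Store.init]
    · ext1
      · ext j
        simp [Store.set_reg]
      · rfl
      · rfl
      · simp
  · convert h₃ using 1
    · simp [Store.readTo]
    · simp only [Store.readTo]
      rw [List.drop_eq_nil_of_le le_rfl, List.take_of_length_le le_rfl]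
  · convert h₄ using 1
    · rfl
    · rw [List.drop_eq_nil_of_le (as := w.reverse) (i := w.length) (by simp), hfin]
      rfl
  · have := Nat.mul_le_mul_right
      (U (V w.length + w.length) + (2 + W (V w.length + w.length) * 2 + 2)) hnV
    simp only [← Nat.add_assoc] at this ⊢
    omega

end CrossComp

/-! ### Path decompositions as interval representations, and the upper bound on pathwidth. -/

namespace CrossComp

/-! ### Interval representations -/

section Interval

variable {V : Type*}

/-- The intervals `[a v, b v]`, for `v ∈ U`, form a path decomposition of `G[U]` with bags of
cardinality at most `m`. -/
structure IsIntervalRep (G : SimpleGraph V) (U : Set V) (a b : V → ℕ) (m : ℕ) : Prop where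
  le : ∀ v ∈ U, a v ≤ b v
  adj : ∀ u ∈ U, ∀ v ∈ U, G.Adj u v → a u ≤ b v
  card : ∀ j, {v | v ∈ U ∧ a v ≤ j ∧ j ≤ b v}.ncard ≤ m

theorem foldr_max_le_iff (l : List ℕ) (m : ℕ) : l.foldr max 0 ≤ m ↔ ∀ x ∈ l, x ≤ m := by
  induction l <;> simp_all

theorem width_le_iff (bags : List (Finset V)) (w : ℕ) :
    width bags ≤ w ↔ ∀ B ∈ bags, B.card ≤ w + 1 := by
  rw [width, Nat.sub_le_iff_le_add, foldr_max_le_iff]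
  simp

theorem exists_isPathDecomposition [Finite V] (G : SimpleGraph V) :
    ∃ bags : List (Finset V), IsPathDecomposition G bags ∧ width bags = pathwidth G := by
  have := Fintype.ofFinite V
  have h : {w | ∃ bags : List (Finset V), IsPathDecomposition G bags ∧ width bags = w}.Nonempty :=
    ⟨width [Finset.univ], [Finset.univ], ⟨by simp, by simp, fun v i j l _ _ hl _ _ => by
      have : j = 0 := by simp only [List.length_singleton] at hl; omega
      subst this; simp⟩, rfl⟩
  exact Nat.sInf_mem h

/-- A vertex is described by the least and the greatest index of a bag containing it. These exist
because every vertex is covered, and convexity fills in everything between them. -/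
theorem IsPathDecomposition.exists_isIntervalRep [Finite V] {G : SimpleGraph V}
    {bags : List (Finset V)} (h : IsPathDecomposition G bags) {m : ℕ}
    (hm : ∀ B ∈ bags, B.card ≤ m) : ∃ a b, IsIntervalRep G Set.univ a b m := by
  let S : V → Set ℕ := fun v => {i | ∃ hi : i < bags.length, v ∈ bags[i]}
  have hne : ∀ v, (S v).Nonempty := fun v => by
    obtain ⟨B, hB, hv⟩ := h.vertex_mem v
    obtain ⟨i, hi, rfl⟩ := List.getElem_of_mem hB
    exact ⟨i, hi, hv⟩
  have hbd : ∀ v, BddAbove (S v) := fun v => ⟨bags.length, fun i ⟨hi, _⟩ => hi.le⟩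
  have hconv : ∀ v j, sInf (S v) ≤ j → j ≤ sSup (S v) → j ∈ S v := fun v j h₁ h₂ => by
    obtain ⟨hi, hvi⟩ := Nat.sInf_mem (hne v)
    obtain ⟨hl, hvl⟩ := Nat.sSup_mem (hne v) (hbd v)
    exact ⟨h₂.trans_lt hl, h.convex v _ j _ h₁ h₂ hl hvi hvl⟩
  refine ⟨fun v => sInf (S v), fun v => sSup (S v), fun v _ => ?_, fun u _ v _ huv => ?_,
    fun j => ?_⟩
  · exact Nat.sInf_le (Nat.sSup_mem (hne v) (hbd v))
  · obtain ⟨B, hB, hu, hv⟩ := h.edge_mem u v huv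
    obtain ⟨i, hi, rfl⟩ := List.getElem_of_mem hB
    exact (Nat.sInf_le (s := S u) (m := i) ⟨hi, hu⟩).trans (le_csSup (hbd v) ⟨hi, hv⟩)
  · by_cases hj : j < bags.length
    · refine le_trans ?_ (hm _ (List.getElem_mem hj))
      rw [← Set.ncard_coe_finset]
      exact Set.ncard_le_ncard fun v ⟨_, h₁, h₂⟩ => (hconv v j h₁ h₂).2
    · have : {v | v ∈ Set.univ ∧ sInf (S v) ≤ j ∧ j ≤ sSup (S v)} = ∅ :=
        Set.eq_empty_of_forall_notMem fun v ⟨_, h₁, h₂⟩ => hj (hconv v j h₁ h₂).1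
      rw [this, Set.ncard_empty]
      exact Nat.zero_le _

/-- This is the interface to pathwidth for the rest of the proof: restricting, clipping and
concatenating decompositions become arithmetic on the end points of intervals. -/
theorem pathwidth_le_iff [Finite V] (G : SimpleGraph V) (w : ℕ) :
    pathwidth G ≤ w ↔ ∃ a b, IsIntervalRep G Set.univ a b (w + 1) := by
  constructor
  · intro h
    obtain ⟨bags, hb, hw⟩ := exists_isPathDecomposition G
    exact hb.exists_isIntervalRep ((width_le_iff _ _).1 (hw.trans_le h))
  · rintro ⟨a, b, h⟩
    classical
    have := Fintype.ofFinite V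
    obtain ⟨M, hM⟩ := (Set.finite_range b).bddAbove
    have hM' : ∀ v, b v < M + 1 := fun v => Nat.lt_succ_of_le (hM ⟨v, rfl⟩)
    let B : ℕ → Finset V := fun j => Finset.univ.filter fun v => a v ≤ j ∧ j ≤ b v
    have hB : IsPathDecomposition G ((List.range (M + 1)).map B) := by
      refine ⟨fun v => ?_, fun u v huv => ?_, fun v i j l hij hjl hl hi hj => ?_⟩
      · exact ⟨B (b v), List.mem_map_of_mem (List.mem_range.2 (hM' v)), by simp [B, h.le]⟩
      -- Two intersecting intervals share the smaller of their right end points.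
      · refine ⟨B (min (b u) (b v)), List.mem_map_of_mem (List.mem_range.2
          ((min_le_left _ _).trans_lt (hM' u))), ?_⟩
        have := h.adj u trivial v trivial huv
        have := h.adj v trivial u trivial huv.symm
        simp [B, h.le, *]
      · simp only [List.getElem_map, List.getElem_range, B, Finset.mem_filter, Finset.mem_univ,
          true_and] at hi hj ⊢
        exact ⟨hi.1.trans hij, hjl.trans hj.2⟩
    have hw : pathwidth G ≤ width ((List.range (M + 1)).map B) := Nat.sInf_le ⟨_, hB, rfl⟩
    refine hw.trans ((width_le_iff _ _).2 fun C hC => ?_)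
    obtain ⟨j, _, rfl⟩ := List.mem_map.1 hC
    have := h.card j
    rw [← Set.ncard_coe_finset]
    simpa [B] using this

theorem pathwidth_le_of_injective {V' : Type*} [Finite V] [Finite V'] {G : SimpleGraph V}
    {G' : SimpleGraph V'} (f : V → V') (hf : Function.Injective f)
    (hadj : ∀ u v, G.Adj u v → G'.Adj (f u) (f v)) : pathwidth G ≤ pathwidth G' := by
  obtain ⟨a, b, h⟩ := (pathwidth_le_iff G' _).1 le_rfl
  refine (pathwidth_le_iff G _).2 ⟨a ∘ f, b ∘ f, fun v _ => h.le _ trivial,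
    fun u _ v _ huv => h.adj _ trivial _ trivial (hadj u v huv), fun j => ?_⟩
  refine le_trans ?_ (h.card j)
  rw [← Set.ncard_image_of_injective _ hf]
  refine Set.ncard_le_ncard ?_
  rintro _ ⟨v, ⟨_, hv⟩, rfl⟩
  exact ⟨trivial, hv⟩

theorem pathwidth_congr {V' : Type*} [Finite V] {G : SimpleGraph V}
    {G' : SimpleGraph V'} (e : G ≃g G') : pathwidth G = pathwidth G' := by
  have := Finite.of_equiv _ e.toEquiv
  exact le_antisymm
    (pathwidth_le_of_injective e e.injective fun _ _ => e.map_adj_iff.2)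
    (pathwidth_le_of_injective e.symm e.symm.injective fun _ _ => e.symm.map_adj_iff.2)

/-- `G[U]` has a path decomposition with bags of cardinality at most `m` such that all vertices of
`L` are in the first bag and all vertices of `R` are in the last bag. -/
def HasRep (G : SimpleGraph V) (U L R : Set V) (m : ℕ) : Prop :=
  ∃ (a b : V → ℕ) (M : ℕ), IsIntervalRep G U a b m ∧ (∀ v ∈ U, b v ≤ M) ∧
    (∀ v ∈ L, a v = 0) ∧ ∀ v ∈ R, b v = M

variable {G : SimpleGraph V} {U U₁ U₂ L R S C : Set V} {m : ℕ}

theorem HasRep.mono {m' : ℕ} {L' R' : Set V} (h : HasRep G U L R m) (hm : m ≤ m') (hL : L' ⊆ L)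
    (hR : R' ⊆ R) : HasRep G U L' R' m' :=
  let ⟨a, b, M, h, hM, hl, hr⟩ := h
  ⟨a, b, M, ⟨h.le, h.adj, fun j => (h.card j).trans hm⟩, hM, fun v hv => hl v (hL hv),
    fun v hv => hr v (hR hv)⟩

theorem HasRep.empty (G : SimpleGraph V) : HasRep G ∅ ∅ ∅ 0 :=
  ⟨fun _ => 0, fun _ => 0, 0, ⟨by simp, by simp, by simp⟩, by simp, by simp, by simp⟩

/-- Stretching `C` over all positions `0, …, M` puts it into every bag, in particular into the two
outermost ones. All edges at `C` are then covered, and `C` may overlap `U`. -/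
theorem HasRep.join [Finite V] (h : HasRep G U L R m) (C : Set V) :
    HasRep G (U ∪ C) C C (m + C.ncard) := by
  classical
  obtain ⟨a, b, M, h, hM, _, _⟩ := h
  refine ⟨fun v => if v ∈ C then 0 else a v, fun v => if v ∈ C then M else b v, M,
    ⟨?_, ?_, fun j => ?_⟩, ?_, ?_, ?_⟩
  · rintro v hv
    by_cases hC : v ∈ C
    · simp [hC]
    · simpa [hC] using h.le v (hv.resolve_right hC)
  · rintro u hu v hv huv
    by_cases hC : u ∈ C
    · simp [hC]
    · have hu' := hu.resolve_right hC
      by_cases hC' : v ∈ C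
      · simpa [hC, hC'] using (h.le u hu').trans (hM u hu')
      · simpa [hC, hC'] using h.adj u hu' v (hv.resolve_right hC') huv
  · refine le_trans (Set.ncard_le_ncard (t := {v | v ∈ U ∧ a v ≤ j ∧ j ≤ b v} ∪ C) ?_)
      ((Set.ncard_union_le _ _).trans (Nat.add_le_add_right (h.card j) _))
    rintro v ⟨hv, h₁, h₂⟩
    by_cases hC : v ∈ C
    · exact .inr hC
    · simp only [hC, if_false] at h₁ h₂
      exact .inl ⟨hv.resolve_right hC, h₁, h₂⟩
  · rintro v hv
    by_cases hC : v ∈ C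
    · simp [hC]
    · simpa [hC] using hM v (hv.resolve_right hC)
  · intro v hv; simp [hv]
  · intro v hv; simp [hv]

/-- The second representation is shifted behind the first. The vertices of `S` lie in the last bag
of the first and in the first bag of the second, so their two intervals merge into one, and each bag
of the result is contained in a bag of one of the two parts. -/
theorem HasRep.glue [Finite V] (h₁ : HasRep G U₁ L S m) (h₂ : HasRep G U₂ S R m)
    (hS : ∀ v, v ∈ S ↔ v ∈ U₁ ∧ v ∈ U₂) (hR : R ⊆ U₂)
    (hadj : ∀ u ∈ U₁, ∀ v ∈ U₂, G.Adj u v → u ∈ S ∨ v ∈ S) : HasRep G (U₁ ∪ U₂) ∅ R m := by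
  classical
  obtain ⟨a₁, b₁, M₁, r₁, hM₁, _, hS₁⟩ := h₁
  obtain ⟨a₂, b₂, M₂, r₂, hM₂, hS₂, hR₂⟩ := h₂
  refine ⟨fun v => if v ∈ U₁ then a₁ v else M₁ + 1 + a₂ v,
    fun v => if v ∈ U₂ then M₁ + 1 + b₂ v else b₁ v, M₁ + 1 + M₂, ⟨?_, ?_, fun j => ?_⟩,
    ?_, by simp, ?_⟩
  · intro v hv
    by_cases hv₁ : v ∈ U₁ <;> by_cases hv₂ : v ∈ U₂
    · simp only [hv₁, hv₂, if_true]
      have := r₁.le v hv₁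
      have := hM₁ v hv₁
      omega
    · simpa [hv₁, hv₂] using r₁.le v hv₁
    · simpa [hv₁, hv₂] using r₂.le v hv₂
    · simp_all
  · intro u hu v hv huv
    have hadj' := hadj v
    have hadj := hadj u
    simp only [hS] at hadj hadj' hS₁ hS₂
    by_cases hu₁ : u ∈ U₁ <;> by_cases hv₂ : v ∈ U₂
    · simp only [hu₁, hv₂, if_true]
      have := r₁.le u hu₁
      have := hM₁ u hu₁
      omega
    · have hv₁ : v ∈ U₁ := hv.resolve_right hv₂
      simpa [hu₁, hv₂] using r₁.adj u hu₁ v hv₁ huv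
    · have hu₂ : u ∈ U₂ := hu.resolve_left hu₁
      simpa [hu₁, hv₂] using r₂.adj u hu₂ v hv₂ huv
    · have hv₁ : v ∈ U₁ := hv.resolve_right hv₂
      have hu₂ : u ∈ U₂ := hu.resolve_left hu₁
      have := hadj' hv₁ u hu₂ huv.symm
      tauto
  · simp only [hS] at hS₁ hS₂
    rcases le_or_gt j M₁ with hj | hj
    · refine le_trans (Set.ncard_le_ncard ?_) (r₁.card j)
      rintro v ⟨hv, h₁, h₂⟩
      have hv₁ : v ∈ U₁ := by
        by_contra hv₁
        simp only [hv₁, if_false] at h₁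
        omega
      simp only [hv₁, if_true] at h₁
      refine ⟨hv₁, h₁, ?_⟩
      by_cases hv₂ : v ∈ U₂
      · rw [hS₁ v ⟨hv₁, hv₂⟩]; exact hj
      · simpa [hv₂] using h₂
    · refine le_trans (Set.ncard_le_ncard ?_) (r₂.card (j - (M₁ + 1)))
      rintro v ⟨hv, h₁, h₂⟩
      have hv₂ : v ∈ U₂ := by
        by_contra hv₂
        have hv₁ : v ∈ U₁ := hv.resolve_right hv₂
        simp only [hv₂, if_false] at h₂
        have := hM₁ v hv₁
        omega
      simp only [hv₂, if_true] at h₂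
      refine ⟨hv₂, ?_, by omega⟩
      by_cases hv₁ : v ∈ U₁
      · rw [hS₂ v ⟨hv₁, hv₂⟩]; exact Nat.zero_le _
      · simp only [hv₁, if_false] at h₁
        omega
  · intro v hv
    by_cases hv₂ : v ∈ U₂
    · simpa [hv₂] using hM₂ v hv₂
    · have := hM₁ v (hv.resolve_right hv₂)
      simp only [hv₂, if_false]
      omega
  · intro v hv
    simp [hR hv, hR₂ v hv]

end Interval

/-! ### Subtrees of the combined graph -/

section Combined

variable {s k : ℕ} {V : TernaryLeaf s → Type*} {G : ∀ x, SimpleGraph (V x)}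

/-- The tree node that a vertex of the combined graph sits at. -/
def nodeWord : (TernaryNode s × Fin k) ⊕ (Σ x, V x) → List (Fin 3)
  | .inl p => p.1.1
  | .inr q => q.1.1

/-- The vertices at descendants of the node `w`. -/
def subtreeSet (V : TernaryLeaf s → Type*) (k : ℕ) (w : List (Fin 3)) :
    Set ((TernaryNode s × Fin k) ⊕ (Σ x, V x)) := {p | w <:+ nodeWord p}

/-- The clique of the node `w`. -/
def nodeClique (V : TernaryLeaf s → Type*) (k : ℕ) (w : List (Fin 3)) :
    Set ((TernaryNode s × Fin k) ⊕ (Σ x, V x)) := {p | ∃ q, p = .inl q ∧ q.1.1 = w}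

/-- The vertices of the graph plugged in at the leaf `x`. -/
def leafBlob (V : TernaryLeaf s → Type*) (k : ℕ) (x : TernaryLeaf s) :
    Set ((TernaryNode s × Fin k) ⊕ (Σ x, V x)) := {p | ∃ v : V x, p = .inr ⟨x, v⟩}

variable {w : List (Fin 3)} {a b : Fin 3} {p q : (TernaryNode s × Fin k) ⊕ (Σ x, V x)}

theorem nodeWord_length_le (p : (TernaryNode s × Fin k) ⊕ (Σ x, V x)) :
    (nodeWord p).length ≤ s := by
  rcases p with ⟨⟨u, hu⟩, i⟩ | ⟨x, v⟩
  · exact hu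
  · exact x.2.le

theorem nodeClique_subset : nodeClique V k w ⊆ subtreeSet V k w := by
  rintro _ ⟨q, rfl, rfl⟩
  exact List.suffix_rfl

theorem subtreeSet_cons_subset : subtreeSet V k (a :: w) ⊆ subtreeSet V k w :=
  fun _ hp => (List.suffix_cons a w).trans hp

/-- Ancestors are suffixes, and a word has at most one suffix of a given length. Hence the subtrees
of different children are disjoint. -/
theorem eq_of_mem_subtreeSet (ha : p ∈ subtreeSet V k (a :: w)) (hb : p ∈ subtreeSet V k (b :: w)) :
    a = b := by
  have := List.IsSuffix.eq_of_length (List.suffix_of_suffix_length_le ha hb (by simp)) (by simp)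
  simpa using this

theorem notMem_nodeClique_of_mem_subtreeSet (h : p ∈ subtreeSet V k (a :: w)) :
    p ∉ nodeClique V k w := by
  rintro ⟨q, rfl, rfl⟩
  have := List.IsSuffix.length_le h
  simp [nodeWord] at this

theorem adj_cases (h : (combinedGraph s k G).Adj p q) :
    nodeWord p = nodeWord q ∨ (p ∈ nodeClique V k (nodeWord p) ∧ q ∈ nodeClique V k (nodeWord q) ∧
      ∃ a, nodeWord q = a :: nodeWord p ∨ nodeWord p = a :: nodeWord q) := by
  rcases p with ⟨u, i⟩ | ⟨x, v⟩ <;> rcases q with ⟨u', j⟩ | ⟨y, v'⟩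
  · obtain ⟨_, h | ⟨a, h⟩ | ⟨a, h⟩⟩ := h
    · simp only [Sum.inl.injEq] at h
      exact .inl (congrArg Subtype.val h)
    · exact .inr ⟨⟨_, rfl, rfl⟩, ⟨_, rfl, rfl⟩, a, .inl h⟩
    · exact .inr ⟨⟨_, rfl, rfl⟩, ⟨_, rfl, rfl⟩, a, .inr h⟩
  · exact .inl h
  · exact .inl (Eq.symm h)
  · obtain ⟨z, _, _, h₁, h₂, _⟩ := h
    simp only [Sigma.mk.injEq] at h₁ h₂
    exact .inl (congrArg Subtype.val (h₁.1.trans h₂.1.symm))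

/-- Edges stay at one node or join the cliques of a node and its parent. So a subtree is attached to
the rest of the graph only through these two cliques, which is what gluing requires. -/
theorem mem_of_adj (h : (combinedGraph s k G).Adj p q) (hp : p ∈ subtreeSet V k (a :: w)) :
    q ∈ subtreeSet V k (a :: w) ∨ (p ∈ nodeClique V k (a :: w) ∧ q ∈ nodeClique V k w) := by
  obtain h | ⟨hp', hq', c, h | h⟩ := adj_cases h
  · exact .inl (by rwa [subtreeSet, Set.mem_ofPred_eq, ← h])
  · refine .inl ?_
    rw [subtreeSet, Set.mem_ofPred_eq, h]
    exact List.IsSuffix.trans hp (List.suffix_cons _ _)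
  · have hp'' : a :: w <:+ c :: nodeWord q := h ▸ hp
    rcases List.suffix_cons_iff.1 hp'' with h' | h'
    · obtain ⟨rfl, rfl⟩ := List.cons.inj h'
      exact .inr ⟨h ▸ hp', hq'⟩
    · exact .inl h'

theorem subtreeSet_eq_of_lt (hw : w.length < s) :
    subtreeSet V k w = (subtreeSet V k (0 :: w) ∪ subtreeSet V k (1 :: w) ∪
      subtreeSet V k (2 :: w)) ∪ nodeClique V k w := by
  ext p
  constructor
  · intro hp
    obtain ⟨l, hl⟩ := id hp
    rcases l.eq_nil_or_concat with rfl | ⟨l, a, rfl⟩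
    · right
      rcases p with ⟨u, i⟩ | ⟨x, v⟩
      · exact ⟨_, rfl, hl.symm⟩
      · exact absurd (congrArg List.length hl) (by
          have := x.2
          simp only [List.nil_append, nodeWord]; omega)
    · left
      have : a :: w <:+ nodeWord p := ⟨l, by rw [← hl]; simp⟩
      fin_cases a
      · exact .inl (.inl this)
      · exact .inl (.inr this)
      · exact .inr this
  · rintro (((h | h) | h) | h)
    exacts [subtreeSet_cons_subset h, subtreeSet_cons_subset h, subtreeSet_cons_subset h,
      nodeClique_subset h]

theorem subtreeSet_leaf (x : TernaryLeaf s) :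
    subtreeSet V k x.1 = leafBlob V k x ∪ nodeClique V k x.1 := by
  ext p
  constructor
  · intro hp
    have hp' : x.1 = nodeWord p := List.IsSuffix.eq_of_length_le hp (by
      rw [x.2]; exact nodeWord_length_le p)
    rcases p with ⟨u, i⟩ | ⟨y, v⟩
    · exact .inr ⟨_, rfl, hp'.symm⟩
    · obtain rfl : x = y := Subtype.ext hp'
      exact .inl ⟨v, rfl⟩
  · rintro (⟨v, rfl⟩ | h)
    · exact List.suffix_rfl
    · exact nodeClique_subset h

theorem subtreeSet_nil : subtreeSet V k [] = Set.univ :=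
  Set.eq_univ_of_forall fun _ => List.nil_suffix

theorem nodeClique_eq_range (hw : w.length ≤ s) :
    nodeClique V k w = Set.range fun i : Fin k => Sum.inl (⟨w, hw⟩, i) := by
  ext p
  constructor
  · rintro ⟨⟨u, i⟩, rfl, rfl⟩
    exact ⟨i, rfl⟩
  · rintro ⟨i, rfl⟩
    exact ⟨_, rfl, rfl⟩

theorem ncard_nodeClique (hw : w.length ≤ s) : (nodeClique V k w).ncard = k := by
  rw [nodeClique_eq_range hw, ← Set.image_univ, Set.ncard_image_of_injective _ (by
    intro i j h; simpa using h), Set.ncard_univ, Nat.card_eq_fintype_card, Fintype.card_fin]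

theorem adj_of_mem_nodeClique (hp : p ∈ nodeClique V k w) (hq : q ∈ nodeClique V k w)
    (hne : p ≠ q) : (combinedGraph s k G).Adj p q := by
  obtain ⟨⟨⟨u, hu⟩, i⟩, rfl, rfl⟩ := hp
  obtain ⟨⟨⟨u', hu'⟩, j⟩, rfl, h⟩ := hq
  simp only at h
  subst h
  exact ⟨fun h => hne (by simpa using h), .inl rfl⟩

theorem adj_of_mem_nodeClique_cons (hp : p ∈ nodeClique V k w)
    (hq : q ∈ nodeClique V k (a :: w)) : (combinedGraph s k G).Adj p q := by
  obtain ⟨⟨⟨u, hu⟩, i⟩, rfl, rfl⟩ := hp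
  obtain ⟨⟨⟨u', hu'⟩, j⟩, rfl, h⟩ := hq
  simp only at h
  subst h
  refine ⟨fun h => ?_, .inr (.inl ⟨a, rfl⟩)⟩
  simp at h

theorem adj_of_mem_leafBlob {x : TernaryLeaf s} (hp : p ∈ nodeClique V k x.1)
    (hq : q ∈ leafBlob V k x) : (combinedGraph s k G).Adj p q := by
  obtain ⟨⟨⟨u, hu⟩, i⟩, rfl, h⟩ := hp
  obtain ⟨v, rfl⟩ := hq
  exact h

theorem adj_inr_iff {x : TernaryLeaf s} {u v : V x} :
    (combinedGraph s k G).Adj (.inr ⟨x, u⟩) (.inr ⟨x, v⟩) ↔ (G x).Adj u v := by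
  constructor
  · rintro ⟨y, u', v', h₁, h₂, h⟩
    obtain rfl : x = y := congrArg Sigma.fst h₁
    simp only [Sigma.mk.injEq, heq_eq_eq, true_and] at h₁ h₂
    rwa [h₁, h₂]
  · exact fun h => ⟨x, u, v, rfl, rfl, h⟩

/-! ### The upper bound -/

instance (s : ℕ) : Finite (TernaryNode s) := (List.finite_length_le (Fin 3) s).to_subtype

variable [∀ x, Finite (V x)]

theorem hasRep_leafBlob {x : TernaryLeaf s} {lo hi : V x → ℕ} {m : ℕ}
    (h : IsIntervalRep (G x) Set.univ lo hi m) :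
    HasRep (combinedGraph s k G) (leafBlob V k x) ∅ ∅ m := by
  classical
  -- The value `0` outside the graph at `x` is arbitrary, since representations constrain only the
  -- vertices of the set they represent.
  let ext : (V x → ℕ) → (TernaryNode s × Fin k) ⊕ (Σ x, V x) → ℕ := fun f p =>
    match p with
    | .inl _ => 0
    | .inr ⟨y, v⟩ => if h : y = x then f (h ▸ v) else 0
  have hext : ∀ f v, ext f (.inr ⟨x, v⟩) = f v := fun f v => by simp [ext]
  obtain ⟨M, hM⟩ := (Set.finite_range hi).bddAbove
  refine ⟨ext lo, ext hi, M, ⟨?_, ?_, fun j => ?_⟩, ?_, by simp, by simp⟩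
  · rintro _ ⟨v, rfl⟩
    simpa only [hext] using h.le v trivial
  · rintro _ ⟨u, rfl⟩ _ ⟨v, rfl⟩ huv
    simpa only [hext] using h.adj u trivial v trivial (adj_inr_iff.1 huv)
  · refine le_trans ?_ (h.card j)
    refine le_trans (Set.ncard_le_ncard (t := (fun v : V x => (Sum.inr ⟨x, v⟩ :
      (TernaryNode s × Fin k) ⊕ (Σ x, V x))) ''
        {v | v ∈ Set.univ ∧ lo v ≤ j ∧ j ≤ hi v}) ?_) (Set.ncard_image_le)
    rintro _ ⟨⟨v, rfl⟩, hv⟩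
    rw [hext, hext] at hv
    exact ⟨v, ⟨trivial, hv⟩, rfl⟩
  · rintro _ ⟨v, rfl⟩
    rw [hext]
    exact hM ⟨v, rfl⟩

/-- At a leaf the clique is added to all bags of a decomposition of `G x`, giving size `2k`. At an
inner node the three child subtrees are put side by side and the clique of the node is added to all
bags, which costs `k`. The clique ends up in the outermost bags, where further pieces can be
attached. -/
theorem hasRep_subtreeSet (hG : ∀ x, ∃ lo hi, IsIntervalRep (G x) Set.univ lo hi k) (h : ℕ) :
    ∀ w : List (Fin 3), w.length + h = s → HasRep (combinedGraph s k G) (subtreeSet V k w)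
      (nodeClique V k w) (nodeClique V k w) (k * (h + 2)) := by
  induction h with
  | zero =>
    intro w hw
    obtain ⟨lo, hi, hr⟩ := hG ⟨w, hw⟩
    have := (hasRep_leafBlob (k := k) hr).join (nodeClique V k w)
    rw [ncard_nodeClique hw.le] at this
    rw [subtreeSet_leaf ⟨w, hw⟩]
    exact this.mono (by omega) subset_rfl subset_rfl
  | succ h ih =>
    intro w hw
    have hc : ∀ a : Fin 3, HasRep (combinedGraph s k G) (subtreeSet V k (a :: w)) ∅ ∅
        (k * (h + 2)) := fun a =>
      (ih (a :: w) (by simp only [List.length_cons]; omega)).mono le_rfl (Set.empty_subset _)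
        (Set.empty_subset _)
    have hne : ∀ {a b : Fin 3}, a ≠ b → ∀ u ∈ subtreeSet V k (a :: w),
        ∀ v ∈ subtreeSet V k (b :: w), ¬ (combinedGraph s k G).Adj u v := by
      intro a b hab u hu v hv huv
      rcases mem_of_adj huv hu with h | h
      · exact hab (eq_of_mem_subtreeSet h hv)
      · exact notMem_nodeClique_of_mem_subtreeSet hv h.2
    have h01 := (hc 0).glue (hc 1) (fun v => by
        simp only [Set.mem_empty_iff_false, false_iff]
        exact fun h => absurd (eq_of_mem_subtreeSet h.1 h.2) (by decide)) (Set.empty_subset _)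
      fun u hu v hv huv => (hne (by decide) u hu v hv huv).elim
    have h012 := h01.glue (hc 2) (fun v => by
        simp only [Set.mem_empty_iff_false, false_iff]
        rintro ⟨h | h, h'⟩ <;> exact absurd (eq_of_mem_subtreeSet h h') (by decide))
      (Set.empty_subset _) fun u hu v hv huv => by
        rcases hu with hu | hu <;> exact (hne (by decide) u hu v hv huv).elim
    have := h012.join (nodeClique V k w)
    rw [ncard_nodeClique (by omega), ← subtreeSet_eq_of_lt (by omega)] at this
    exact this.mono ((Nat.mul_succ k (h + 2)).ge) subset_rfl
      subset_rfl

/-- The unit saved at `x₀` survives on the path to the root. For a node `w` on it with path child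
`a` and other children `b`, `c`, the pieces are arranged as: subtree of `b`; the cliques of `b` and
`w`; subtree of `a` with the clique of `w` in all bags; the cliques of `w` and `c`; subtree of `c`.
The outer subtrees have bags of size `k(h+2)` without the clique of `w`, the linking bags have at
most `2k` vertices, and only the middle piece pays for both a subtree and the clique of `w`. -/
theorem hasRep_subtreeSet_of_suffix (hk : 2 ≤ k)
    (hG : ∀ x, ∃ lo hi, IsIntervalRep (G x) Set.univ lo hi k) (x₀ : TernaryLeaf s)
    (hx₀ : ∃ lo hi, IsIntervalRep (G x₀) Set.univ lo hi (k - 1)) (h : ℕ) :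
    ∀ w : List (Fin 3), w.length + h = s → w <:+ x₀.1 →
      HasRep (combinedGraph s k G) (subtreeSet V k w) ∅ ∅ (k * (h + 2) - 1) := by
  induction h with
  | zero =>
    intro w hw hsuf
    obtain rfl : w = x₀.1 := hsuf.eq_of_length (by rw [x₀.2]; exact hw)
    obtain ⟨lo, hi, hr⟩ := hx₀
    have := (hasRep_leafBlob (k := k) hr).join (nodeClique V k x₀.1)
    rw [ncard_nodeClique hw.le] at this
    rw [subtreeSet_leaf x₀]
    exact this.mono (by omega) (Set.empty_subset _) (Set.empty_subset _)
  | succ h ih =>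
    intro w hw hsuf
    obtain ⟨a, ha⟩ : ∃ a, a :: w <:+ x₀.1 := by
      obtain ⟨l, hl⟩ := hsuf
      rcases l.eq_nil_or_concat with rfl | ⟨l, a, rfl⟩
      · exact absurd (congrArg List.length hl) (by
          have := x₀.2
          simp only [List.nil_append]; omega)
      · exact ⟨a, l, by rw [← hl]; simp⟩
    obtain ⟨b, c, hab, hac, hbc, hU⟩ : ∃ b c : Fin 3, a ≠ b ∧ a ≠ c ∧ b ≠ c ∧
        subtreeSet V k w = subtreeSet V k (b :: w) ∪ (nodeClique V k (b :: w) ∪ nodeClique V k w) ∪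
          (subtreeSet V k (a :: w) ∪ nodeClique V k w) ∪
            (nodeClique V k (c :: w) ∪ nodeClique V k w) ∪ subtreeSet V k (c :: w) := by
      -- Addition in `Fin 3` is modulo three, so these are the two siblings of `a`.
      refine ⟨a + 1, a + 2, by clear ha; revert a; decide, by clear ha; revert a; decide,
        by clear ha; revert a; decide, ?_⟩
      rw [subtreeSet_eq_of_lt (by omega)]
      ext p
      have h₁ := fun a => @nodeClique_subset s k V (a :: w) p
      have h₁0 := h₁ 0
      have h₁1 := h₁ 1
      have h₁2 := h₁ 2
      fin_cases a <;> simp only [Set.mem_union] <;>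
        simp only [Fin.mk_zero, Fin.mk_one, Fin.zero_add, Fin.reduceAdd, Fin.reduceFinMk] <;> tauto
    have hlen : ∀ a : Fin 3, (a :: w).length + h = s := fun a => by
      simp only [List.length_cons]; omega
    set m := k * (h + 1 + 2) - 1 with hm
    have hm' : k * (h + 1 + 2) = k * (h + 2) + k := Nat.mul_succ _ _
    have hm'' : k * (h + 2) = k * h + k + k := by ring
    have cb := fun a : Fin 3 => @nodeClique_subset s k V (a :: w)
    have child : ∀ d : Fin 3, HasRep (combinedGraph s k G) (subtreeSet V k (d :: w))
        (nodeClique V k (d :: w)) (nodeClique V k (d :: w)) m := fun d =>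
      (hasRep_subtreeSet hG h (d :: w) (hlen d)).mono (by omega) subset_rfl subset_rfl
    have link : ∀ d : Fin 3, HasRep (combinedGraph s k G)
        (nodeClique V k (d :: w) ∪ nodeClique V k w) (nodeClique V k (d :: w) ∪ nodeClique V k w)
        (nodeClique V k (d :: w) ∪ nodeClique V k w) m := fun d => by
      have h₁ := (HasRep.empty (combinedGraph s k G)).join
        (nodeClique V k (d :: w) ∪ nodeClique V k w)
      rw [Set.empty_union] at h₁
      refine h₁.mono ?_ subset_rfl subset_rfl
      have h₂ := Set.ncard_union_le (nodeClique V k (d :: w)) (nodeClique V k w)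
      rw [ncard_nodeClique (by have := hlen d; omega), ncard_nodeClique (by omega)] at h₂
      omega
    have mid : HasRep (combinedGraph s k G) (subtreeSet V k (a :: w) ∪ nodeClique V k w)
        (nodeClique V k w) (nodeClique V k w) m := by
      have h₁ := (ih (a :: w) (hlen a) ha).join (nodeClique V k w)
      rw [ncard_nodeClique (by omega)] at h₁
      exact h₁.mono (by omega) subset_rfl subset_rfl
    have e₁ : ∀ {d p}, p ∈ subtreeSet V k (d :: w) → p ∉ nodeClique V k w :=
      fun h => notMem_nodeClique_of_mem_subtreeSet h
    have e₂ : ∀ {d d' p}, d ≠ d' → p ∈ subtreeSet V k (d :: w) → p ∉ subtreeSet V k (d' :: w) :=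
      fun hne h h' => hne (eq_of_mem_subtreeSet h h')
    have adj : ∀ {d p q}, (combinedGraph s k G).Adj p q → p ∈ subtreeSet V k (d :: w) →
        q ∈ subtreeSet V k (d :: w) ∨ (p ∈ nodeClique V k (d :: w) ∧ q ∈ nodeClique V k w) :=
      fun h hp => mem_of_adj h hp
    have g₁ := (child b).glue ((link b).mono le_rfl Set.subset_union_left
      (R' := nodeClique V k w) Set.subset_union_right) (fun v => by
        have := @cb b v
        have := @e₁ b v
        simp only [Set.mem_union]; grind) Set.subset_union_right (fun u hu v hv huv => by
        have := adj huv hu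
        have := @e₁ b v
        simp only [Set.mem_union] at hv; grind)
    have g₂ := g₁.glue mid (fun v => by
        have := @cb b v
        have := @e₁ b v
        have := @e₁ a v
        have := @e₂ _ _ v hab
        simp only [Set.mem_union]; grind) Set.subset_union_right (fun u hu v hv huv => by
        have := @cb b u
        have := @adj b _ _ huv
        have := @adj a _ _ huv.symm
        have := @e₂ _ _ v hab
        have := @e₂ _ _ u hab
        simp only [Set.mem_union] at hu hv; grind)
    have g₃ := g₂.glue ((link c).mono le_rfl (L' := nodeClique V k w) Set.subset_union_right
      (R' := nodeClique V k (c :: w)) Set.subset_union_left) (fun v => by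
        have := @cb b v
        have := @cb c v
        have := @e₁ b v
        have := @e₁ a v
        have := @e₁ c v
        have := @e₂ _ _ v hac
        have := @e₂ _ _ v hbc
        simp only [Set.mem_union]; grind) Set.subset_union_left (fun u hu v hv huv => by
        have := @cb b u
        have := @cb c v
        have := @adj b _ _ huv
        have := @adj a _ _ huv
        have := @adj c _ _ huv.symm
        have := @e₂ _ _ v hac
        have := @e₂ _ _ u hac
        have := @e₂ _ _ v hbc
        have := @e₂ _ _ u hbc
        simp only [Set.mem_union] at hu hv; grind)
    have g₄ := g₃.glue (child c) (fun v => by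
        have := @cb b v
        have := @cb c v
        have := @e₁ c v
        have := @e₂ _ _ v hac
        have := @e₂ _ _ v hbc
        simp only [Set.mem_union]; grind) (nodeClique_subset) (fun u hu v hv huv => by
        have := @cb b u
        have := @cb c u
        have := @adj b _ _ huv
        have := @adj a _ _ huv
        have := @adj c _ _ huv.symm
        have := @e₁ c v
        have := @e₂ _ _ v hac
        have := @e₂ _ _ u hac
        have := @e₂ _ _ v hbc
        have := @e₂ _ _ u hbc
        simp only [Set.mem_union] at hu; grind)
    rw [hU]
    exact g₄.mono le_rfl subset_rfl (Set.empty_subset _)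

end Combined

end CrossComp

/-! ### The lower bound: large bags in every subtree. -/

namespace CrossComp

/-! ### The lower bound -/

section LowerBound

variable {s k : ℕ} {V : TernaryLeaf s → Type*} {G : ∀ x, SimpleGraph (V x)}
  {lo hi : (TernaryNode s × Fin k) ⊕ (Σ x, V x) → ℕ} {m : ℕ}

/-- The bag at position `j` of an interval representation. -/
def bagAt {W : Type*} (lo hi : W → ℕ) (j : ℕ) : Set W := {v | lo v ≤ j ∧ j ≤ hi v}

/-- A bag separates what lies to its left from what lies to its right. Outside the bag at `p`, being
on the left is expressed by `hi u < p`. -/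
theorem lt_iff_of_adj (r : IsIntervalRep (combinedGraph s k G) Set.univ lo hi m) {p : ℕ}
    {u v : (TernaryNode s × Fin k) ⊕ (Σ x, V x)} (hu : u ∉ bagAt lo hi p)
    (hv : v ∉ bagAt lo hi p) (huv : (combinedGraph s k G).Adj u v) : hi u < p ↔ hi v < p := by
  have h₁ := r.adj u trivial v trivial huv
  have h₂ := r.adj v trivial u trivial huv.symm
  simp only [bagAt, Set.mem_ofPred_eq, not_and_or, not_le] at hu hv
  omega

variable [∀ x, Finite (V x)]

theorem exists_mem_diff_of_ncard_lt {W : Type*} [Finite W] {A B : Set W}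
    (h : (B ∩ A).ncard < A.ncard) : ∃ v ∈ A, v ∉ B := by
  by_contra! hA
  rw [Set.inter_eq_right.2 hA] at h
  exact h.ne rfl

/-- The intervals of the clique have the common part `[lo y, hi z]`. All vertices of `G x` are
adjacent to `y` and `z`, so their intervals clipped to this part still represent `G x`. Every
clipped bag occurs next to the full clique; if all bags had fewer than `2k` vertices here, clipped
bags would have at most `k - 1`, and `G x` would have pathwidth at most `k - 2`. -/
theorem exists_bag_leaf (hk : 2 ≤ k) (r : IsIntervalRep (combinedGraph s k G) Set.univ lo hi m)
    (x : TernaryLeaf s) (hx : ¬ pathwidth (G x) ≤ k - 2) :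
    ∃ j, k * 2 ≤ (bagAt lo hi j ∩ subtreeSet V k x.1).ncard := by
  by_contra! hlt
  apply hx
  have hY : (nodeClique V k x.1).Nonempty := by
    rw [← Set.ncard_pos, ncard_nodeClique x.2.le]; omega
  obtain ⟨y, hy, hmax⟩ := (nodeClique V k x.1).toFinite.exists_maximalFor lo _ hY
  obtain ⟨z, hz, hmin⟩ := (nodeClique V k x.1).toFinite.exists_minimalFor hi _ hY
  replace hmax : ∀ q ∈ nodeClique V k x.1, lo q ≤ lo y := fun q hq => by
    rcases le_total (lo q) (lo y) with h | h
    exacts [h, hmax hq h]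
  replace hmin : ∀ q ∈ nodeClique V k x.1, hi z ≤ hi q := fun q hq => by
    rcases le_total (hi z) (hi q) with h | h
    exacts [h, hmin hq h]
  have hle : ∀ v, lo v ≤ hi v := fun v => r.le v trivial
  have hadj : ∀ {u v}, (combinedGraph s k G).Adj u v → lo u ≤ hi v := fun h =>
    r.adj _ trivial _ trivial h
  have hyz : lo y ≤ hi z := by
    by_cases h : y = z
    · rw [h]; exact hle z
    · exact hadj (adj_of_mem_nodeClique hy hz h)
  have hblob : ∀ (q) (v : V x), q ∈ nodeClique V k x.1 →
      (combinedGraph s k G).Adj q (.inr ⟨x, v⟩) := fun q v hq => adj_of_mem_leafBlob hq ⟨v, rfl⟩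
  refine (pathwidth_le_iff _ _).2 ⟨fun v => max (lo (.inr ⟨x, v⟩)) (lo y),
    fun v => min (hi (.inr ⟨x, v⟩)) (hi z), fun v _ => ?_, fun u _ v _ huv => ?_, fun j => ?_⟩
  · have := hadj (hblob y v hy)
    have := hadj (hblob z v hz).symm
    have := hle (.inr ⟨x, v⟩)
    simp only [max_le_iff, le_min_iff]
    tauto
  · have := hadj (hblob y v hy)
    have := hadj (hblob z u hz).symm
    have : lo (.inr ⟨x, u⟩) ≤ hi (.inr ⟨x, v⟩) := hadj (adj_inr_iff.2 huv)
    simp only [max_le_iff, le_min_iff]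
    tauto
  · rw [show k - 2 + 1 = k - 1 by omega]
    set f : V x → (TernaryNode s × Fin k) ⊕ (Σ x, V x) := fun v => .inr ⟨x, v⟩ with hf
    have hinj : Function.Injective f := fun u v h => by simpa [f] using h
    change {v | v ∈ Set.univ ∧ max (lo (f v)) (lo y) ≤ j ∧ j ≤ min (hi (f v)) (hi z)}.ncard ≤ k - 1
    by_cases hj : lo y ≤ j ∧ j ≤ hi z
    · have hj' := hlt j
      have hsub : nodeClique V k x.1 ∪ f '' {v | v ∈ Set.univ ∧
          max (lo (f v)) (lo y) ≤ j ∧ j ≤ min (hi (f v)) (hi z)} ⊆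
          bagAt lo hi j ∩ subtreeSet V k x.1 := by
        rintro q (hq | ⟨v, ⟨_, h₁, h₂⟩, rfl⟩)
        · exact ⟨⟨(hmax q hq).trans hj.1, hj.2.trans (hmin q hq)⟩, nodeClique_subset hq⟩
        · exact ⟨⟨(le_max_left _ _).trans h₁, h₂.trans (min_le_left _ _)⟩, List.suffix_rfl⟩
      have hcard := Set.ncard_le_ncard hsub
      rw [Set.ncard_union_eq, ncard_nodeClique x.2.le, Set.ncard_image_of_injective _ hinj] at hcard
      · omega
      · rw [Set.disjoint_left]
        rintro _ ⟨q, rfl, _⟩ ⟨v, _, h⟩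
        simp [f] at h
    · have : {v | v ∈ Set.univ ∧ max (lo (f v)) (lo y) ≤ j ∧ j ≤ min (hi (f v)) (hi z)} = ∅ :=
        Set.eq_empty_of_forall_notMem fun v ⟨_, h₁, h₂⟩ =>
          hj ⟨(le_max_right _ _).trans h₁, h₂.trans (min_le_right _ _)⟩
      rw [this, Set.ncard_empty]
      exact Nat.zero_le _

/-- The vertices of a subtree outside of a bag that contains fewer than `k` vertices of the subtree
are all on the same side of this bag. -/
theorem exists_side (r : IsIntervalRep (combinedGraph s k G) Set.univ lo hi m) (p h : ℕ) :
    ∀ w : List (Fin 3), w.length + h = s →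
      (bagAt lo hi p ∩ subtreeSet V k w).ncard < k →
      ∃ c ∈ nodeClique V k w, c ∉ bagAt lo hi p ∧
        ∀ v ∈ subtreeSet V k w, v ∉ bagAt lo hi p → (hi v < p ↔ hi c < p) := by
  induction h with
  | zero =>
    intro w hw hlt
    -- The bag is too small to contain the whole clique. A clique vertex outside the bag is adjacent
    -- to all other vertices at this leaf and thus determines their side.
    obtain ⟨c, hc, hc'⟩ := exists_mem_diff_of_ncard_lt (A := nodeClique V k w)
      (B := bagAt lo hi p) (by
        rw [ncard_nodeClique (by omega)]
        exact (Set.ncard_le_ncard (Set.inter_subset_inter_right _ nodeClique_subset)).trans_lt hlt)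
    refine ⟨c, hc, hc', fun v hv hv' => ?_⟩
    rw [subtreeSet_leaf ⟨w, hw⟩] at hv
    rcases hv with hv | hv
    · exact (lt_iff_of_adj r hc' hv' (adj_of_mem_leafBlob hc hv)).symm
    · by_cases hvc : v = c
      · rw [hvc]
      · exact lt_iff_of_adj r hv' hc' (adj_of_mem_nodeClique hv hc hvc)
  | succ h ih =>
    intro w hw hlt
    obtain ⟨c, hc, hc'⟩ := exists_mem_diff_of_ncard_lt (A := nodeClique V k w)
      (B := bagAt lo hi p) (by
        rw [ncard_nodeClique (by omega)]
        exact (Set.ncard_le_ncard (Set.inter_subset_inter_right _ nodeClique_subset)).trans_lt hlt)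
    -- The representative `d` of the child clique is adjacent to `c`, and neither lies in the bag,
    -- so the side is passed on from parent to child.
    have hchild : ∀ a : Fin 3, ∀ v ∈ subtreeSet V k (a :: w), v ∉ bagAt lo hi p →
        (hi v < p ↔ hi c < p) := fun a v hv hv' => by
      obtain ⟨d, hd, hd', hside⟩ := ih (a :: w) (by simp only [List.length_cons]; omega)
        ((Set.ncard_le_ncard (Set.inter_subset_inter_right _ subtreeSet_cons_subset)).trans_lt hlt)
      exact (hside v hv hv').trans (lt_iff_of_adj r hc' hd' (adj_of_mem_nodeClique_cons hc hd)).symm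
    refine ⟨c, hc, hc', fun v hv hv' => ?_⟩
    rw [subtreeSet_eq_of_lt (by omega)] at hv
    rcases hv with ((hv | hv) | hv) | hv
    · exact hchild _ v hv hv'
    · exact hchild _ v hv hv'
    · exact hchild _ v hv hv'
    · by_cases hvc : v = c
      · rw [hvc]
      · exact lt_iff_of_adj r hv' hc' (adj_of_mem_nodeClique hv hc hvc)

theorem exists_sorted_triple (f : Fin 3 → ℕ) :
    ∃ a b c : Fin 3, a ≠ b ∧ b ≠ c ∧ a ≠ c ∧ f a ≤ f b ∧ f b ≤ f c := by
  have h := Tuple.monotone_sort f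
  have hinj := (Tuple.sort f).injective
  exact ⟨Tuple.sort f 0, Tuple.sort f 1, Tuple.sort f 2, hinj.ne (by decide), hinj.ne (by decide),
    hinj.ne (by decide), h (by decide), h (by decide)⟩

/-- The large bags of the three children are sorted by position, and the middle one gains `k`
vertices. Otherwise fewer than `k` vertices of it lie in the clique of `w` and the two other child
subtrees, and by `exists_side` all remaining vertices of these sets lie on one side. The bags at `j
a` and `j c` nevertheless contain vertices of the outer subtrees that miss the middle bag, one to
its left and one to its right. -/
theorem exists_bag_subtree (hk : 2 ≤ k)
    (r : IsIntervalRep (combinedGraph s k G) Set.univ lo hi m)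
    (hG : ∀ x, ¬ pathwidth (G x) ≤ k - 2) (h : ℕ) : ∀ w : List (Fin 3), w.length + h = s →
      ∃ j, k * (h + 2) ≤ (bagAt lo hi j ∩ subtreeSet V k w).ncard := by
  induction h with
  | zero => exact fun w hw => exists_bag_leaf hk r ⟨w, hw⟩ (hG _)
  | succ h ih =>
    intro w hw
    have hlen : ∀ a : Fin 3, (a :: w).length + h = s := fun a => by
      simp only [List.length_cons]; omega
    choose j hj using fun a : Fin 3 => ih (a :: w) (hlen a)
    obtain ⟨a, b, c, hab, hbc, hac, hjab, hjbc⟩ := exists_sorted_triple j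
    set O := nodeClique V k w ∪ (subtreeSet V k (a :: w) ∪ subtreeSet V k (c :: w)) with hO
    refine ⟨j b, ?_⟩
    by_contra! hlt
    -- The subtree of `b` already accounts for `k(h+2)` vertices of this bag and is disjoint from
    -- `O`, so fewer than `k` are left for `O`.
    have hOlt : (bagAt lo hi (j b) ∩ O).ncard < k := by
      have hsub : (bagAt lo hi (j b) ∩ subtreeSet V k (b :: w)) ∪ (bagAt lo hi (j b) ∩ O) ⊆
          bagAt lo hi (j b) ∩ subtreeSet V k w := by
        rw [← Set.inter_union_distrib_left]
        refine Set.inter_subset_inter_right _ (Set.union_subset subtreeSet_cons_subset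
          (Set.union_subset nodeClique_subset
            (Set.union_subset subtreeSet_cons_subset subtreeSet_cons_subset)))
      have hcard := Set.ncard_le_ncard hsub
      rw [Set.ncard_union_eq] at hcard
      · have := hj b
        have := Nat.mul_succ k (h + 2)
        rw [show (h + 2).succ = h + 1 + 2 from rfl] at this
        omega
      · rw [Set.disjoint_left]
        rintro v ⟨_, hv⟩ ⟨_, hv' | hv' | hv'⟩
        · exact notMem_nodeClique_of_mem_subtreeSet hv hv'
        · exact hab (eq_of_mem_subtreeSet hv' hv)
        · exact hbc (eq_of_mem_subtreeSet hv hv')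
    have hle : ∀ {A : Set ((TernaryNode s × Fin k) ⊕ (Σ x, V x))}, A ⊆ O →
        (bagAt lo hi (j b) ∩ A).ncard < k := fun hA =>
      (Set.ncard_le_ncard (Set.inter_subset_inter_right _ hA)).trans_lt hOlt
    have hOa : subtreeSet V k (a :: w) ⊆ O := fun v hv => .inr (.inl hv)
    have hOc : subtreeSet V k (c :: w) ⊆ O := fun v hv => .inr (.inr hv)
    obtain ⟨d, hd, hd'⟩ := exists_mem_diff_of_ncard_lt (A := nodeClique V k w)
      (B := bagAt lo hi (j b)) (by
        rw [ncard_nodeClique (by omega)]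
        exact hle fun v hv => .inl hv)
    -- The bag at `j e` has at least `k` vertices in the subtree of `e`, so one of them escapes the
    -- middle bag. Its side is that of `d`, a vertex of the clique of `w` that serves both outer
    -- subtrees.
    have hside : ∀ e : Fin 3, subtreeSet V k (e :: w) ⊆ O → ∃ v, lo v ≤ j e ∧ j e ≤ hi v ∧
        v ∉ bagAt lo hi (j b) ∧ (hi v < j b ↔ hi d < j b) := fun e he => by
      obtain ⟨c', hc', hc'', hs⟩ := exists_side r (j b) h (e :: w) (hlen e) (hle he)
      obtain ⟨v, hv, hv'⟩ := exists_mem_diff_of_ncard_lt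
        (A := bagAt lo hi (j e) ∩ subtreeSet V k (e :: w)) (B := bagAt lo hi (j b)) (by
          refine (hle (Set.inter_subset_right.trans he)).trans_le (le_trans ?_ (hj e))
          exact Nat.le_mul_of_pos_right k (by omega))
      exact ⟨v, hv.1.1, hv.1.2, hv', (hs v hv.2 hv').trans
        (lt_iff_of_adj r hd' hc'' (adj_of_mem_nodeClique_cons hd hc')).symm⟩
    obtain ⟨u, hu₁, hu₂, hu₃, hu₄⟩ := hside a hOa
    obtain ⟨v, hv₁, hv₂, hv₃, hv₄⟩ := hside c hOc
    simp only [bagAt, Set.mem_ofPred_eq, not_and_or, not_le] at hu₃ hv₃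
    omega

end LowerBound

theorem IsPathDecomposition.pathwidth_le {W : Type*} {H : SimpleGraph W} {bags : List (Finset W)}
    (h : IsPathDecomposition H bags) : pathwidth H ≤ width bags := Nat.sInf_le ⟨bags, h, rfl⟩

/-- The combined graph has small pathwidth iff one of the plugged-in graphs does. -/
theorem pathwidth_combinedGraph_le_iff {s k : ℕ} {V : TernaryLeaf s → Type*} [∀ x, Finite (V x)]
    (G : ∀ x, SimpleGraph (V x)) (hk : 2 ≤ k)
    (hG : ∀ x, pathwidth (G x) ≤ k - 1) :
    pathwidth (combinedGraph s k G) ≤ k * (s + 2) - 2 ↔ ∃ x, pathwidth (G x) ≤ k - 2 := by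
  have hpos : 2 ≤ k * (s + 2) := by nlinarith
  constructor
  · intro h
    by_contra! hx
    obtain ⟨lo, hi, r⟩ := (pathwidth_le_iff _ _).1 h
    obtain ⟨j, hj⟩ := exists_bag_subtree hk r (fun x => (hx x).not_ge) s [] (by simp)
    rw [subtreeSet_nil, Set.inter_univ] at hj
    have h₁ := r.card j
    have h₂ : {v | v ∈ Set.univ ∧ lo v ≤ j ∧ j ≤ hi v} = bagAt lo hi j := by
      ext v; simp [bagAt]
    rw [h₂] at h₁
    omega
  · rintro ⟨x, hx⟩
    obtain ⟨lo, hi, r⟩ := (pathwidth_le_iff _ _).1 hx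
    rw [show k - 2 + 1 = k - 1 by omega] at r
    obtain ⟨a, b, _, r', _⟩ := hasRep_subtreeSet_of_suffix hk
      (fun x => by simpa only [show k - 1 + 1 = k by omega] using (pathwidth_le_iff _ _).1 (hG x)) x ⟨lo, hi, r⟩ s []
      (by simp) List.nil_suffix
    rw [subtreeSet_nil] at r'
    refine (pathwidth_le_iff _ _).2 ⟨a, b, ?_⟩
    rwa [show k * (s + 2) - 2 + 1 = k * (s + 2) - 1 by omega]

end CrossComp

/-! ### Formulas as expressions, bounded search, and access to the input strings. -/

namespace CrossComp

/-! ### Formulas and bounded search -/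

namespace Expr

variable {r : ℕ}

/-- An expression, read as a formula, holds if its value is not zero. -/
def Holds (e : Expr r) (w : List (Option Bool)) (v : Fin r → ℕ) : Prop := e.eval w v ≠ 0

/-- Truth is a non-zero value, so conjunction is a product, and disjunction and bounded existence
are sums. Negation uses truncated subtraction and always yields `0` or `1`. -/
protected def not (a : Expr r) : Expr r := .sub (.const 1) a
protected def and (a b : Expr r) : Expr r := .mul a b
protected def or (a b : Expr r) : Expr r := .add a b
protected def imp (a b : Expr r) : Expr r := .or (.not a) b
protected def le (a b : Expr r) : Expr r := .sub (.add b (.const 1)) a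
protected def lt (a b : Expr r) : Expr r := .sub b a
protected def eq (a b : Expr r) : Expr r := .and (.le a b) (.le b a)
/-- Bounded existential quantification. -/
protected def ex (b : Expr r) (f : Expr (r + 1)) : Expr r := .sum b f
/-- Bounded universal quantification. -/
protected def all (b : Expr r) (f : Expr (r + 1)) : Expr r := .not (.ex b (.not f))
protected def ite (c a b : Expr r) : Expr r := .add (.mul (.not (.not c)) a) (.mul (.not c) b)
/-- The number of values below a bound that satisfy a formula. -/
protected def count (b : Expr r) (f : Expr (r + 1)) : Expr r := .sum b (.not (.not f))

variable (w : List (Option Bool)) (v : Fin r → ℕ)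

@[simp] theorem eval_const (c : ℕ) : (const c : Expr r).eval w v = c := rfl
@[simp] theorem eval_var (i : Fin r) : (var i).eval w v = v i := rfl
@[simp] theorem eval_add (a b : Expr r) : (a.add b).eval w v = a.eval w v + b.eval w v := rfl
@[simp] theorem eval_sub (a b : Expr r) : (a.sub b).eval w v = a.eval w v - b.eval w v := rfl
@[simp] theorem eval_mul (a b : Expr r) : (a.mul b).eval w v = a.eval w v * b.eval w v := rfl
@[simp] theorem eval_sum (b : Expr r) (f : Expr (r + 1)) :
    (sum b f).eval w v = ∑ i ∈ Finset.range (b.eval w v), f.eval w (Fin.cons i v) := rfl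
@[simp] theorem eval_len : (len : Expr r).eval w v = w.length := rfl
@[simp] theorem eval_read (a : Expr r) :
    (read a).eval w v = symbolCode w[a.eval w v]? := rfl
@[simp] theorem eval_up (a : Expr r) (i : ℕ) : a.up.eval w (Fin.cons i v) = a.eval w v := rfl

@[simp] theorem holds_not (a : Expr r) : a.not.Holds w v ↔ ¬ a.Holds w v := by
  simp only [Holds, Expr.not, eval_sub, eval_const]
  omega

@[simp] theorem holds_and (a b : Expr r) : (a.and b).Holds w v ↔ a.Holds w v ∧ b.Holds w v := by
  simp [Holds, Expr.and]

@[simp] theorem holds_or (a b : Expr r) : (a.or b).Holds w v ↔ a.Holds w v ∨ b.Holds w v := by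
  simp only [Holds, Expr.or, eval_add]
  omega

@[simp] theorem holds_imp (a b : Expr r) :
    (a.imp b).Holds w v ↔ (a.Holds w v → b.Holds w v) := by
  simp only [Expr.imp, holds_or, holds_not]
  tauto

@[simp] theorem holds_le (a b : Expr r) : (a.le b).Holds w v ↔ a.eval w v ≤ b.eval w v := by
  simp only [Holds, Expr.le, eval_sub, eval_add, eval_const]
  omega

@[simp] theorem holds_lt (a b : Expr r) : (a.lt b).Holds w v ↔ a.eval w v < b.eval w v := by
  simp only [Holds, Expr.lt, eval_sub]
  omega

@[simp] theorem holds_eq (a b : Expr r) : (a.eq b).Holds w v ↔ a.eval w v = b.eval w v := by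
  simp only [Expr.eq, holds_and, holds_le]
  omega

@[simp] theorem holds_ex (b : Expr r) (f : Expr (r + 1)) :
    (Expr.ex b f).Holds w v ↔ ∃ i < b.eval w v, f.Holds w (Fin.cons i v) := by
  simp only [Holds, Expr.ex, eval_sum, ne_eq, Finset.sum_eq_zero_iff, Finset.mem_range]
  push Not
  rfl

@[simp] theorem holds_all (b : Expr r) (f : Expr (r + 1)) :
    (Expr.all b f).Holds w v ↔ ∀ i < b.eval w v, f.Holds w (Fin.cons i v) := by
  simp only [Expr.all, holds_not, holds_ex]
  push Not
  rfl

/-- Double negation normalises an arbitrary truth value to `0` or `1`, as counting and case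
distinctions require. -/
theorem eval_not_not (c : Expr r) [Decidable (c.Holds w v)] :
    c.not.not.eval w v = if c.Holds w v then 1 else 0 := by
  split_ifs with h <;> simp only [Holds] at h <;> simp only [Expr.not, eval_sub, eval_const] <;>
    omega

theorem eval_ite (c a b : Expr r) [Decidable (c.Holds w v)] :
    (c.ite a b).eval w v = if c.Holds w v then a.eval w v else b.eval w v := by
  split_ifs with h <;> simp only [Holds] at h <;>
    simp only [Expr.ite, Expr.not, eval_add, eval_mul, eval_sub, eval_const]
  · rw [show 1 - (1 - c.eval w v) = 1 by omega, show 1 - c.eval w v = 0 by omega]; simp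
  · rw [show 1 - (1 - c.eval w v) = 0 by omega, show 1 - c.eval w v = 1 by omega]; simp

theorem eval_count (b : Expr r) (f : Expr (r + 1))
    [DecidablePred fun i => f.Holds w (Fin.cons i v)] :
    (Expr.count b f).eval w v = Nat.count (fun i => f.Holds w (Fin.cons i v)) (b.eval w v) := by
  rw [Expr.count, eval_sum, Nat.count_eq_card_filter_range, Finset.card_filter]
  exact Finset.sum_congr rfl fun i _ => eval_not_not _ _ _

theorem count_lt_eq (m n : ℕ) (h : m ≤ n) (p : ℕ → Prop) [DecidablePred p]
    (hp : ∀ i < n, p i ↔ i < m) : Nat.count p n = m := by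
  rw [Nat.count_eq_card_filter_range]
  have : (Finset.range n).filter p = Finset.range m := by
    ext i
    simp only [Finset.mem_filter, Finset.mem_range]
    constructor
    · exact fun hi => (hp i hi.1).1 hi.2
    · exact fun hi => ⟨hi.trans_le h, (hp i (hi.trans_le h)).2 hi⟩
  rw [this, Finset.card_range]

/-- A number is computed by counting the numbers below it. It suffices to have a bound for it and a
formula that expresses `i < m`; this replaces minimisation, division and logarithms. -/
theorem eval_count_eq {w : List (Option Bool)} {v : Fin r → ℕ} {b : Expr r} {f : Expr (r + 1)}
    (m : ℕ) (hm : m ≤ b.eval w v) (hf : ∀ i < b.eval w v, f.Holds w (Fin.cons i v) ↔ i < m) :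
    (Expr.count b f).eval w v = m := by
  classical
  rw [eval_count]
  exact count_lt_eq m _ hm _ hf

/-- The least number `m < b` that satisfies the formula, or `b` if there is none. The formula has
`m` as its innermost variable and must not depend on its second variable. -/
protected def find (b : Expr r) (f : Expr (r + 2)) : Expr r :=
  .count b (.all (.add (.var 0) (.const 1)) (.not f))

/-- The search counts the `q` for which no `i ≤ q` satisfies the formula, and these are exactly the
`q < m`. Quantifying over `q` in the hypotheses expresses that the second variable is irrelevant. -/
theorem eval_find {w : List (Option Bool)} {v : Fin r → ℕ} {b : Expr r} {f : Expr (r + 2)}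
    (m : ℕ) (hm : m ≤ b.eval w v)
    (h₁ : ∀ q, ∀ i < m, ¬ f.Holds w (Fin.cons i (Fin.cons q v)))
    (h₂ : m < b.eval w v → ∀ q, f.Holds w (Fin.cons m (Fin.cons q v))) :
    (Expr.find b f).eval w v = m := by
  refine eval_count_eq m hm fun q hq => ?_
  simp only [holds_all, holds_not, eval_add, eval_var, eval_const, Fin.cons_zero]
  constructor
  · intro h
    by_contra! hmq
    exact h m (by omega) (h₂ (hmq.trans_lt hq) q)
  · exact fun hqm i hi => h₁ q i (by omega)

end Expr

/-! ### Access to the strings of the input -/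

section Strings

variable (xs : List (List Bool))

theorem encodeStrings_append (ys : List (List Bool)) :
    encodeStrings (xs ++ ys) = encodeStrings xs ++ encodeStrings ys := by
  simp [encodeStrings]

/-- The position at which the `i`-th string starts. -/
def offset (i : ℕ) : ℕ := (encodeStrings (xs.take i)).length

theorem encodeStrings_eq (i : ℕ) (hi : i < xs.length) :
    encodeStrings xs = encodeStrings (xs.take i) ++
      ((xs[i].map some ++ [none]) ++ encodeStrings (xs.drop (i + 1))) := by
  conv_lhs => rw [← List.take_append_drop i xs, List.drop_eq_getElem_cons hi]
  rw [encodeStrings_append]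
  rfl

theorem offset_succ (i : ℕ) (hi : i < xs.length) :
    offset xs (i + 1) = offset xs i + xs[i].length + 1 := by
  rw [offset, List.take_succ_eq_append_getElem hi, encodeStrings_append, List.length_append]
  simp [encodeStrings, offset, Nat.add_assoc]

theorem offset_of_le (i : ℕ) (hi : xs.length ≤ i) :
    offset xs i = (encodeStrings xs).length := by
  rw [offset, List.take_of_length_le hi]

theorem offset_le (i : ℕ) : offset xs i ≤ (encodeStrings xs).length := by
  conv_rhs => rw [← List.take_append_drop i xs, encodeStrings_append, List.length_append]
  exact Nat.le_add_right _ _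

theorem encodeStrings_getElem?_of_lt (i p : ℕ) (hi : i < xs.length) (hp : p < xs[i].length) :
    (encodeStrings xs)[offset xs i + p]? = some (some xs[i][p]) := by
  rw [encodeStrings_eq xs i hi, offset, List.getElem?_append_right (Nat.le_add_right _ _),
    Nat.add_sub_cancel_left, List.getElem?_append_left (by simp; omega),
    List.getElem?_append_left (by simpa using hp)]
  simp [hp]

theorem encodeStrings_getElem?_length (i : ℕ) (hi : i < xs.length) :
    (encodeStrings xs)[offset xs i + xs[i].length]? = some none := by
  rw [encodeStrings_eq xs i hi, offset, List.getElem?_append_right (Nat.le_add_right _ _),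
    Nat.add_sub_cancel_left, List.getElem?_append_left (by simp),
    List.getElem?_append_right (by simp)]
  simp

/-- The number of terminators before position `p`. -/
def terminators (p : ℕ) : ℕ := Nat.count (fun q => (encodeStrings xs)[q]? = some none) p

theorem terminators_within (i p : ℕ) (hi : i < xs.length) (hp : p ≤ xs[i].length) :
    terminators xs (offset xs i + p) = terminators xs (offset xs i) := by
  rw [terminators, Nat.count_add, terminators, Nat.add_eq_left, Nat.count_eq_card_filter_range,
    Finset.card_eq_zero, Finset.filter_eq_empty_iff]
  intro q hq
  rw [Finset.mem_range] at hq
  simp [encodeStrings_getElem?_of_lt xs i q hi (by omega)]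

theorem terminators_offset (i : ℕ) (hi : i ≤ xs.length) : terminators xs (offset xs i) = i := by
  induction i with
  | zero => simp [terminators, offset, encodeStrings]
  | succ i ih =>
    rw [offset_succ xs i hi, terminators, Nat.count_succ,
      if_pos (encodeStrings_getElem?_length xs i hi)]
    have := terminators_within xs i _ hi le_rfl
    rw [terminators] at this
    rw [this, ih (by omega)]

/-- The `i`-th string starts right behind the `i`-th terminator, so its start can be found by
counting. For `i` past the number of strings both sides hold. -/
theorem terminators_lt_iff (i p : ℕ) (hp : p < (encodeStrings xs).length) :
    terminators xs p < i ↔ p < offset xs i := by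
  constructor
  · intro h
    by_contra! hle
    rcases le_or_gt i xs.length with hi | hi
    · have := Nat.count_monotone (fun q => (encodeStrings xs)[q]? = some none) hle
      have h' := terminators_offset xs i hi
      rw [terminators] at h h'
      omega
    · rw [offset_of_le xs i hi.le] at hle
      omega
  · intro h
    have key : ∀ i, i ≤ xs.length → p < offset xs i → terminators xs p < i := by
      rintro (_ | i) hi h
      · simp [offset, encodeStrings] at h
      · rw [offset_succ xs i hi] at h
        have := Nat.count_monotone (fun q => (encodeStrings xs)[q]? = some none) (Nat.le_of_lt_succ h)
        have h' := terminators_within xs i _ hi le_rfl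
        rw [terminators_offset xs i (by omega)] at h'
        rw [terminators] at h' ⊢
        omega
    rcases le_or_gt i xs.length with hi | hi
    · exact key i hi h
    · refine (key xs.length le_rfl ?_).trans hi
      rwa [offset_of_le xs i hi.le, ← offset_of_le xs xs.length le_rfl] at h

namespace Expr

variable {r : ℕ}

/-- The symbol at a position is a terminator. -/
def isTerminator (p : Expr r) : Expr r := .eq (.read p) (.const 1)

theorem symbolCode_eq_one (a : Option (Option Bool)) : symbolCode a = 1 ↔ a = some none := by
  rcases a with _ | _ | _ | _ <;> simp [symbolCode]

theorem symbolCode_eq_three (a : Option (Option Bool)) :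
    symbolCode a = 3 ↔ a = some (some true) := by
  rcases a with _ | _ | _ | _ <;> simp [symbolCode]

/-- The number of strings. -/
def numStrings : Expr r := .count .len (.isTerminator (.var 0))

/-- The start of the `i`-th string. -/
def start (i : Expr r) : Expr r :=
  .count .len (.lt (.count (.var 0) (.isTerminator (.var 0))) i.up)

/-- The length of the `i`-th string. -/
def strLen (i : Expr r) : Expr r := .sub (.sub (start (.add i (.const 1))) (start i)) (.const 1)

/-- The `p`-th letter of the `i`-th string is `true`. -/
def bit (i p : Expr r) : Expr r :=
  .and (.lt p (strLen i)) (.eq (.read (.add (start i) p)) (.const 3))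

variable (v : Fin r → ℕ)

theorem eval_count_isTerminator (b : Expr r) :
    (Expr.count b (.isTerminator (.var 0))).eval (encodeStrings xs) v =
      terminators xs (b.eval (encodeStrings xs) v) := by
  classical
  rw [eval_count, terminators]
  congr 1
  ext i
  simp [isTerminator, symbolCode_eq_one]

@[simp] theorem eval_numStrings :
    (numStrings : Expr r).eval (encodeStrings xs) v = xs.length := by
  rw [numStrings, eval_count_isTerminator, eval_len, ← offset_of_le xs _ le_rfl,
    terminators_offset xs _ le_rfl]

@[simp] theorem eval_start (i : Expr r) :
    (start i).eval (encodeStrings xs) v = offset xs (i.eval (encodeStrings xs) v) := by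
  refine eval_count_eq _ (offset_le xs _) fun p hp => ?_
  rw [holds_lt, eval_count_isTerminator, eval_up]
  exact terminators_lt_iff xs _ p hp

@[simp] theorem eval_strLen (i : Expr r) : (strLen i).eval (encodeStrings xs) v =
    (xs.getD (i.eval (encodeStrings xs) v) []).length := by
  simp only [strLen, eval_sub, eval_start, eval_add, eval_const]
  generalize i.eval (encodeStrings xs) v = i
  rcases lt_or_ge i xs.length with hi | hi
  · rw [offset_succ xs i hi, List.getD_eq_getElem _ _ hi]
    omega
  · rw [offset_of_le xs i hi, offset_of_le xs (i + 1) (by omega), List.getD_eq_default _ _ hi]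
    simp

@[simp] theorem holds_bit (i p : Expr r) : (bit i p).Holds (encodeStrings xs) v ↔
    (xs.getD (i.eval (encodeStrings xs) v) [])[p.eval (encodeStrings xs) v]? = some true := by
  simp only [bit, holds_and, holds_lt, eval_strLen, holds_eq, eval_read, eval_add, eval_start,
    eval_const, symbolCode_eq_three]
  generalize i.eval (encodeStrings xs) v = i
  generalize p.eval (encodeStrings xs) v = p
  rcases lt_or_ge i xs.length with hi | hi
  · rw [List.getD_eq_getElem _ _ hi]
    rcases lt_or_ge p xs[i].length with hp | hp
    · rw [encodeStrings_getElem?_of_lt xs i p hi hp]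
      simp [hp]
    · simp [hp]
  · simp [hi]

end Expr

end Strings

end CrossComp

/-! ### Parsing of encoded instances and unique decodability. -/

namespace CrossComp

/-! ### Decoding instances -/

section Matrices

variable {α β : Type*}

theorem length_flatMap_of_forall {l : List β} {L : β → List α} {m : ℕ}
    (hL : ∀ b ∈ l, (L b).length = m) : (l.flatMap L).length = l.length * m := by
  induction l with
  | nil => simp
  | cons b l ih =>
    simp only [List.mem_cons, forall_eq_or_imp] at hL
    rw [List.flatMap_cons, List.length_append, ih hL.2, hL.1, List.length_cons, Nat.succ_mul,
      Nat.add_comm]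

theorem flatMap_getElem? {l : List β} {L : β → List α} {m : ℕ}
    (hL : ∀ b ∈ l, (L b).length = m) (u v : ℕ) (hv : v < m) :
    (l.flatMap L)[u * m + v]? = l[u]?.bind fun b => (L b)[v]? := by
  induction l generalizing u with
  | nil => simp
  | cons b l ih =>
    simp only [List.mem_cons, forall_eq_or_imp] at hL
    rcases u with _ | u
    · rw [Nat.zero_mul, Nat.zero_add, List.flatMap_cons, List.getElem?_append_left (by omega)]
      simp
    · rw [List.flatMap_cons, List.getElem?_append_right (by rw [hL.1, Nat.succ_mul]; omega), hL.1,
        show (u + 1) * m + v - m = u * m + v by rw [Nat.succ_mul]; omega, ih hL.2]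
      simp

theorem mul_add_lt {n m u v : ℕ} (hu : u < n) (hv : v < m) : u * m + v < n * m :=
  calc u * m + v < u * m + m := by omega
    _ = (u + 1) * m := (Nat.succ_mul _ _).symm
    _ ≤ n * m := Nat.mul_le_mul_right _ hu

theorem ext_of_matrix {l l' : List α} {n m : ℕ} (h : l.length = n * m) (h' : l'.length = n * m)
    (heq : ∀ u < n, ∀ v < m, l[u * m + v]? = l'[u * m + v]?) : l = l' := by
  refine List.ext_getElem? fun j => ?_
  rcases lt_or_ge j (n * m) with hj | hj
  · have hm : 0 < m := Nat.pos_of_ne_zero fun hm => by simp [hm] at hj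
    have := heq (j / m) ((Nat.div_lt_iff_lt_mul hm).2 hj) (j % m) (Nat.mod_lt _ hm)
    rwa [Nat.div_add_mod'] at this
  · rw [List.getElem?_eq_none (by omega), List.getElem?_eq_none (by omega)]

end Matrices

theorem exists_getElem?_ne_true (x : List Bool) (p : ℕ) : ∃ q, x[p + q]? ≠ some true :=
  ⟨x.length, by rw [List.getElem?_eq_none (by omega)]; simp⟩

/-- The number of consecutive letters `true` from position `p` on. -/
def run (x : List Bool) (p : ℕ) : ℕ := Nat.find (exists_getElem?_ne_true x p)

theorem run_eq_iff {x : List Bool} {p m : ℕ} :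
    run x p = m ↔ x[p + m]? ≠ some true ∧ ∀ q < m, x[p + q]? = some true := by
  rw [run, Nat.find_eq_iff]
  simp

theorem run_le (x : List Bool) (p : ℕ) : run x p ≤ x.length :=
  Nat.find_min' _ (by rw [List.getElem?_eq_none (by omega)]; simp)

theorem run_append (pre post : List Bool) (n : ℕ) :
    run (pre ++ (unaryCode n ++ post)) pre.length = n := by
  rw [run_eq_iff]
  refine ⟨?_, fun q hq => ?_⟩ <;>
    rw [List.getElem?_append_right (Nat.le_add_right _ _), Nat.add_sub_cancel_left, unaryCode,
      List.append_assoc]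
  · rw [List.getElem?_append_right (by simp)]
    simp
  · rw [List.getElem?_append_left (by simpa using hq)]
    simp [hq]

/-- The hypothesis says that the run of ones ends inside the string; the letter that ends it is then
the closing `false` of the unary code. -/
theorem drop_eq_unaryCode_append {x : List Bool} {p : ℕ} (h : p + run x p < x.length) :
    x.drop p = unaryCode (run x p) ++ x.drop (p + run x p + 1) := by
  obtain ⟨h₁, h₂⟩ := run_eq_iff.1 (rfl : run x p = run x p)
  refine List.ext_getElem? fun q => ?_
  rw [List.getElem?_drop, unaryCode, List.append_assoc]
  rcases lt_trichotomy q (run x p) with hq | rfl | hq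
  · rw [List.getElem?_append_left (by simpa using hq), h₂ q hq]
    simp [hq]
  · rw [List.getElem?_append_right (by simp)]
    rw [List.getElem?_eq_getElem h] at h₁ ⊢
    simpa using h₁
  · rw [List.getElem?_append_right (by simpa using hq.le), List.length_replicate]
    obtain ⟨d, rfl⟩ := Nat.exists_eq_add_of_lt hq
    rw [show run x p + d + 1 - run x p = d + 1 by omega, List.singleton_append,
      List.getElem?_cons_succ, List.getElem?_drop]
    congr 1
    omega

/-- The number of vertices of the encoded graph. -/
def sizeField (x : List Bool) : ℕ := run x 0

/-- The adjacency of two vertices of the encoded graph. -/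
def AdjBit (x : List Bool) (u v : ℕ) : Prop :=
  x[sizeField x + 1 + (u * sizeField x + v)]? = some true

/-- The encoded number `k`. -/
def kField (x : List Bool) : ℕ := run x (sizeField x + 1 + sizeField x * sizeField x)

/-- The position after the code of `k`. -/
def kEnd (x : List Bool) : ℕ := sizeField x + 1 + sizeField x * sizeField x + kField x + 1

/-- The encoded number of bags. -/
def bagsField (x : List Bool) : ℕ := run x (kEnd x)

/-- The membership of a vertex in a bag. -/
def BagBit (x : List Bool) (j v : ℕ) : Prop :=
  x[kEnd x + bagsField x + 1 + (j * sizeField x + v)]? = some true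

instance (x : List Bool) (j : ℕ) : DecidablePred (BagBit x j) :=
  fun _ => inferInstanceAs (Decidable (_ = _))

/-- A string is the code of an instance of Pathwidth Improvement. -/
structure Valid (x : List Bool) : Prop where
  length_eq : x.length = kEnd x + bagsField x + 1 + bagsField x * sizeField x
  two_le : 2 ≤ kField x
  le_size : kField x ≤ sizeField x
  symm : ∀ u < sizeField x, ∀ v < sizeField x, AdjBit x u v → AdjBit x v u
  irrefl : ∀ u < sizeField x, ¬ AdjBit x u u
  vertex_mem : ∀ v < sizeField x, ∃ j < bagsField x, BagBit x j v
  edge_mem : ∀ u < sizeField x, ∀ v < sizeField x, AdjBit x u v →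
    ∃ j < bagsField x, BagBit x j u ∧ BagBit x j v
  convex : ∀ v < sizeField x, ∀ l < bagsField x, ∀ j < l, ∀ i < j,
    BagBit x i v → BagBit x l v → BagBit x j v
  card_le : ∀ j < bagsField x, Nat.count (BagBit x j) (sizeField x) ≤ kField x
  exists_card : ∃ j < bagsField x, kField x ≤ Nat.count (BagBit x j) (sizeField x)

theorem count_eq_card_filter_fin (n : ℕ) (p : ℕ → Prop) [DecidablePred p] :
    Nat.count p n = (Finset.univ.filter fun v : Fin n => p v).card := by
  rw [Nat.count_eq_card_filter_range, Finset.card_filter, Finset.card_filter,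
    Fin.sum_univ_eq_sum_range (fun i => if p i then 1 else 0)]

theorem le_foldr_max (l : List ℕ) (m : ℕ) (hm : 0 < m) :
    m ≤ l.foldr max 0 ↔ ∃ x ∈ l, m ≤ x := by
  induction l with
  | nil => simp; omega
  | cons a l ih => simp [ih]

/-- The bound on `k` makes the truncated subtraction in `width` harmless: for `k = 1` the maximum
bag size could be `0` or `1`. -/
theorem width_eq_iff {V : Type*} (bags : List (Finset V)) (k : ℕ) (hk : 2 ≤ k) :
    width bags = k - 1 ↔ (∀ B ∈ bags, B.card ≤ k) ∧ ∃ B ∈ bags, k ≤ B.card := by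
  have h₁ := foldr_max_le_iff (bags.map Finset.card) k
  have h₂ := le_foldr_max (bags.map Finset.card) k (by omega)
  simp only [List.mem_map, exists_exists_and_eq_and, forall_exists_index, and_imp,
    forall_apply_eq_imp_iff₂] at h₁ h₂
  rw [← h₁, ← h₂, width]
  omega

open Classical in
/-- The adjacency matrix of a graph. -/
noncomputable def matrixBits {n : ℕ} (G : SimpleGraph (Fin n)) : List Bool :=
  (List.finRange n).flatMap fun u => (List.finRange n).map fun v => decide (G.Adj u v)

theorem length_matrixBits {n : ℕ} (G : SimpleGraph (Fin n)) :
    (matrixBits G).length = n * n := by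
  rw [matrixBits, length_flatMap_of_forall (m := n) (by simp), List.length_finRange]

open Classical in
theorem matrixBits_getElem? {n : ℕ} (G : SimpleGraph (Fin n)) (u v : Fin n) :
    (matrixBits G)[u * n + v]? = some (decide (G.Adj u v)) := by
  rw [matrixBits, flatMap_getElem? (by simp) _ _ v.2]
  simp

namespace ImprovementInstance

variable (I : ImprovementInstance)

/-- The characteristic vectors of the bags. -/
def bagBits : List Bool :=
  I.bags.flatMap fun B => (List.finRange I.n).map fun v => decide (v ∈ B)

theorem length_bagBits : I.bagBits.length = I.bags.length * I.n := by
  rw [bagBits, length_flatMap_of_forall (m := I.n) (by simp)]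

theorem bagBits_getElem? (j : ℕ) (hj : j < I.bags.length) (v : Fin I.n) :
    I.bagBits[j * I.n + v]? = some (decide (v ∈ I.bags[j])) := by
  rw [bagBits, flatMap_getElem? (by simp) _ _ v.2]
  simp [hj]

theorem encode_eq : I.encode = unaryCode I.n ++ (matrixBits I.graph ++ (unaryCode I.k ++
    (unaryCode I.bags.length ++ I.bagBits))) := by
  simp only [encode, encodeGraph, List.append_assoc]
  rfl

theorem length_unaryCode (n : ℕ) : (unaryCode n).length = n + 1 := by simp [unaryCode]

@[simp] theorem sizeField_encode : sizeField I.encode = I.n := by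
  rw [encode_eq]
  exact run_append [] _ _

@[simp] theorem kField_encode : kField I.encode = I.k := by
  rw [kField, sizeField_encode, encode_eq, ← List.append_assoc]
  have := run_append (unaryCode I.n ++ matrixBits I.graph)
    (unaryCode I.bags.length ++ I.bagBits) I.k
  rwa [List.length_append, length_unaryCode, length_matrixBits] at this

theorem kEnd_encode :
    kEnd I.encode = (unaryCode I.n ++ matrixBits I.graph ++ unaryCode I.k).length := by
  simp [kEnd, length_unaryCode, length_matrixBits, Nat.add_assoc]

@[simp] theorem bagsField_encode : bagsField I.encode = I.bags.length := by
  rw [bagsField, kEnd_encode, encode_eq]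
  simpa using run_append (unaryCode I.n ++ matrixBits I.graph ++ unaryCode I.k) I.bagBits
    I.bags.length

theorem adjBit_encode (u v : Fin I.n) : AdjBit I.encode u v ↔ I.graph.Adj u v := by
  have h : (u : ℕ) * I.n + v < I.n * I.n := mul_add_lt u.2 v.2
  rw [AdjBit, sizeField_encode, encode_eq, List.getElem?_append_right
      (by rw [length_unaryCode]; omega), length_unaryCode, Nat.add_sub_cancel_left,
    List.getElem?_append_left (by rwa [length_matrixBits]), matrixBits_getElem?]
  simp

theorem bagBit_encode (j : ℕ) (hj : j < I.bags.length) (v : Fin I.n) :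
    BagBit I.encode j v ↔ v ∈ I.bags[j] := by
  have h : j * I.n + v < I.bags.length * I.n := mul_add_lt hj v.2
  have h₁ : kEnd I.encode + bagsField I.encode + 1 =
      (unaryCode I.n ++ matrixBits I.graph ++ unaryCode I.k ++ unaryCode I.bags.length).length := by
    rw [List.length_append (bs := unaryCode I.bags.length), kEnd_encode, bagsField_encode,
      length_unaryCode, Nat.add_assoc]
  have h₂ : I.encode = (unaryCode I.n ++ matrixBits I.graph ++ unaryCode I.k ++
      unaryCode I.bags.length) ++ I.bagBits := by simp [encode_eq]
  rw [BagBit, h₁, sizeField_encode, h₂, List.getElem?_append_right (Nat.le_add_right _ _),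
    Nat.add_sub_cancel_left, bagBits_getElem? I j hj]
  simp

theorem count_bagBit (j : ℕ) (hj : j < I.bags.length) :
    Nat.count (BagBit I.encode j) I.n = I.bags[j].card := by
  rw [count_eq_card_filter_fin]
  congr 1
  ext v
  simp [I.bagBit_encode j hj]

theorem valid_encode : Valid I.encode where
  length_eq := by
    rw [kEnd_encode, bagsField_encode, sizeField_encode, encode_eq]
    simp only [List.length_append, length_bagBits, length_unaryCode]
    omega
  two_le := by simpa using I.two_le
  le_size := by simpa using I.le_card
  symm u hu v hv h := by
    rw [sizeField_encode] at hu hv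
    exact (I.adjBit_encode ⟨v, hv⟩ ⟨u, hu⟩).2 ((I.adjBit_encode ⟨u, hu⟩ ⟨v, hv⟩).1 h).symm
  irrefl u hu h := by
    rw [sizeField_encode] at hu
    exact ((I.adjBit_encode ⟨u, hu⟩ ⟨u, hu⟩).1 h).ne rfl
  vertex_mem v hv := by
    rw [sizeField_encode] at hv
    obtain ⟨B, hB, h⟩ := I.isPathDecomposition.vertex_mem ⟨v, hv⟩
    obtain ⟨j, hj, rfl⟩ := List.getElem_of_mem hB
    exact ⟨j, by simpa using hj, (I.bagBit_encode j hj ⟨v, hv⟩).2 h⟩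
  edge_mem u hu v hv h := by
    rw [sizeField_encode] at hu hv
    obtain ⟨B, hB, h₁, h₂⟩ := I.isPathDecomposition.edge_mem _ _
      ((I.adjBit_encode ⟨u, hu⟩ ⟨v, hv⟩).1 h)
    obtain ⟨j, hj, rfl⟩ := List.getElem_of_mem hB
    exact ⟨j, by simpa using hj, (I.bagBit_encode j hj ⟨u, hu⟩).2 h₁,
      (I.bagBit_encode j hj ⟨v, hv⟩).2 h₂⟩
  convex v hv l hl j hj i hi h₁ h₂ := by
    rw [sizeField_encode] at hv
    rw [bagsField_encode] at hl
    exact (I.bagBit_encode j (by omega) ⟨v, hv⟩).2 (I.isPathDecomposition.convex ⟨v, hv⟩ i j l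
      hi.le hj.le hl ((I.bagBit_encode i (by omega) ⟨v, hv⟩).1 h₁)
      ((I.bagBit_encode l hl ⟨v, hv⟩).1 h₂))
  card_le j hj := by
    rw [bagsField_encode] at hj
    rw [sizeField_encode, kField_encode, I.count_bagBit j hj]
    exact ((width_eq_iff _ _ I.two_le).1 I.width_eq).1 _ (List.getElem_mem hj)
  exists_card := by
    obtain ⟨B, hB, h⟩ := ((width_eq_iff _ _ I.two_le).1 I.width_eq).2
    obtain ⟨j, hj, rfl⟩ := List.getElem_of_mem hB
    refine ⟨j, by simpa using hj, ?_⟩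
    rwa [sizeField_encode, kField_encode, I.count_bagBit j hj]

end ImprovementInstance

namespace Valid

variable {x : List Bool} (h : Valid x)

/-- The graph that is encoded by a valid string. -/
def graph : SimpleGraph (Fin (sizeField x)) where
  Adj u v := AdjBit x u v
  symm := ⟨fun u v huv => h.symm u u.2 v v.2 huv⟩
  loopless := ⟨fun u huu => h.irrefl u u.2 huu⟩

/-- The path decomposition that is encoded by a valid string. -/
def bags (x : List Bool) : List (Finset (Fin (sizeField x))) :=
  (List.range (bagsField x)).map fun j => Finset.univ.filter fun v => BagBit x j v

/-- The instance that is encoded by a valid string. -/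
def toInstance : ImprovementInstance where
  n := sizeField x
  graph := h.graph
  k := kField x
  bags := bags x
  two_le := h.two_le
  le_card := h.le_size
  isPathDecomposition := by
    refine ⟨fun v => ?_, fun u v huv => ?_, fun v i j l hij hjl hl hi hj => ?_⟩
    · obtain ⟨j, hj, hv⟩ := h.vertex_mem v v.2
      exact ⟨_, List.mem_map_of_mem (List.mem_range.2 hj), by simpa using hv⟩
    · obtain ⟨j, hj, hv⟩ := h.edge_mem u u.2 v v.2 huv
      exact ⟨_, List.mem_map_of_mem (List.mem_range.2 hj), by simpa using hv⟩
    · simp only [bags, List.length_map, List.length_range] at hl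
      simp only [bags, List.getElem_map, List.getElem_range, Finset.mem_filter, Finset.mem_univ,
        true_and] at hi hj ⊢
      rcases hij.eq_or_lt with rfl | hij
      · exact hi
      rcases hjl.eq_or_lt with rfl | hjl
      · exact hj
      exact h.convex v v.2 l hl j hjl i hij hi hj
  width_eq := by
    rw [width_eq_iff _ _ h.two_le]
    simp only [bags, List.mem_map, exists_exists_and_eq_and, forall_exists_index, and_imp,
    forall_apply_eq_imp_iff₂, List.mem_range,
      ← count_eq_card_filter_fin]
    exact ⟨h.card_le, h.exists_card⟩

-- The string is cut into its unary codes, its matrix and its bag vectors. The length condition in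
-- `Valid` ensures that each unary code is terminated and that the two bit blocks have the right
-- sizes.
open Classical in
theorem encode_toInstance : h.toInstance.encode = x := by
  have hl := h.length_eq
  set n := sizeField x with hn
  set k := kField x with hk
  set b := bagsField x with hb
  have hkE : kEnd x = n + 1 + n * n + k + 1 := rfl
  rw [ImprovementInstance.encode_eq]
  have d₁ : x = unaryCode n ++ x.drop (n + 1) := by
    have := drop_eq_unaryCode_append (x := x) (p := 0) (by
      rw [show run x 0 = n from rfl]; omega)
    rwa [show run x 0 = n from rfl, List.drop_zero, Nat.zero_add] at this
  have d₂ : x.drop (n + 1) = (x.drop (n + 1)).take (n * n) ++ x.drop (n + 1 + n * n) := by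
    conv_lhs => rw [← List.take_append_drop (n * n) (x.drop (n + 1)), List.drop_drop]
  have d₃ : x.drop (n + 1 + n * n) = unaryCode k ++ x.drop (kEnd x) :=
    drop_eq_unaryCode_append (x := x) (p := n + 1 + n * n) (by
      rw [show run x (n + 1 + n * n) = k from rfl]; omega)
  have d₄ : x.drop (kEnd x) = unaryCode b ++ x.drop (kEnd x + b + 1) :=
    drop_eq_unaryCode_append (x := x) (p := kEnd x) (by
      rw [show run x (kEnd x) = b from rfl]; omega)
  have hbl : h.toInstance.bags.length = b := by simp [toInstance, bags, hb]
  have m₁ : matrixBits h.toInstance.graph = (x.drop (n + 1)).take (n * n) := by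
    refine ext_of_matrix (length_matrixBits _) ?_ fun u hu v hv => ?_
    · rw [List.length_take, List.length_drop]
      exact Nat.min_eq_left (by omega)
    · have huv : u * n + v < n * n := mul_add_lt hu hv
      rw [matrixBits_getElem? _ ⟨u, hu⟩ ⟨v, hv⟩]
      change _ = ((x.drop (n + 1)).take (n * n))[u * n + v]?
      rw [List.getElem?_take_of_lt huv, List.getElem?_drop,
        List.getElem?_eq_getElem (by omega), Option.some_inj, Bool.eq_iff_iff]
      refine decide_eq_true_iff.trans ?_
      change AdjBit x u v ↔ _
      rw [AdjBit, ← hn, List.getElem?_eq_getElem (by omega), Option.some_inj]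
  have m₂ : h.toInstance.bagBits = x.drop (kEnd x + b + 1) := by
    refine ext_of_matrix (h.toInstance.length_bagBits) ?_ fun j hj v hv => ?_
    · rw [List.length_drop, hbl, show h.toInstance.n = n from rfl]
      omega
    · have hjv : j * n + v < b * n := mul_add_lt (hbl ▸ hj) hv
      rw [ImprovementInstance.bagBits_getElem? _ j hj ⟨v, hv⟩]
      change _ = (x.drop (kEnd x + b + 1))[j * n + v]?
      rw [List.getElem?_drop, List.getElem?_eq_getElem (by omega), Option.some_inj,
        Bool.eq_iff_iff, decide_eq_true_iff]
      have : (⟨v, hv⟩ : Fin h.toInstance.n) ∈ h.toInstance.bags[j] ↔ BagBit x j v := by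
        have hj' : j < (bags x).length := hj
        change (⟨v, hv⟩ : Fin (sizeField x)) ∈ (bags x)[j] ↔ _
        simp [bags]
      rw [this, BagBit, ← hn, List.getElem?_eq_getElem (by omega), Option.some_inj]
  rw [m₁, m₂, hbl]
  change unaryCode n ++ (_ ++ (unaryCode k ++ _)) = x
  rw [← d₄, ← d₃, ← d₂, ← d₁]

end Valid

theorem encodeGraph_eq {n : ℕ} (G : SimpleGraph (Fin n)) :
    encodeGraph G = unaryCode n ++ matrixBits G := rfl

/-- Graphs with the same code are equal. -/
theorem sigma_eq_of_encodeGraph_eq {n m : ℕ} {G : SimpleGraph (Fin n)} {H : SimpleGraph (Fin m)}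
    (h : encodeGraph G = encodeGraph H) :
    (⟨n, G⟩ : Σ n, SimpleGraph (Fin n)) = ⟨m, H⟩ := by
  rw [encodeGraph_eq, encodeGraph_eq] at h
  obtain rfl : n = m := by
    have h₁ := run_append [] (matrixBits G) n
    rw [h] at h₁
    exact h₁.symm.trans (run_append [] (matrixBits H) m)
  have h' := List.append_cancel_left h
  congr 1
  ext u v
  have h₁ := matrixBits_getElem? G u v
  rw [h', matrixBits_getElem? H u v, Option.some_inj, decide_eq_decide] at h₁
  exact h₁.symm

/-- Since `Valid` strings are exactly the codes of instances, the existential quantifier over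
instances becomes a property of the string that bounded formulas can test. -/
theorem mem_pathwidthImprovement_iff {x : List Bool} :
    x ∈ pathwidthImprovement ↔ ∃ h : Valid x, pathwidth h.graph ≤ kField x - 2 := by
  constructor
  · rintro ⟨I, rfl, hI⟩
    refine ⟨I.valid_encode, ?_⟩
    rw [I.kField_encode]
    refine (pathwidth_congr ⟨finCongr I.sizeField_encode, ?_⟩).trans_le hI
    intro u v
    exact (I.adjBit_encode _ _).symm
  · rintro ⟨h, hx⟩
    exact ⟨h.toInstance, h.encode_toInstance.symm, hx⟩

theorem mem_kPathwidth_iff {n k : ℕ} (G : SimpleGraph (Fin n)) :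
    (encodeGraph G, k) ∈ kPathwidth ↔ pathwidth G ≤ k := by
  constructor
  · rintro ⟨m, H, h, hH⟩
    have e := sigma_eq_of_encodeGraph_eq h
    obtain rfl : n = m := congrArg Sigma.fst e
    obtain rfl : G = H := by simpa using e
    exact hH
  · exact fun h => ⟨n, G, rfl, h⟩

end CrossComp

/-! ### The composed graph as an arithmetic function of the input strings. -/

namespace CrossComp

/-! ### The construction as a function of the input strings -/

/-- The number of inner nodes of the ternary tree of height `s`. -/
def firstLeaf (s : ℕ) : ℕ := (3 ^ s - 1) / 2

theorem two_mul_firstLeaf (s : ℕ) : 2 * firstLeaf s + 1 = 3 ^ s := by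
  have h : 3 ^ s % 2 = 1 := by rw [Nat.pow_mod]; simp
  rw [firstLeaf]
  generalize 3 ^ s = m at h ⊢
  omega

section Construction

variable (xs : List (List Bool))

/-- The height of the tree that is used for the given strings. -/
def level : ℕ := max 1 (Nat.clog 3 xs.length)

/-- The common parameter of the given strings. -/
def commonK : ℕ := max 2 (kField (xs.getD 0 []))

/-- The `i`-th string is an instance with the common parameter. -/
def Good (i : ℕ) : Prop := Valid (xs.getD i []) ∧ kField (xs.getD i []) = commonK xs

open Classical in
/-- The number of vertices of the graph at the `i`-th leaf. -/
noncomputable def slotSize (i : ℕ) : ℕ := if Good xs i then sizeField (xs.getD i []) else commonK xs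

/-- The adjacency of the graph at the `i`-th leaf, which is a clique if there is no usable
instance. -/
def SlotAdj (i u v : ℕ) : Prop := u ≠ v ∧ (Good xs i → AdjBit (xs.getD i []) u v)

/-- The number of tree nodes. -/
def numNodes : ℕ := firstLeaf (level xs) + 3 ^ level xs

/-- The number of the first vertex of the graph at the `i`-th leaf. -/
noncomputable def slotStart (i : ℕ) : ℕ :=
  numNodes xs * commonK xs + ∑ j ∈ Finset.range i, slotSize xs j

/-- Adjacency of two vertices of tree cliques, in terms of their numbers. -/
def NodeNodeAdj (p q : ℕ) : Prop :=
  ∃ u < numNodes xs, ∃ c < commonK xs, ∃ u' < numNodes xs, ∃ c' < commonK xs,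
    p = c + commonK xs * u ∧ q = c' + commonK xs * u' ∧ p ≠ q ∧
      (u = u' ∨ ∃ a < 3, u' = 3 * u + 1 + a ∨ u = 3 * u' + 1 + a)

/-- Adjacency of a vertex of a tree clique and a vertex at a leaf, in terms of their numbers. -/
def NodeLeafAdj (p q : ℕ) : Prop :=
  ∃ u < numNodes xs, ∃ c < commonK xs, ∃ i < 3 ^ level xs, ∃ v < slotSize xs i,
    p = c + commonK xs * u ∧ q = slotStart xs i + v ∧ u = firstLeaf (level xs) + i

/-- Adjacency of two vertices at leaves, in terms of their numbers. -/
def LeafLeafAdj (p q : ℕ) : Prop :=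
  ∃ i < 3 ^ level xs, ∃ v < slotSize xs i, ∃ v' < slotSize xs i,
    p = slotStart xs i + v ∧ q = slotStart xs i + v' ∧ SlotAdj xs i v v'

/-- Adjacency in the constructed graph, in terms of the numbers of the vertices. -/
def VertexAdj (p q : ℕ) : Prop :=
  NodeNodeAdj xs p q ∨ NodeLeafAdj xs p q ∨ NodeLeafAdj xs q p ∨ LeafLeafAdj xs p q

/-- The number of vertices of the constructed graph. -/
noncomputable def numVertices : ℕ := slotStart xs (3 ^ level xs)

/-- The parameter of the constructed instance. -/
def outParam : ℕ := commonK xs * (level xs + 2) - 2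

end Construction

/-- Expressions have no exponentiation, so powers of three are recognised by their divisors: each is
`1` or a multiple of `3`. All quantifiers are bounded. -/
theorem isPow_three_iff (y : ℕ) : (0 < y ∧ ∀ d < y + 1, (∃ q < y + 1, d * q = y) →
    d = 1 ∨ ∃ q < d, d = 3 * q) ↔ ∃ m, y = 3 ^ m := by
  constructor
  · rintro ⟨hy, h⟩
    refine ⟨_, Nat.eq_prime_pow_of_unique_prime_dvd hy.ne' fun {d} hd hdy => ?_⟩
    obtain ⟨q, hq⟩ := id hdy
    have hqy : q ≤ y := Nat.le_of_dvd hy ⟨d, by rw [hq, Nat.mul_comm]⟩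
    rcases h d (Nat.lt_succ_of_le (Nat.le_of_dvd hy hdy)) ⟨q, Nat.lt_succ_of_le hqy, hq.symm⟩ with
      h | ⟨q, -, h⟩
    · exact absurd h hd.ne_one
    · exact ((Nat.prime_dvd_prime_iff_eq Nat.prime_three hd).1 ⟨q, h⟩).symm
  · rintro ⟨m, rfl⟩
    refine ⟨by positivity, fun d _ ⟨q, _, hq⟩ => ?_⟩
    obtain ⟨j, _, rfl⟩ := (Nat.dvd_prime_pow Nat.prime_three).1 ⟨q, hq.symm⟩
    rcases j with _ | j
    · exact .inl rfl
    · exact .inr ⟨3 ^ j, Nat.pow_lt_pow_right (by norm_num) j.lt_succ_self, by rw [pow_succ']⟩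

theorem le_pow_level (xs : List (List Bool)) : xs.length ≤ 3 ^ level xs :=
  (Nat.le_pow_clog (by norm_num) _).trans (Nat.pow_le_pow_right (by norm_num) (le_max_right _ _))

/-- Padding to a power of three enlarges the number of leaves only linearly, which supplies the
bound for the search for it. -/
theorem pow_level_le (xs : List (List Bool)) : 3 ^ level xs ≤ 3 * xs.length + 3 := by
  rw [level]
  rcases le_total 1 (Nat.clog 3 xs.length) with h | h
  · rw [max_eq_right h]
    have hlt : 1 < xs.length := by
      by_contra! hle
      rw [Nat.clog_of_right_le_one hle] at h
      omega
    have := Nat.pow_pred_clog_lt_self (b := 3) (by norm_num) hlt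
    obtain ⟨m, hm⟩ := Nat.exists_eq_add_of_le' h
    rw [hm, Nat.pred_succ] at this
    rw [hm, pow_succ]
    omega
  · rw [max_eq_left h]
    omega

namespace Expr

variable {r : ℕ}

/-- The successor. -/
def succ (a : Expr r) : Expr r := .add a (.const 1)

/-- The length of the run of letters `true` from position `p` of the `i`-th string on. -/
def run (i p : Expr r) : Expr r :=
  .find (strLen i) (.not (bit i.up.up (.add p.up.up (.var 0))))

def sizeField (i : Expr r) : Expr r := run i (.const 0)

def adjBit (i u v : Expr r) : Expr r :=
  bit i (.add (.succ (sizeField i)) (.add (.mul u (sizeField i)) v))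

def kPos (i : Expr r) : Expr r := .add (.succ (sizeField i)) (.mul (sizeField i) (sizeField i))

def kField (i : Expr r) : Expr r := run i (kPos i)

def kEnd (i : Expr r) : Expr r := .succ (.add (kPos i) (kField i))

def bagsField (i : Expr r) : Expr r := run i (kEnd i)

def bagBit (i j v : Expr r) : Expr r :=
  bit i (.add (.succ (.add (kEnd i) (bagsField i))) (.add (.mul j (sizeField i)) v))

/-- The number of elements of the `j`-th bag of the `i`-th string. -/
def bagCard (i j : Expr r) : Expr r := .count (sizeField i) (bagBit i.up j.up (.var 0))

/-- The `i`-th string is the code of an instance. -/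
def valid (i : Expr r) : Expr r :=
  .and (.eq (strLen i)
    (.add (.succ (.add (kEnd i) (bagsField i))) (.mul (bagsField i) (sizeField i)))) <|
  .and (.le (.const 2) (kField i)) <|
  .and (.le (kField i) (sizeField i)) <|
  .and (.all (sizeField i) <| .all (sizeField i.up) <|
    .imp (adjBit i.up.up (var 0).up (.var 0)) (adjBit i.up.up (.var 0) (var 0).up)) <|
  .and (.all (sizeField i) <| .not (adjBit i.up (.var 0) (.var 0))) <|
  .and (.all (sizeField i) <| .ex (bagsField i.up) <| bagBit i.up.up (.var 0) (var 0).up) <|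
  .and (.all (sizeField i) <| .all (sizeField i.up) <|
    .imp (adjBit i.up.up (var 0).up (.var 0)) <| .ex (bagsField i.up.up) <|
      .and (bagBit i.up.up.up (.var 0) (var 0).up.up) (bagBit i.up.up.up (.var 0) (var 0).up)) <|
  .and (.all (sizeField i) <| .all (bagsField i.up) <| .all (.var 0) <| .all (.var 0) <|
    .imp (bagBit i.up.up.up.up (.var 0) (var 0).up.up.up) <|
    .imp (bagBit i.up.up.up.up (var 0).up.up (var 0).up.up.up) <|
      bagBit i.up.up.up.up (var 0).up (var 0).up.up.up) <|
  .and (.all (bagsField i) <| .le (bagCard i.up (.var 0)) (kField i.up)) <|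
  .ex (bagsField i) <| .le (kField i.up) (bagCard i.up (.var 0))

/-- A number is a power of three. -/
def isPow (y : Expr r) : Expr r :=
  .and (.lt (.const 0) y) <| .all (.succ y) <|
    .imp (.ex (.succ y.up) <| .eq (.mul (var 0).up (.var 0)) y.up.up) <|
      .or (.eq (.var 0) (.const 1)) (.ex (.var 0) <| .eq (var 0).up (.mul (.const 3) (.var 0)))

/-- The number of leaves. -/
def numLeaves : Expr r :=
  .find (.add (.mul (.const 3) .len) (.const 3)) <|
    .and (isPow (.var 0)) <| .and (.le (.const 3) (.var 0)) (.le numStrings (.var 0))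

/-- There are exactly `s` powers of three below `3 ^ s`, so the logarithm is obtained by counting.
-/
def level : Expr r := .count numLeaves (isPow (.var 0))

def commonK : Expr r :=
  .ite (.le (.const 2) (kField (.const 0))) (kField (.const 0)) (.const 2)

def good (i : Expr r) : Expr r := .and (valid i) (.eq (kField i) commonK)

def slotSize (i : Expr r) : Expr r := .ite (good i) (sizeField i) commonK

def slotAdj (i u v : Expr r) : Expr r := .and (.not (.eq u v)) (.imp (good i) (adjBit i u v))

/-- Halving by counting: `(3 ^ s - 1) / 2` is the number of `i` with `2 * i + 1 < 3 ^ s`, because `3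
^ s` is odd. -/
def firstLeaf : Expr r :=
  .count numLeaves (.lt (.succ (.mul (.const 2) (.var 0))) numLeaves)

def numNodes : Expr r := .add firstLeaf numLeaves

def slotStart (i : Expr r) : Expr r :=
  .add (.mul numNodes commonK) (.sum i (slotSize (.var 0)))

def child (u a : Expr r) : Expr r := .add (.succ (.mul (.const 3) u)) a

def nodeNodeAdj (p q : Expr r) : Expr r :=
  .ex numNodes <| .ex commonK <| .ex numNodes <| .ex commonK <|
    .and (.eq p.up.up.up.up (.add (var 0).up.up (.mul commonK (var 0).up.up.up))) <|
    .and (.eq q.up.up.up.up (.add (.var 0) (.mul commonK (var 0).up))) <|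
    .and (.not (.eq p.up.up.up.up q.up.up.up.up)) <|
    .or (.eq (var 0).up.up.up (var 0).up) <| .ex (.const 3) <|
      .or (.eq (var 0).up.up (child (var 0).up.up.up.up (.var 0)))
        (.eq (var 0).up.up.up.up (child (var 0).up.up (.var 0)))

def nodeLeafAdj (p q : Expr r) : Expr r :=
  .ex numNodes <| .ex commonK <| .ex numLeaves <| .ex (slotSize (.var 0)) <|
    .and (.eq p.up.up.up.up (.add (var 0).up.up (.mul commonK (var 0).up.up.up))) <|
    .and (.eq q.up.up.up.up (.add (slotStart (var 0).up) (.var 0))) <|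
    .eq (var 0).up.up.up (.add firstLeaf (var 0).up)

def leafLeafAdj (p q : Expr r) : Expr r :=
  .ex numLeaves <| .ex (slotSize (.var 0)) <| .ex (slotSize (var 0).up) <|
    .and (.eq p.up.up.up (.add (slotStart (var 0).up.up) (var 0).up)) <|
    .and (.eq q.up.up.up (.add (slotStart (var 0).up.up) (.var 0))) <|
    slotAdj (var 0).up.up (var 0).up (.var 0)

def vertexAdj (p q : Expr r) : Expr r :=
  .or (nodeNodeAdj p q) <| .or (nodeLeafAdj p q) <| .or (nodeLeafAdj q p) (leafLeafAdj p q)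

def numVertices : Expr r := slotStart numLeaves

def outParam : Expr r := .sub (.mul commonK (.add level (.const 2))) (.const 2)

/-- The length of the output. -/
def outLength : Expr r :=
  .add (.succ outParam) (.add (.succ numVertices) (.mul numVertices numVertices))

/-- The `j`-th letter of the output. -/
def outBit (j : Expr r) : Expr r :=
  .or (.lt j outParam) <|
  .or (.and (.lt outParam j) (.lt j (.add (.succ outParam) numVertices))) <|
  .ex numVertices <| .ex numVertices <|
    .and (.eq j.up.up (.add (.succ outParam) (.add (.succ numVertices)
      (.add (.mul (var 0).up numVertices) (.var 0))))) <|
    vertexAdj (var 0).up (.var 0)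

section Eval

variable (xs : List (List Bool)) (v : Fin r → ℕ)

@[simp] theorem eval_succ (w : List (Option Bool)) (a : Expr r) :
    a.succ.eval w v = a.eval w v + 1 := rfl

@[simp] theorem eval_run (i p : Expr r) : (run i p).eval (encodeStrings xs) v =
    CrossComp.run (xs.getD (i.eval (encodeStrings xs) v) []) (p.eval (encodeStrings xs) v) := by
  obtain ⟨h₁, h₂⟩ := run_eq_iff.1 (rfl : CrossComp.run
    (xs.getD (i.eval (encodeStrings xs) v) []) (p.eval (encodeStrings xs) v) = _)
  refine eval_find _ ?_ (fun q j hj => ?_) fun _ q => ?_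
  · rw [eval_strLen]
    exact run_le _ _
  · simpa using h₂ j hj
  · simpa using h₁

@[simp] theorem eval_sizeField (i : Expr r) : (sizeField i).eval (encodeStrings xs) v =
    CrossComp.sizeField (xs.getD (i.eval (encodeStrings xs) v) []) := by
  simp [sizeField, CrossComp.sizeField]

@[simp] theorem holds_adjBit (i a b : Expr r) : (adjBit i a b).Holds (encodeStrings xs) v ↔
    AdjBit (xs.getD (i.eval (encodeStrings xs) v) []) (a.eval (encodeStrings xs) v)
      (b.eval (encodeStrings xs) v) := by
  simp [adjBit, AdjBit]

@[simp] theorem eval_kPos (i : Expr r) : (kPos i).eval (encodeStrings xs) v =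
    CrossComp.sizeField (xs.getD (i.eval (encodeStrings xs) v) []) + 1 +
      CrossComp.sizeField (xs.getD (i.eval (encodeStrings xs) v) []) *
        CrossComp.sizeField (xs.getD (i.eval (encodeStrings xs) v) []) := by
  simp [kPos]

@[simp] theorem eval_kField (i : Expr r) : (kField i).eval (encodeStrings xs) v =
    CrossComp.kField (xs.getD (i.eval (encodeStrings xs) v) []) := by
  simp [kField, CrossComp.kField]

@[simp] theorem eval_kEnd (i : Expr r) : (kEnd i).eval (encodeStrings xs) v =
    CrossComp.kEnd (xs.getD (i.eval (encodeStrings xs) v) []) := by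
  simp [kEnd, CrossComp.kEnd]

@[simp] theorem eval_bagsField (i : Expr r) : (bagsField i).eval (encodeStrings xs) v =
    CrossComp.bagsField (xs.getD (i.eval (encodeStrings xs) v) []) := by
  simp [bagsField, CrossComp.bagsField]

@[simp] theorem holds_bagBit (i a b : Expr r) : (bagBit i a b).Holds (encodeStrings xs) v ↔
    BagBit (xs.getD (i.eval (encodeStrings xs) v) []) (a.eval (encodeStrings xs) v)
      (b.eval (encodeStrings xs) v) := by
  simp [bagBit, BagBit]

@[simp] theorem eval_bagCard (i j : Expr r) : (bagCard i j).eval (encodeStrings xs) v =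
    Nat.count (BagBit (xs.getD (i.eval (encodeStrings xs) v) []) (j.eval (encodeStrings xs) v))
      (CrossComp.sizeField (xs.getD (i.eval (encodeStrings xs) v) [])) := by
  classical
  rw [bagCard, eval_count, eval_sizeField]
  congr 1
  ext a
  simp

@[simp] theorem holds_valid (i : Expr r) : (valid i).Holds (encodeStrings xs) v ↔
    Valid (xs.getD (i.eval (encodeStrings xs) v) []) := by
  simp only [valid, holds_and, holds_eq, holds_le, holds_all, holds_ex, holds_imp, holds_not,
    holds_adjBit, holds_bagBit, eval_bagCard, eval_sizeField, eval_bagsField, eval_kField,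
    eval_kEnd, eval_strLen, eval_add, eval_mul, eval_succ, eval_const, eval_var, eval_up,
    Fin.cons_zero]
  constructor
  · rintro ⟨h₁, h₂, h₃, h₄, h₅, h₆, h₇, h₈, h₉, h₁₀⟩
    exact ⟨h₁, h₂, h₃, h₄, h₅, h₆, h₇, h₈, h₉, h₁₀⟩
  · rintro ⟨h₁, h₂, h₃, h₄, h₅, h₆, h₇, h₈, h₉, h₁₀⟩
    exact ⟨h₁, h₂, h₃, h₄, h₅, h₆, h₇, h₈, h₉, h₁₀⟩

@[simp] theorem holds_isPow (w : List (Option Bool)) (y : Expr r) :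
    (isPow y).Holds w v ↔ ∃ m, y.eval w v = 3 ^ m := by
  rw [← isPow_three_iff]
  -- The excluded simp lemma would rewrite the bounds `< y + 1` and destroy the match with
  -- `isPow_three_iff`.
  simp [isPow, -Order.lt_add_one_iff]

-- The condition `3 ≤ m` enforces height at least one. The search bound suffices because every
-- string contributes its own terminator, so the number of strings is at most the length of the
-- input word.
@[simp] theorem eval_numLeaves :
    (numLeaves : Expr r).eval (encodeStrings xs) v = 3 ^ CrossComp.level xs := by
  refine eval_find _ ?_ (fun q j hj => ?_) fun _ q => ?_
  · have h₁ := pow_level_le xs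
    have h₂ : xs.length ≤ (encodeStrings xs).length := by
      have := terminators_offset xs _ le_rfl
      rw [← this, ← offset_of_le xs _ le_rfl]
      exact Nat.count_le _
    simp only [eval_add, eval_mul, eval_const, eval_len]
    omega
  · simp only [holds_and, holds_isPow, holds_le, eval_var, Fin.cons_zero, eval_const,
      eval_numStrings]
    rintro ⟨⟨m, rfl⟩, h₁, h₂⟩
    have hm := (Nat.pow_lt_pow_iff_right (by norm_num)).1 hj
    rw [CrossComp.level, lt_max_iff] at hm
    rcases hm with hm | hm
    · rw [Nat.lt_one_iff.1 hm] at h₁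
      omega
    · exact absurd (Nat.clog_le_of_le_pow h₂) hm.not_ge
  · simp only [holds_and, holds_isPow, holds_le, eval_var, Fin.cons_zero, eval_const,
      eval_numStrings]
    refine ⟨⟨_, rfl⟩, ?_, le_pow_level xs⟩
    calc 3 = 3 ^ 1 := rfl
      _ ≤ _ := Nat.pow_le_pow_right (by norm_num) (le_max_left _ _)

theorem count_isPow (s : ℕ) (p : ℕ → Prop) [DecidablePred p] (hp : ∀ y, p y ↔ ∃ m, y = 3 ^ m) :
    Nat.count p (3 ^ s) = s := by
  rw [Nat.count_eq_card_filter_range]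
  have : (Finset.range (3 ^ s)).filter p = (Finset.range s).image fun m => 3 ^ m := by
    ext y
    simp only [Finset.mem_filter, Finset.mem_range, Finset.mem_image, hp]
    constructor
    · rintro ⟨h, m, rfl⟩
      exact ⟨m, (Nat.pow_lt_pow_iff_right (by norm_num)).1 h, rfl⟩
    · rintro ⟨m, h, rfl⟩
      exact ⟨Nat.pow_lt_pow_right (by norm_num) h, m, rfl⟩
  rw [this, Finset.card_image_of_injective _ (Nat.pow_right_injective (by norm_num)),
    Finset.card_range]

@[simp] theorem eval_level :
    (level : Expr r).eval (encodeStrings xs) v = CrossComp.level xs := by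
  classical
  rw [level, eval_count, eval_numLeaves]
  exact count_isPow _ _ fun y => by simp

@[simp] theorem eval_commonK :
    (commonK : Expr r).eval (encodeStrings xs) v = CrossComp.commonK xs := by
  classical
  rw [commonK, eval_ite, CrossComp.commonK]
  simp only [holds_le, eval_kField, eval_const]
  split_ifs <;> omega

@[simp] theorem holds_good (i : Expr r) : (good i).Holds (encodeStrings xs) v ↔
    Good xs (i.eval (encodeStrings xs) v) := by
  simp [good, Good]

@[simp] theorem eval_slotSize (i : Expr r) : (slotSize i).eval (encodeStrings xs) v =
    CrossComp.slotSize xs (i.eval (encodeStrings xs) v) := by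
  classical
  rw [slotSize, eval_ite, CrossComp.slotSize]
  simp

@[simp] theorem holds_slotAdj (i a b : Expr r) : (slotAdj i a b).Holds (encodeStrings xs) v ↔
    SlotAdj xs (i.eval (encodeStrings xs) v) (a.eval (encodeStrings xs) v)
      (b.eval (encodeStrings xs) v) := by
  simp [slotAdj, SlotAdj]

@[simp] theorem eval_firstLeaf : (firstLeaf : Expr r).eval (encodeStrings xs) v =
    CrossComp.firstLeaf (CrossComp.level xs) := by
  have := two_mul_firstLeaf (CrossComp.level xs)
  refine eval_count_eq _ ?_ fun i _ => ?_
  · rw [eval_numLeaves]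
    omega
  · simp only [holds_lt, eval_succ, eval_mul, eval_const, eval_var, Fin.cons_zero, eval_numLeaves]
    omega

@[simp] theorem eval_numNodes :
    (numNodes : Expr r).eval (encodeStrings xs) v = CrossComp.numNodes xs := by
  simp [numNodes, CrossComp.numNodes]

@[simp] theorem eval_slotStart (i : Expr r) : (slotStart i).eval (encodeStrings xs) v =
    CrossComp.slotStart xs (i.eval (encodeStrings xs) v) := by
  simp [slotStart, CrossComp.slotStart]

@[simp] theorem eval_child (w : List (Option Bool)) (u a : Expr r) :
    (child u a).eval w v = 3 * u.eval w v + 1 + a.eval w v := rfl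

theorem holds_nodeNodeAdj (p q : Expr r) : (nodeNodeAdj p q).Holds (encodeStrings xs) v ↔
    NodeNodeAdj xs (p.eval (encodeStrings xs) v) (q.eval (encodeStrings xs) v) := by
  simp only [nodeNodeAdj, NodeNodeAdj, holds_and, holds_or, holds_eq, holds_ex, holds_not,
    eval_numNodes, eval_commonK, eval_add, eval_mul, eval_const, eval_child, eval_var, eval_up,
    Fin.cons_zero, ne_eq]

theorem holds_nodeLeafAdj (p q : Expr r) : (nodeLeafAdj p q).Holds (encodeStrings xs) v ↔
    NodeLeafAdj xs (p.eval (encodeStrings xs) v) (q.eval (encodeStrings xs) v) := by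
  simp only [nodeLeafAdj, NodeLeafAdj, holds_and, holds_eq, holds_ex, eval_numNodes, eval_commonK,
    eval_numLeaves, eval_slotSize, eval_slotStart, eval_firstLeaf, eval_add, eval_mul, eval_var,
    eval_up, Fin.cons_zero]

theorem holds_leafLeafAdj (p q : Expr r) : (leafLeafAdj p q).Holds (encodeStrings xs) v ↔
    LeafLeafAdj xs (p.eval (encodeStrings xs) v) (q.eval (encodeStrings xs) v) := by
  simp only [leafLeafAdj, LeafLeafAdj, holds_and, holds_eq, holds_ex, holds_slotAdj,
    eval_numLeaves, eval_slotSize, eval_slotStart, eval_add, eval_var, eval_up, Fin.cons_zero]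

@[simp] theorem holds_vertexAdj (p q : Expr r) : (vertexAdj p q).Holds (encodeStrings xs) v ↔
    VertexAdj xs (p.eval (encodeStrings xs) v) (q.eval (encodeStrings xs) v) := by
  simp only [vertexAdj, VertexAdj, holds_or, holds_nodeNodeAdj, holds_nodeLeafAdj,
    holds_leafLeafAdj]

@[simp] theorem eval_numVertices :
    (numVertices : Expr r).eval (encodeStrings xs) v = CrossComp.numVertices xs := by
  simp [numVertices, CrossComp.numVertices]

@[simp] theorem eval_outParam :
    (outParam : Expr r).eval (encodeStrings xs) v = CrossComp.outParam xs := by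
  simp [outParam, CrossComp.outParam]

theorem eval_outLength : (outLength : Expr r).eval (encodeStrings xs) v =
    CrossComp.outParam xs + 1 +
      (CrossComp.numVertices xs + 1 + CrossComp.numVertices xs * CrossComp.numVertices xs) := by
  simp [outLength]

theorem holds_outBit (j : Expr r) : (outBit j).Holds (encodeStrings xs) v ↔
    j.eval (encodeStrings xs) v < CrossComp.outParam xs ∨
    (CrossComp.outParam xs < j.eval (encodeStrings xs) v ∧
      j.eval (encodeStrings xs) v < CrossComp.outParam xs + 1 + CrossComp.numVertices xs) ∨
    ∃ p < CrossComp.numVertices xs, ∃ q < CrossComp.numVertices xs,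
      j.eval (encodeStrings xs) v = CrossComp.outParam xs + 1 +
        (CrossComp.numVertices xs + 1 + (p * CrossComp.numVertices xs + q)) ∧
      VertexAdj xs p q := by
  simp only [outBit, holds_or, holds_and, holds_lt, holds_ex, holds_eq, holds_vertexAdj,
    eval_outParam, eval_numVertices, eval_add, eval_mul, eval_succ, eval_var, eval_up,
    Fin.cons_zero]

end Eval

end Expr

end CrossComp

/-! ### Numbering the vertices, and the composed graph on an initial segment of the naturals. -/

namespace CrossComp

/-! ### Numbering the vertices of the constructed graph -/

/-- The number whose ternary digits are the letters of a word. -/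
def leafIdx : List (Fin 3) → ℕ
  | [] => 0
  | a :: u => 3 * leafIdx u + a

theorem leafIdx_lt (u : List (Fin 3)) : leafIdx u < 3 ^ u.length := by
  induction u with
  | nil => simp [leafIdx]
  | cons a u ih =>
    rw [leafIdx, List.length_cons, pow_succ]
    have := a.2
    omega

/-- The number of a node of the ternary tree in the numbering by levels. -/
def wordNum (u : List (Fin 3)) : ℕ := firstLeaf u.length + leafIdx u

theorem firstLeaf_succ (s : ℕ) : firstLeaf (s + 1) = firstLeaf s + 3 ^ s := by
  have h₁ := two_mul_firstLeaf s
  have h₂ := two_mul_firstLeaf (s + 1)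
  rw [pow_succ] at h₂
  omega

theorem wordNum_nil : wordNum [] = 0 := rfl

/-- This is the breadth-first numbering of the infinite ternary tree, as in a heap. It makes
adjacency of tree nodes an arithmetic condition on their numbers. -/
theorem wordNum_cons (a : Fin 3) (u : List (Fin 3)) : wordNum (a :: u) = 3 * wordNum u + 1 + a := by
  have := two_mul_firstLeaf u.length
  rw [wordNum, wordNum, List.length_cons, firstLeaf_succ, leafIdx]
  omega

theorem wordNum_injective : Function.Injective wordNum := by
  intro u
  induction u with
  | nil =>
    rintro (_ | ⟨b, v⟩) h
    · rfl
    · rw [wordNum_nil, wordNum_cons] at h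
      omega
  | cons a u ih =>
    rintro (_ | ⟨b, v⟩) h
    · rw [wordNum_nil, wordNum_cons] at h
      omega
    · rw [wordNum_cons, wordNum_cons] at h
      have ha := a.2
      have hb := b.2
      rw [ih (show wordNum u = wordNum v by omega), show a = b from Fin.ext (by omega)]

/-- The parent of the node with number `n + 1` has the number `n / 3`, and `n % 3` tells which child
it is. -/
theorem wordNum_surjective : Function.Surjective wordNum := by
  intro n
  induction n using Nat.strong_induction_on with
  | _ n ih =>
    rcases n with _ | n
    · exact ⟨[], rfl⟩
    · obtain ⟨u, hu⟩ := ih (n / 3) (by omega)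
      exact ⟨⟨n % 3, Nat.mod_lt _ (by norm_num)⟩ :: u, by rw [wordNum_cons, hu, Fin.val_mk]; omega⟩

/-- The words of length `l` occupy the block of numbers from `firstLeaf l` up to, but excluding,
`firstLeaf (l + 1)`. -/
theorem length_le_iff (u : List (Fin 3)) (s : ℕ) :
    u.length ≤ s ↔ wordNum u < firstLeaf s + 3 ^ s := by
  have hmono : Monotone firstLeaf := monotone_nat_of_le_succ fun m => by
    rw [firstLeaf_succ]
    exact Nat.le_add_right _ _
  have h := leafIdx_lt u
  rw [← firstLeaf_succ, wordNum]
  constructor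
  · intro hs
    have := hmono (Nat.succ_le_succ hs)
    rw [Nat.succ_eq_add_one, Nat.succ_eq_add_one, firstLeaf_succ] at this
    omega
  · intro hs
    by_contra! hlt
    have := hmono (Nat.succ_le_of_lt hlt)
    rw [Nat.succ_eq_add_one] at this
    omega

/-- The numbering of the nodes of the ternary tree. -/
noncomputable def nodeEquiv (s : ℕ) : TernaryNode s ≃ Fin (firstLeaf s + 3 ^ s) :=
  Equiv.ofBijective (fun u => ⟨wordNum u.1, (length_le_iff u.1 s).1 u.2⟩)
    ⟨fun u v h => Subtype.ext (wordNum_injective (congrArg Fin.val h)), fun n => by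
      obtain ⟨u, hu⟩ := wordNum_surjective n
      exact ⟨⟨u, (length_le_iff u s).2 (hu ▸ n.2)⟩, Fin.ext hu⟩⟩

/-- The numbering of the leaves of the ternary tree. -/
noncomputable def leafEquiv (s : ℕ) : TernaryLeaf s ≃ Fin (3 ^ s) :=
  Equiv.ofBijective (fun x => ⟨leafIdx x.1, by simpa only [x.2] using leafIdx_lt x.1⟩) <|
    (Fintype.bijective_iff_injective_and_card _).2 ⟨fun x y h => Subtype.ext <| wordNum_injective <|
      by rw [wordNum, wordNum, x.2, y.2, show leafIdx x.1 = leafIdx y.1 from congrArg Fin.val h],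
      by simp⟩

theorem nodeEquiv_val {s : ℕ} (u : TernaryNode s) : (nodeEquiv s u : ℕ) = wordNum u.1 := rfl

theorem eq_iff_nodeEquiv {s : ℕ} (u : TernaryNode s) (x : TernaryLeaf s) :
    u.1 = x.1 ↔ (nodeEquiv s u : ℕ) = firstLeaf s + leafEquiv s x := by
  have h : wordNum x.1 = firstLeaf s + leafEquiv s x := by
    rw [wordNum, x.2]
    rfl
  rw [← h, nodeEquiv_val, wordNum_injective.eq_iff]

theorem exists_cons_iff {s : ℕ} (u v : TernaryNode s) :
    (∃ a : Fin 3, v.1 = a :: u.1) ↔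
      ∃ a < 3, (nodeEquiv s v : ℕ) = 3 * (nodeEquiv s u : ℕ) + 1 + a := by
  simp only [nodeEquiv_val]
  constructor
  · rintro ⟨a, h⟩
    exact ⟨a, a.2, by rw [h, wordNum_cons]⟩
  · rintro ⟨a, ha, h⟩
    exact ⟨⟨a, ha⟩, wordNum_injective (by rw [h, wordNum_cons])⟩

/-- The numbering of the vertices of the combined graph, if there are `m i` vertices at the `i`-th
leaf. -/
noncomputable def vertexEquiv (s k : ℕ) (m : ℕ → ℕ) :
    (TernaryNode s × Fin k) ⊕ (Σ x : TernaryLeaf s, Fin (m (leafEquiv s x))) ≃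
      Fin ((firstLeaf s + 3 ^ s) * k + ∑ j ∈ Finset.range (3 ^ s), m j) :=
  (Equiv.sumCongr (((nodeEquiv s).prodCongr (Equiv.refl _)).trans finProdFinEquiv)
    ((Equiv.sigmaCongrLeft (β := fun i : Fin (3 ^ s) => Fin (m i)) (leafEquiv s)).trans
      (finSigmaFinEquiv.trans (finCongr (Fin.sum_univ_eq_sum_range m _))))).trans finSumFinEquiv

theorem vertexEquiv_inr (s k : ℕ) (m : ℕ → ℕ)
    (z : Σ x : TernaryLeaf s, Fin (m (leafEquiv s x))) :
    (vertexEquiv s k m (.inr z) : ℕ) =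
      (firstLeaf s + 3 ^ s) * k + ∑ j ∈ Finset.range (leafEquiv s z.1), m j + z.2 := by
  have : (vertexEquiv s k m (.inr z) : ℕ) = (firstLeaf s + 3 ^ s) * k +
      (finSigmaFinEquiv (n := fun i : Fin (3 ^ s) => m i) ⟨leafEquiv s z.1, z.2⟩ : ℕ) := rfl
  rw [this, finSigmaFinEquiv_apply, add_assoc]
  congr 2
  exact Fin.sum_univ_eq_sum_range m _

/-! ### The constructed graph -/

theorem Good.symm {xs : List (List Bool)} {i u v : ℕ} (h : Good xs i)
    (hu : u < slotSize xs i) (hv : v < slotSize xs i) (huv : AdjBit (xs.getD i []) u v) :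
    AdjBit (xs.getD i []) v u := by
  rw [slotSize, if_pos h] at hu hv
  exact h.1.symm u hu v hv huv

section Construction

variable (xs : List (List Bool))

/-- The graph that is plugged into the `i`-th leaf. -/
def slotGraph (i : ℕ) : SimpleGraph (Fin (slotSize xs i)) where
  Adj u v := SlotAdj xs i u v
  symm := ⟨fun u v h => ⟨h.1.symm, fun hi => hi.symm u.2 v.2 (h.2 hi)⟩⟩
  loopless := ⟨fun _ h => h.1 rfl⟩

/-- The combined graph that is constructed from the given strings. -/
noncomputable abbrev abstractGraph : SimpleGraph ((TernaryNode (level xs) × Fin (commonK xs)) ⊕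
    (Σ x : TernaryLeaf (level xs), Fin (slotSize xs (leafEquiv (level xs) x)))) :=
  combinedGraph (level xs) (commonK xs) fun x => slotGraph xs (leafEquiv (level xs) x)

/-- The numbering of the vertices of the constructed graph. -/
noncomputable def outEquiv : (TernaryNode (level xs) × Fin (commonK xs)) ⊕
    (Σ x : TernaryLeaf (level xs), Fin (slotSize xs (leafEquiv (level xs) x))) ≃
      Fin (numVertices xs) :=
  vertexEquiv (level xs) (commonK xs) (slotSize xs)

theorem outEquiv_inl (y) :
    (outEquiv xs (.inl y) : ℕ) = y.2 + commonK xs * nodeEquiv (level xs) y.1 := rfl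

theorem outEquiv_inr (z) :
    (outEquiv xs (.inr z) : ℕ) = slotStart xs (leafEquiv (level xs) z.1) + z.2 :=
  vertexEquiv_inr _ _ _ z

/-- The constructed graph on an initial segment of the natural numbers. -/
noncomputable def outGraph : SimpleGraph (Fin (numVertices xs)) :=
  (abstractGraph xs).map (outEquiv xs).toEmbedding

theorem nodeNodeAdj_iff (p q : ℕ) : NodeNodeAdj xs p q ↔ ∃ y y', outEquiv xs (.inl y) = p ∧
    outEquiv xs (.inl y') = q ∧ (abstractGraph xs).Adj (.inl y) (.inl y') := by
  have hadj : ∀ y y', (abstractGraph xs).Adj (.inl y) (.inl y') ↔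
      (outEquiv xs (.inl y) : ℕ) ≠ outEquiv xs (.inl y') ∧
      ((nodeEquiv (level xs) y.1 : ℕ) = nodeEquiv (level xs) y'.1 ∨ ∃ a < 3,
        (nodeEquiv (level xs) y'.1 : ℕ) = 3 * (nodeEquiv (level xs) y.1 : ℕ) + 1 + a ∨
        (nodeEquiv (level xs) y.1 : ℕ) = 3 * (nodeEquiv (level xs) y'.1 : ℕ) + 1 + a) := by
    intro y y'
    have : (abstractGraph xs).Adj (.inl y) (.inl y') ↔
        ((Sum.inl y.1, y.2) : (TernaryNode (level xs) ⊕ TernaryLeaf (level xs)) × _) ≠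
          (Sum.inl y'.1, y'.2) ∧ ((Sum.inl y.1 : TernaryNode (level xs) ⊕ TernaryLeaf (level xs)) =
            Sum.inl y'.1 ∨ (∃ a : Fin 3, y'.1.1 = a :: y.1.1) ∨ (∃ a : Fin 3, y.1.1 = a :: y'.1.1)) :=
      Iff.rfl
    rw [this, exists_cons_iff, exists_cons_iff]
    simp only [and_or_left, exists_or, Fin.val_inj, (outEquiv xs).injective.eq_iff,
      (nodeEquiv _).injective.eq_iff, Sum.inl.injEq, Prod.ext_iff, ne_eq]
  constructor
  · rintro ⟨u, hu, c, hc, u', hu', c', hc', rfl, rfl, h⟩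
    refine ⟨((nodeEquiv _).symm ⟨u, hu⟩, ⟨c, hc⟩), ((nodeEquiv _).symm ⟨u', hu'⟩, ⟨c', hc'⟩), ?_⟩
    rw [hadj]
    simpa only [outEquiv_inl, Equiv.apply_symm_apply, true_and] using h
  · rintro ⟨y, y', rfl, rfl, h⟩
    exact ⟨_, (nodeEquiv _ y.1).2, _, y.2.2, _, (nodeEquiv _ y'.1).2, _, y'.2.2, rfl, rfl,
      (hadj y y').1 h⟩

theorem nodeLeafAdj_iff (p q : ℕ) : NodeLeafAdj xs p q ↔ ∃ y z, outEquiv xs (.inl y) = p ∧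
    outEquiv xs (.inr z) = q ∧ (abstractGraph xs).Adj (.inl y) (.inr z) := by
  have hadj : ∀ y z, (abstractGraph xs).Adj (.inl y) (.inr z) ↔
      (nodeEquiv (level xs) y.1 : ℕ) = firstLeaf (level xs) + leafEquiv (level xs) z.1 :=
    fun y z => eq_iff_nodeEquiv y.1 z.1
  constructor
  · rintro ⟨u, hu, c, hc, i, hi, v, hv, rfl, rfl, h⟩
    refine ⟨((nodeEquiv _).symm ⟨u, hu⟩, ⟨c, hc⟩), ⟨(leafEquiv _).symm ⟨i, hi⟩, ⟨v, ?_⟩⟩, ?_⟩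
    · rwa [Equiv.apply_symm_apply]
    · rw [hadj]
      simpa only [outEquiv_inl, outEquiv_inr, Equiv.apply_symm_apply, true_and] using h
  · rintro ⟨y, z, rfl, rfl, h⟩
    exact ⟨_, (nodeEquiv _ y.1).2, _, y.2.2, _, (leafEquiv _ z.1).2, _, z.2.2, rfl,
      outEquiv_inr xs z, (hadj y z).1 h⟩

theorem leafLeafAdj_iff (p q : ℕ) : LeafLeafAdj xs p q ↔ ∃ z z', outEquiv xs (.inr z) = p ∧
    outEquiv xs (.inr z') = q ∧ (abstractGraph xs).Adj (.inr z) (.inr z') := by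
  constructor
  · rintro ⟨i, hi, v, hv, v', hv', rfl, rfl, h⟩
    obtain ⟨x, hx⟩ := (leafEquiv (level xs)).surjective ⟨i, hi⟩
    obtain rfl : (leafEquiv (level xs) x : ℕ) = i := congrArg Fin.val hx
    exact ⟨⟨x, v, hv⟩, ⟨x, v', hv'⟩, outEquiv_inr _ _, outEquiv_inr _ _, adj_inr_iff.2 h⟩
  · rintro ⟨_, _, rfl, rfl, x, v, v', rfl, rfl, h⟩
    exact ⟨_, (leafEquiv _ x).2, _, v.2, _, v'.2, outEquiv_inr _ _, outEquiv_inr _ _, h⟩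

/-- The graph is defined by transport along the numbering, so it is isomorphic to the combined graph
by construction; this lemma connects it to the arithmetic predicate that expressions can evaluate.
-/
theorem outGraph_adj (p q : Fin (numVertices xs)) : (outGraph xs).Adj p q ↔ VertexAdj xs p q := by
  rw [outGraph, SimpleGraph.map_adj, VertexAdj, nodeNodeAdj_iff, nodeLeafAdj_iff, nodeLeafAdj_iff,
    leafLeafAdj_iff]
  simp only [Sum.exists, exists_or, Equiv.coe_toEmbedding, Fin.val_inj]
  constructor
  · rintro ((⟨y, y', h, hp, hq⟩ | ⟨z, y, h, hp, hq⟩) | (⟨y, z, h, hp, hq⟩ | ⟨z, z', h, hp, hq⟩))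
    · exact .inl ⟨y, y', hp, hq, h⟩
    · exact .inr (.inr (.inl ⟨y, z, hq, hp, h.symm⟩))
    · exact .inr (.inl ⟨y, z, hp, hq, h⟩)
    · exact .inr (.inr (.inr ⟨z, z', hp, hq, h⟩))
  · rintro (⟨y, y', hp, hq, h⟩ | ⟨y, z, hp, hq, h⟩ | ⟨y, z, hq, hp, h⟩ | ⟨z, z', hp, hq, h⟩)
    · exact .inl (.inl ⟨y, y', h, hp, hq⟩)
    · exact .inr (.inl ⟨y, z, h, hp, hq⟩)
    · exact .inl (.inr ⟨z, y, h.symm, hp, hq⟩)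
    · exact .inr (.inr ⟨z, z', h, hp, hq⟩)

/-- The constructed graph is isomorphic to the combined graph. -/
noncomputable def outIso : abstractGraph xs ≃g outGraph xs := SimpleGraph.Iso.map _ _

/-- The instance of `k`-Pathwidth that is constructed from the given strings. -/
noncomputable def construct : List Bool × ℕ := (encodeGraph (outGraph xs), outParam xs)

end Construction

end CrossComp

/-! ### The cross-composition: output string, equivalence relation, padding and correctness. -/

namespace CrossComp

/-! ### The output string -/

theorem unaryCode_eq_map (n : ℕ) (c : ℕ → Prop) [DecidablePred c] (h : ∀ j < n, c j) (hn : ¬ c n) :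
    unaryCode n = (List.range (n + 1)).map fun j => decide (c j) := by
  rw [List.range_succ, List.map_append, unaryCode]
  congr 1
  · refine (List.eq_replicate_iff.2 ⟨by simp, fun b hb => ?_⟩).symm
    obtain ⟨j, hj, rfl⟩ := List.mem_map.1 hb
    exact decide_eq_true (h j (List.mem_range.1 hj))
  · simp [hn]

/-- The output consists of the unary parameter, the unary number of vertices and the matrix. The
positions `k` and `k + 1 + n` satisfy none of the alternatives and carry the terminators of the two
unary codes. -/
theorem encodeParam_encodeGraph {n k : ℕ} (G : SimpleGraph (Fin n)) (c : ℕ → Prop)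
    [DecidablePred c] (A : ℕ → ℕ → Prop) (hA : ∀ p q : Fin n, G.Adj p q ↔ A p q)
    (hc : ∀ j, c j ↔ j < k ∨ (k < j ∧ j < k + 1 + n) ∨
      ∃ p < n, ∃ q < n, j = k + 1 + (n + 1 + (p * n + q)) ∧ A p q) :
    encodeParam (encodeGraph G, k) =
      (List.range (k + 1 + (n + 1 + n * n))).map fun j => decide (c j) := by
  classical
  rw [List.range_add (n := k + 1), List.range_add (n := n + 1), encodeParam, encodeGraph_eq]
  simp only [List.map_append, List.map_map]
  congr 1
  · refine unaryCode_eq_map k c (fun j hj => (hc j).2 (.inl hj)) fun h => ?_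
    rcases (hc k).1 h with h | h | ⟨p, _, q, _, h, _⟩ <;> omega
  congr 1
  · refine unaryCode_eq_map n (fun j => c (k + 1 + j))
      (fun j hj => (hc _).2 (.inr (.inl (by omega)))) fun h => ?_
    rcases (hc _).1 h with h | h | ⟨p, _, q, _, h, _⟩ <;> omega
  · refine ext_of_matrix (length_matrixBits G) (by simp) fun u hu v hv => ?_
    rw [matrixBits_getElem? G ⟨u, hu⟩ ⟨v, hv⟩, List.getElem?_map,
      List.getElem?_range (mul_add_lt hu hv), Option.map_some, Option.some_inj]
    simp only [Function.comp_apply, decide_eq_decide]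
    rw [hA, hc]
    constructor
    · exact fun h => .inr (.inr ⟨u, hu, v, hv, rfl, h⟩)
    · rintro (h | h | ⟨p, hp, q, hq, h, hpq⟩)
      · omega
      · omega
      · have h' : u * n + v = p * n + q := by omega
        have hn : 0 < n := by omega
        have h₁ : u = p := by
          have := congrArg (· / n) h'
          simpa [Nat.mul_add_div, Nat.add_div_of_dvd_right, Nat.div_eq_of_lt hv,
            Nat.div_eq_of_lt hq, hn, Nat.mul_comm _ n] using this
        subst h₁
        have h₂ : v = q := by omega
        subst h₂
        exact hpq

theorem nonempty_polyTime_construct (S : List (List Bool) → Prop) :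
    Nonempty (Turing.TM2ComputableInPolyTime
      (fun xs : {xs : List (List Bool) // S xs} => encodeStrings xs.1) encodeParam
      (fun xs => construct xs.1)) := by
  refine Expr.nonempty_polyTime _ _ _ .outLength (.outBit (.var 0)) fun xs => ?_
  rw [Expr.eval_outLength]
  exact encodeParam_encodeGraph (outGraph xs.1) _ _ (outGraph_adj xs.1) fun j =>
    Expr.holds_outBit xs.1 _ _

/-! ### The equivalence relation -/

/-- Strings are equivalent if their parameters are equal. -/
def paramSetoid : Setoid (List Bool) := Setoid.ker kField

/-- The parsed parameter is a run of ones and hence at most the length of the string, so there is at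
most one class per number up to the maximum length. This covers malformed strings too. -/
theorem isPolynomialEquivalence_paramSetoid : IsPolynomialEquivalence paramSetoid where
  decide_polyTime := by
    refine Expr.nonempty_polyTime _ _ _ (.const 1)
      (.eq (.kField (.const 0)) (.kField (.const 1))) fun p => ?_
    have : (Expr.eq (.kField (.const 0)) (.kField (.const 1)) : Expr 1).Holds
        (encodeStrings [p.1, p.2]) (fun _ => 0) ↔ paramSetoid p.1 p.2 := by
      rw [Expr.holds_eq, Expr.eval_kField, Expr.eval_kField]
      rfl
    exact congrArg (fun b => [b]) (decide_eq_decide.2 this.symm)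
  card_classes_le := by
    refine ⟨Polynomial.X + 1, fun S => ?_⟩
    have hker : Function.Injective (Setoid.kerLift kField) := Setoid.kerLift_injective _
    have := Set.ncard_le_ncard_of_injOn (s := Quotient.mk paramSetoid '' (S : Set (List Bool)))
      (t := Set.Iic (S.sup List.length)) (Setoid.kerLift kField)
      (by
        rintro _ ⟨x, hx, rfl⟩
        exact (run_le _ _).trans (Finset.le_sup (f := List.length) hx))
      hker.injOn (Set.finite_Iic _)
    refine this.trans (le_of_eq ?_)
    rw [← Nat.card_coe_set_eq, Nat.card_eq_fintype_card]
    simp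

/-! ### The graphs at the leaves -/

section Slots

variable {xs : List (List Bool)} {i : ℕ}

theorem Good.valid (h : Good xs i) : Valid (xs.getD i []) := h.1

theorem Good.kField_eq (h : Good xs i) : kField (xs.getD i []) = commonK xs := h.2

/-- The graph at a leaf is the graph that is encoded by the string of the leaf. -/
noncomputable def Good.slotIso (h : Good xs i) : slotGraph xs i ≃g h.valid.graph where
  toEquiv := finCongr (if_pos h)
  map_rel_iff' {u v} := by
    change AdjBit (xs.getD i []) u v ↔ (u : ℕ) ≠ v ∧ (Good xs i → AdjBit (xs.getD i []) u v)
    refine ⟨fun huv => ⟨?_, fun _ => huv⟩, fun huv => huv.2 h⟩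
    intro he
    rw [← he] at huv
    exact h.valid.irrefl u (u.2.trans_eq (if_pos h)) huv

/-- For an instance this is witnessed by its own path decomposition; a padding clique has only
`commonK xs` vertices, which fit into a single bag. -/
theorem pathwidth_slotGraph_le (xs : List (List Bool)) (i : ℕ) :
    pathwidth (slotGraph xs i) ≤ commonK xs - 1 := by
  by_cases h : Good xs i
  · rw [pathwidth_congr h.slotIso]
    exact h.valid.toInstance.isPathDecomposition.pathwidth_le.trans_eq
      (h.valid.toInstance.width_eq.trans (congrArg (· - 1) h.kField_eq))
  · have hK : 2 ≤ commonK xs := le_max_left _ _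
    refine (pathwidth_le_iff _ _).2 ⟨0, 0, fun _ _ => le_rfl, fun _ _ _ _ _ => le_rfl, fun j => ?_⟩
    refine (Set.ncard_le_card _).trans ?_
    rw [Nat.card_fin, slotSize, if_neg h]
    omega

/-- A clique on `k` vertices does not have pathwidth at most `k - 2`, so padding never turns a
no-instance into a yes-instance. -/
theorem good_of_pathwidth_le (h : pathwidth (slotGraph xs i) ≤ commonK xs - 2) : Good xs i := by
  by_contra hi
  have hK : 2 ≤ commonK xs := le_max_left _ _
  have hsize : slotSize xs i = commonK xs := if_neg hi
  have : Nonempty (Fin (slotSize xs i)) := ⟨⟨0, by omega⟩⟩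
  obtain ⟨a, b, r⟩ := (pathwidth_le_iff _ _).1 h
  -- Pairwise intersecting intervals all contain the largest left end point, so one bag contains the
  -- whole clique.
  obtain ⟨u, hu⟩ := Finite.exists_max a
  have hall : {v | v ∈ Set.univ ∧ a v ≤ a u ∧ a u ≤ b v} = Set.univ := by
    refine Set.eq_univ_of_forall fun v => ⟨trivial, hu v, ?_⟩
    by_cases huv : u = v
    · exact huv ▸ r.le u trivial
    · exact r.adj u trivial v trivial ⟨fun h => huv (Fin.ext h), fun h => absurd h hi⟩
  have := r.card (a u)
  rw [hall, Set.ncard_univ, Nat.card_fin] at this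
  omega

theorem not_valid_nil : ¬ Valid [] := fun h =>
  absurd (h.two_le.trans (run_le _ _)) (by simp)

theorem Good.lt_length (h : Good xs i) : i < xs.length := by
  by_contra! hi
  have := h.1
  rw [List.getD_eq_default _ _ hi] at this
  exact not_valid_nil this

theorem Good.pathwidth_le_iff (h : Good xs i) :
    pathwidth (slotGraph xs i) ≤ commonK xs - 2 ↔ xs.getD i [] ∈ pathwidthImprovement := by
  rw [mem_pathwidthImprovement_iff, pathwidth_congr h.slotIso]
  simp only [h.kField_eq, exists_prop_of_true h.valid]

end Slots

/-! ### The cross-composition -/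

theorem SameClass.commonK_eq {xs : List (List Bool)} (h : SameClass paramSetoid xs) {x : List Bool}
    (hx : x ∈ xs) : commonK xs = max 2 (kField x) := by
  obtain ⟨y, ys, rfl⟩ := List.exists_cons_of_ne_nil h.1
  rw [commonK, List.getD_cons_zero, show kField y = kField x from h.2 _ (by simp) _ hx]

/-- A yes-string is valid, so its parameter is at least `2` and, all strings being equivalent, equal
to `commonK xs`; hence its graph really occurs at a leaf. Conversely, a leaf graph of small
pathwidth comes from such a string and not from padding. -/
theorem construct_mem_iff {xs : List (List Bool)} (h : SameClass paramSetoid xs) :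
    construct xs ∈ kPathwidth ↔ ∃ x ∈ xs, x ∈ pathwidthImprovement := by
  rw [construct, mem_kPathwidth_iff, ← pathwidth_congr (outIso xs), outParam,
    pathwidth_combinedGraph_le_iff _ (show 2 ≤ commonK xs from le_max_left _ _) fun x => pathwidth_slotGraph_le _ _]
  constructor
  · rintro ⟨x, hx⟩
    have hg := good_of_pathwidth_le hx
    refine ⟨_, ?_, hg.pathwidth_le_iff.1 hx⟩
    rw [List.getD_eq_getElem _ _ hg.lt_length]
    exact List.getElem_mem _
  · rintro ⟨x, hx, hmem⟩
    obtain ⟨i, hi, rfl⟩ := List.getElem_of_mem hx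
    obtain ⟨hv, -⟩ := mem_pathwidthImprovement_iff.1 hmem
    have hg : Good xs i := by
      rw [Good, h.commonK_eq hx, List.getD_eq_getElem _ _ hi]
      exact ⟨hv, (max_eq_right hv.two_le).symm⟩
    refine ⟨(leafEquiv _).symm ⟨i, hi.trans_le (le_pow_level xs)⟩, ?_⟩
    rw [Equiv.apply_symm_apply, hg.pathwidth_le_iff, List.getD_eq_getElem _ _ hi]
    exact hmem

theorem length_le_maxLength {A : Type} {xs : List (List A)} {x : List A} (hx : x ∈ xs) :
    x.length ≤ maxLength xs :=
  (foldr_max_le_iff _ _).1 le_rfl _ (List.mem_map_of_mem hx)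

theorem level_le_log (xs : List (List Bool)) : level xs ≤ Nat.log 2 xs.length + 2 := by
  have : Nat.clog 3 xs.length ≤ Nat.log 2 xs.length + 1 := by
    refine Nat.clog_le_of_le_pow ((Nat.lt_pow_succ_log_self one_lt_two xs.length).le.trans ?_)
    exact Nat.pow_le_pow_left (by norm_num) _
  rw [level]
  omega

theorem isORCrossComposition_construct :
    IsORCrossComposition paramSetoid construct pathwidthImprovement kPathwidth where
  polyTime := nonempty_polyTime_construct _
  mem_iff _ h := construct_mem_iff h
  param_le := by
    -- The factors bound `commonK xs`, at most the maximum length plus two, and `level xs + 2`, at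
    -- most the binary logarithm of the number of strings plus four.
    refine ⟨(Polynomial.X + 2) * (Polynomial.X + 4), fun xs h => ?_⟩
    obtain ⟨x, hx⟩ := List.exists_mem_of_ne_nil xs h.1
    have h₁ : kField x ≤ maxLength xs := (run_le _ _).trans (length_le_maxLength hx)
    have h₂ := h.commonK_eq hx
    have h₃ := level_le_log xs
    simp only [Polynomial.eval_mul, Polynomial.eval_add, Polynomial.eval_X, Polynomial.eval_ofNat]
    refine (Nat.sub_le _ _).trans (Nat.mul_le_mul ?_ (by omega))
    rw [h₂]
    omega

/-! ### The shape of the constructed graph -/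

/-- Plugging in isomorphic graphs gives isomorphic graphs. -/
def plugIso {N X : Type*} (H : SimpleGraph (N ⊕ X)) (k : ℕ) {V V' : X → Type*}
    {G : ∀ x, SimpleGraph (V x)} {G' : ∀ x, SimpleGraph (V' x)} (e : ∀ x, G x ≃g G' x) :
    plug H k G ≃g plug H k G' where
  toEquiv := Equiv.sumCongr (Equiv.refl _) (Equiv.sigmaCongrRight fun x => (e x).toEquiv)
  map_rel_iff' {a b} := by
    rcases a with p | ⟨x, u⟩ <;> rcases b with q | ⟨y, v⟩
    · rfl
    · rfl
    · rfl
    · constructor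
      · rintro ⟨z, u', v', h₁, h₂, h⟩
        obtain rfl : x = z := congrArg Sigma.fst h₁
        obtain rfl : y = x := congrArg Sigma.fst h₂
        obtain rfl : e _ u = u' := eq_of_heq (Sigma.mk.inj h₁).2
        obtain rfl : e _ v = v' := eq_of_heq (Sigma.mk.inj h₂).2
        exact ⟨_, u, v, rfl, rfl, (e _).map_adj_iff.1 h⟩
      · rintro ⟨z, u', v', h₁, h₂, h⟩
        cases h₁
        cases h₂
        exact ⟨_, _, _, rfl, rfl, (e _).map_adj_iff.2 h⟩

theorem nonempty_outGraph_iso {xs : List (List Bool)} {s k : ℕ} (hs : level xs = s)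
    (hk : commonK xs = k) (I : TernaryLeaf s → ImprovementInstance) (hI : ∀ x, (I x).k = k)
    (hxs : ∀ x, xs.getD (leafEquiv s x) [] = (I x).encode) :
    Nonempty (outGraph xs ≃g combinedGraph s k fun x => (I x).graph) := by
  subst hs hk
  refine ⟨(outIso xs).symm.trans (plugIso _ _ fun x => ?_)⟩
  have hg : Good xs (leafEquiv _ x) := by
    rw [Good, hxs]
    exact ⟨(I x).valid_encode, (I x).kField_encode.trans (hI x)⟩
  have hsize : sizeField (xs.getD (leafEquiv _ x) []) = (I x).n := by
    rw [hxs, ImprovementInstance.sizeField_encode]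
  refine hg.slotIso.trans ⟨finCongr hsize, fun {u v} => ?_⟩
  have := ((I x).adjBit_encode (finCongr hsize u) (finCongr hsize v)).symm
  rwa [← hxs] at this

theorem level_ofFn {s : ℕ} (hs : 1 ≤ s) (x : Fin (3 ^ s) → List Bool) :
    level (List.ofFn x) = s := by
  rw [level, List.length_ofFn, Nat.clog_pow _ _ (by norm_num), max_eq_right hs]

theorem getD_ofFn {n : ℕ} (x : Fin n → List Bool) (i : Fin n) : (List.ofFn x).getD i [] = x i := by
  simp [List.getD_eq_getElem?_getD]

theorem commonK_ofFn {n k : ℕ} (hn : 0 < n) (I : Fin n → ImprovementInstance)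
    (hI : ∀ i, (I i).k = k) : commonK (List.ofFn fun i => (I i).encode) = k := by
  rw [commonK, show 0 = ((⟨0, hn⟩ : Fin n) : ℕ) from rfl, getD_ofFn,
    ImprovementInstance.kField_encode, hI, ← hI ⟨0, hn⟩, max_eq_right (I _).two_le]

end CrossComp

/-! ### The main theorem. -/

theorem theorem3 :
    -- Pathwidth Improvement OR-cross-composes into `k`-Pathwidth, through the stated construction
    (∃ (R : Setoid (List Bool)) (f : List (List Bool) → List Bool × ℕ),
      CrossComp.IsPolynomialEquivalence R ∧
      CrossComp.IsORCrossComposition R f CrossComp.pathwidthImprovement CrossComp.kPathwidth ∧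
      (∀ I J : CrossComp.ImprovementInstance, I.k = J.k → R I.encode J.encode) ∧
      ∃ label : ∀ s : ℕ, Fin (3 ^ s) ≃ CrossComp.TernaryLeaf s,
        ∀ (s k : ℕ) (I : Fin (3 ^ s) → CrossComp.ImprovementInstance),
          1 ≤ s → (∀ i, (I i).k = k) →
          ∃ (N : ℕ) (G' : SimpleGraph (Fin N)),
            f (List.ofFn fun i => (I i).encode) =
              (CrossComp.encodeGraph G', k * (s + 2) - 2) ∧
            Nonempty (G' ≃g
              CrossComp.combinedGraph s k fun x => (I ((label s).symm x)).graph)) ∧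
    -- correctness of the construction
    (∀ (s k : ℕ) (V : CrossComp.TernaryLeaf s → Type*) [∀ x, Fintype (V x)]
        (G : ∀ x, SimpleGraph (V x)),
      1 ≤ s → 2 ≤ k → (∀ x, k ≤ Fintype.card (V x)) →
      (∀ x, ∃ bags : List (Finset (V x)),
        CrossComp.IsPathDecomposition (G x) bags ∧ CrossComp.width bags = k - 1) →
      (CrossComp.pathwidth (CrossComp.combinedGraph s k G) ≤ k * (s + 2) - 2 ↔
        ∃ x, CrossComp.pathwidth (G x) ≤ k - 2)) := by
  refine ⟨⟨CrossComp.paramSetoid, CrossComp.construct,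
    CrossComp.isPolynomialEquivalence_paramSetoid, CrossComp.isORCrossComposition_construct,
    fun I J h => ?_, fun s => (CrossComp.leafEquiv s).symm, fun s k I hs hI => ?_⟩,
    fun s k V _ G _ hk _ hG => ?_⟩
  · exact I.kField_encode.trans (h.trans J.kField_encode.symm)
  · have hlevel := CrossComp.level_ofFn hs fun i => (I i).encode
    have hK := CrossComp.commonK_ofFn (by positivity) I hI
    refine ⟨_, CrossComp.outGraph _, ?_, CrossComp.nonempty_outGraph_iso hlevel hK
      (fun x => I (CrossComp.leafEquiv s x)) (fun x => hI _) fun x => ?_⟩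
    · rw [CrossComp.construct, CrossComp.outParam, hlevel, hK]
    · exact CrossComp.getD_ofFn _ _
  · refine CrossComp.pathwidth_combinedGraph_le_iff G hk fun x => ?_
    obtain ⟨bags, hb, hw⟩ := hG x
    exact hb.pathwidth_le.trans_eq hw
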